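/- Let $\mathcal U\subset\mathbb R^n$ ($n$ arbitrary) be a connected open set and let $F=F(x,y)$ be a Finsler metric on $\mathcal U$: $F:\mathcal U\times\mathbb R^n\to[0,\infty)$ is $C^\infty$ for $y\ne 0$, $F(x,y)=0$ iff $y=0$, $F(x,\lambda y)=\lambda F(x,y)$ for $\lambda\ge 0$, and the matrix $g_{ij}=\frac12[F^2]_{y^iy^j}$ is positive definite for $y\neq0$. Let $$G^i=\tfrac14 g^{il}\big\{[F^2]_{x^my^l}y^m-[F^2]_{x^l}\big\},\qquad R^i_{\ k}=2\frac{\partial G^i}{\partial x^k}-\frac{\partial^2G^i}{\partial x^l\partial y^k}y^l+2G^l\frac{\partial^2G^i}{\partial y^l\partial y^k}-\frac{\partial G^i}{\partial y^l}\frac{\partial G^l}{\partial y^k}$$ be its geodesic coefficients and Riemann curvature. Assume that $F$ is projectively flat, i.e. all its geodesics (the solutions of $\ddot x^i+2G^i(x,\dot x)=0$ in $\mathcal U$ with $\dot x\ne0$) are contained in straight lines, and that $F$ has weakly isotropic flag curvature $$\mathbf K=\frac{3\theta}{F}+\sigma ,$$ where $\theta=\theta_i(x)y^i$ is a smooth $1$-form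 on $\mathcal U$ that is not identically zero and $\sigma=\sigma(x)$ is a smooth function on $\mathcal U$; that is, for all $x\in\mathcal U$ and all linearly independent $y,u\in\mathbb R^n$, $$\frac{g_{im}(x,y)R^i_{\ k}(x,y)u^ku^m}{F^2\,g_{ij}u^iu^j-(g_{ij}y^iu^j)^2}=\frac{3\theta_i(x)y^i}{F(x,y)}+\sigma(x).$$ Then $F$ is a Randers metric on $\mathcal U$: $F=\alpha+\beta$, where $\alpha=\sqrt{a_{ij}(x)y^iy^j}$ is a smooth Riemannian metric on $\mathcal U$ and $\beta=b_i(x)y^i$ is a smooth $1$-form with $\|\beta\|_\alpha=\sqrt{a^{ij}b_ib_j}<1$ at every point. -/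

import Mathlib

open scoped ContDiff

namespace Finsler

noncomputable section

/-- Partial derivative in the `k`-th position coordinate of a function `f = f(x, y)`. -/
def dX {n : ℕ} (k : Fin n) (f : (Fin n → ℝ) → (Fin n → ℝ) → ℝ) (x y : Fin n → ℝ) : ℝ :=
  fderiv ℝ (fun z => f z y) x (Pi.single k 1)

/-- Partial derivative in the `k`-th direction coordinate of a function `f = f(x, y)`. -/
def dY {n : ℕ} (k : Fin n) (f : (Fin n → ℝ) → (Fin n → ℝ) → ℝ) (x y : Fin n → ℝ) : ℝ :=
  fderiv ℝ (fun v => f x v) y (Pi.single k 1)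

/-- The function `F²`. -/
def sqF {n : ℕ} (F : (Fin n → ℝ) → (Fin n → ℝ) → ℝ) (x y : Fin n → ℝ) : ℝ :=
  F x y ^ 2

/-- The fundamental tensor `g_{ij} = ½ [F²]_{y^i y^j}`. -/
def fundTensor {n : ℕ} (F : (Fin n → ℝ) → (Fin n → ℝ) → ℝ) (x y : Fin n → ℝ) :
    Matrix (Fin n) (Fin n) ℝ :=
  Matrix.of fun i j => (1 / 2 : ℝ) * dY j (dY i (sqF F)) x y

/-- `F` is a (smooth, positively homogeneous, strongly convex) Finsler metric on the open set
`U ⊆ ℝⁿ`; its tangent bundle is `U × ℝⁿ`. Values of `F` over points outside `U` are irrelevant. -/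
structure IsFinslerMetric {n : ℕ} (U : Set (Fin n → ℝ))
    (F : (Fin n → ℝ) → (Fin n → ℝ) → ℝ) : Prop where
  smooth : ContDiffOn ℝ ∞ (fun p : (Fin n → ℝ) × (Fin n → ℝ) => F p.1 p.2) (U ×ˢ {0}ᶜ)
  nonneg : ∀ x ∈ U, ∀ y, 0 ≤ F x y
  eq_zero_iff : ∀ x ∈ U, ∀ y, F x y = 0 ↔ y = 0
  homogeneous : ∀ x ∈ U, ∀ y, ∀ c : ℝ, 0 ≤ c → F x (c • y) = c * F x y
  strongly_convex : ∀ x ∈ U, ∀ y, y ≠ 0 → (fundTensor F x y).PosDef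

/-- The geodesic coefficients
`G^i = ¼ g^{il} ( [F²]_{x^m y^l} y^m - [F²]_{x^l} )`. -/
def geodCoeff {n : ℕ} (F : (Fin n → ℝ) → (Fin n → ℝ) → ℝ) (i : Fin n) (x y : Fin n → ℝ) : ℝ :=
  (1 / 4 : ℝ) * ∑ l, (fundTensor F x y)⁻¹ i l *
    ((∑ m, dX m (dY l (sqF F)) x y * y m) - dX l (sqF F) x y)

/-- The coefficients `R^i_k` of the Riemann curvature. -/
def riemannCurv {n : ℕ} (F : (Fin n → ℝ) → (Fin n → ℝ) → ℝ) (i k : Fin n)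
    (x y : Fin n → ℝ) : ℝ :=
  2 * dX k (geodCoeff F i) x y
    - ∑ l, dX l (dY k (geodCoeff F i)) x y * y l
    + 2 * ∑ l, geodCoeff F l x y * dY l (dY k (geodCoeff F i)) x y
    - ∑ l, dY l (geodCoeff F i) x y * dY k (geodCoeff F l) x y

/-- The flag curvature `K(Π, y)` of the flag `Π = span {y, u}` with flag pole `y`, at `x`
(meaningful for linearly independent `y`, `u`). -/
def flagCurv {n : ℕ} (F : (Fin n → ℝ) → (Fin n → ℝ) → ℝ) (x y u : Fin n → ℝ) : ℝ :=
  (∑ i, ∑ m, ∑ k, fundTensor F x y i m * riemannCurv F i k x y * u k * u m) /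
    (F x y ^ 2 * (∑ i, ∑ j, fundTensor F x y i j * u i * u j)
      - (∑ i, ∑ j, fundTensor F x y i j * y i * u j) ^ 2)

/-- `F` has weakly isotropic flag curvature `K = 3θ/F + σ` on `U`, for the 1-form
`θ = θ_i(x) y^i` and the function `σ = σ(x)`: every flag `span {y, u}` with pole `y` at `x`
has this flag curvature. -/
def HasWeaklyIsotropicFlagCurv {n : ℕ} (U : Set (Fin n → ℝ))
    (F : (Fin n → ℝ) → (Fin n → ℝ) → ℝ) (θ : (Fin n → ℝ) → (Fin n → ℝ))
    (σ : (Fin n → ℝ) → ℝ) : Prop :=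
  ∀ x ∈ U, ∀ y u : Fin n → ℝ, LinearIndependent ℝ ![y, u] →
    flagCurv F x y u = 3 * (∑ i, θ x i * y i) / F x y + σ x

/-- `γ`, restricted to the open interval `I`, is a (nonconstant) geodesic of `F` in `U`:
`γ'' + 2 G(γ, γ') = 0`. -/
structure IsGeodesicOn {n : ℕ} (U : Set (Fin n → ℝ)) (F : (Fin n → ℝ) → (Fin n → ℝ) → ℝ)
    (I : Set ℝ) (γ : ℝ → (Fin n → ℝ)) : Prop where
  isOpen : IsOpen I
  ordConnected : I.OrdConnected
  mem : ∀ t ∈ I, γ t ∈ U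
  differentiable : ∀ t ∈ I, DifferentiableAt ℝ γ t
  velocity_ne_zero : ∀ t ∈ I, deriv γ t ≠ 0
  geodesic_eq : ∀ t ∈ I,
    HasDerivAt (deriv γ) (fun i => -(2 * geodCoeff F i (γ t) (deriv γ t))) t

/-- `F` is projectively flat in `U`: all its geodesics are straight lines. -/
def IsProjectivelyFlat {n : ℕ} (U : Set (Fin n → ℝ))
    (F : (Fin n → ℝ) → (Fin n → ℝ) → ℝ) : Prop :=
  ∀ (I : Set ℝ) (γ : ℝ → (Fin n → ℝ)), IsGeodesicOn U F I γ → Collinear ℝ (γ '' I)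

/-- `F` is a Randers metric on `U`: `F = α + β` with `α = √(a_{ij}(x) y^i y^j)` a (smooth)
Riemannian metric and `β = b_i(x) y^i` a (smooth) 1-form with
`‖β‖_α = √(a^{ij} b_i b_j) < 1` at every point. -/
def IsRandersMetric {n : ℕ} (U : Set (Fin n → ℝ))
    (F : (Fin n → ℝ) → (Fin n → ℝ) → ℝ) : Prop :=
  ∃ (a : (Fin n → ℝ) → Matrix (Fin n) (Fin n) ℝ) (b : (Fin n → ℝ) → (Fin n → ℝ)),
    (∀ i j, ContDiffOn ℝ ∞ (fun x => a x i j) U) ∧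
    ContDiffOn ℝ ∞ b U ∧
    (∀ x ∈ U, (a x).PosDef) ∧
    (∀ x ∈ U, Real.sqrt (∑ i, ∑ j, (a x)⁻¹ i j * b x i * b x j) < 1) ∧
    ∀ x ∈ U, ∀ y, F x y = Real.sqrt (∑ i, ∑ j, a x i j * y i * y j) + ∑ i, b x i * y i

end

end Finsler

/-! Projective flatness forces Gⁱ = P yⁱ with a factor P of degree one in y, and for n ≥ 2 the
curvature hypothesis becomes a first order system (`ProjSystem`): F and P have their x-derivatives
expressed through y-derivatives, with θ and σ as coefficients. In the direction y it reads F' = 2PF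
and P' = P² − 3θF − σF².

Write c = (∂_y θ)(y) and s = dσ(y). Symmetry of the second derivatives of P makes θ closed and makes
(2θP − c − sF)/F² independent of y (`form_closed`, `exists_quotient`). Hence 2θP = c + sF + fF² with
f = f(x). Differentiating this relation along y and eliminating P shows that F is a root of a
quartic whose coefficients are polynomial in y (`quartic`).

The system is invariant under reflection, so G(x, y) = −F(x, −y) is a root of the same quartic, and
F > 0 > G. For a Randers metric F + G = 2β and FG = β² − α²; conversely it suffices that F + G be
linear and FG quadratic in y (`isRandersMetric_of_isLinQuad`). So F and G have to be split off from
the quartic as a quadratic factor with polynomial coefficients.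

In a direction of ker θ the relation says that F and G are the roots of q = c + sT + fT², and the
quartic factors as q h. Where f ≠ 0, differentiating the quartic twice more yields two further
polynomial equations for F and G; the gcd of the three specializes on ker θ to a divisor prime to h,
so it has degree two (`exists_polynomial_sum_prod`). Where f vanishes on an open set the quartic
drops to a quadratic, divisible by the square of the parameter of the line; its leading coefficient
cannot vanish on an open set (`exists_leading_ne_zero`). Homogeneity and continuity extend the
conclusion to every point where θ ≠ 0.

The zeros of θ require unique continuation. Linearity of F + G where θ ≠ 0 yields a function L with
dL = θ, f = L(L² + σ), dσ = 6Lθ and df = (9L² + σ)θ (`exists_root`). Therefore dσ and df are bounded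
by θ, and along a segment of direction u the pair (θ(u), f) obeys a linear differential inequality
(`propagate`). If θ vanished on an open set it would vanish on the connected set U; so {θ ≠ 0} is
dense and continuity concludes. -/

namespace Finsler

open Set Filter Topology

/-! ### The differential system of a projectively flat metric -/

section

variable {E : Type*} [NormedAddCommGroup E] [NormedSpace ℝ E]

/-- A nowhere vanishing function `F` on the slit tangent bundle of `U`, positively homogeneous of
degree one, together with its projective factor `P`, satisfying the equations that express
projective flatness and the flag curvature `3θ/F + σ`. -/
structure ProjSystem (U : Set E) (ϑ : E → E →L[ℝ] ℝ) (σ : E → ℝ) (F P : E × E → ℝ) : Prop where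
  isOpen : IsOpen U
  smooth_form : ContDiffOn ℝ ∞ ϑ U
  smooth_fun : ContDiffOn ℝ ∞ σ U
  smooth_F : ContDiffOn ℝ ∞ F (U ×ˢ {0}ᶜ)
  smooth_P : ContDiffOn ℝ ∞ P (U ×ˢ {0}ᶜ)
  hom_F : ∀ x ∈ U, ∀ y, y ≠ 0 → ∀ c : ℝ, 0 < c → F (x, c • y) = c * F (x, y)
  hom_P : ∀ x ∈ U, ∀ y, y ≠ 0 → ∀ c : ℝ, 0 < c → P (x, c • y) = c * P (x, y)
  F_ne : ∀ x ∈ U, ∀ y, y ≠ 0 → F (x, y) ≠ 0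
  dX_F : ∀ x ∈ U, ∀ y, y ≠ 0 → ∀ w, fderiv ℝ F (x, y) (w, 0) =
    P (x, y) * fderiv ℝ F (x, y) (0, w) + F (x, y) * fderiv ℝ P (x, y) (0, w)
  dX_P : ∀ x ∈ U, ∀ y, y ≠ 0 → ∀ w, fderiv ℝ P (x, y) (w, 0) =
    P (x, y) * fderiv ℝ P (x, y) (0, w) - ϑ x w * F (x, y)
      - 2 * ϑ x y * fderiv ℝ F (x, y) (0, w) - σ x * F (x, y) * fderiv ℝ F (x, y) (0, w)

theorem isOpen_slit {E : Type*} [NormedAddCommGroup E] {U : Set E} (hU : IsOpen U) :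
    IsOpen (U ×ˢ ({0}ᶜ : Set E)) :=
  hU.prod isOpen_compl_singleton

theorem slit_mem_nhds {E : Type*} [NormedAddCommGroup E] {U : Set E} (hU : IsOpen U)
    {x y : E} (hx : x ∈ U) (hy : y ≠ 0) :
    U ×ˢ ({0}ᶜ : Set E) ∈ 𝓝 (x, y) :=
  (isOpen_slit hU).mem_nhds ⟨hx, hy⟩

/-- Euler's relation for positively homogeneous functions of degree `k`. -/
theorem fderiv_radial {f : E × E → ℝ} {x y : E} (k : ℕ) (hf : DifferentiableAt ℝ f (x, y))
    (hom : ∀ c : ℝ, 0 < c → f (x, c • y) = c ^ k * f (x, y)) :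
    fderiv ℝ f (x, y) (0, y) = k * f (x, y) := by
  have h1 : HasDerivAt (fun c : ℝ => (x, c • y)) ((0 : E), y) 1 := by
    have := (hasDerivAt_id (1 : ℝ)).smul_const y
    simpa using (hasDerivAt_const (1 : ℝ) x).prodMk this
  have hf' : HasFDerivAt f (fderiv ℝ f (x, y)) (x, (1 : ℝ) • y) := by
    simpa using hf.hasFDerivAt
  have h2 := hf'.comp_hasDerivAt (1 : ℝ) h1
  have h3 : HasDerivAt (fun c : ℝ => c ^ k * f (x, y)) (k * f (x, y)) 1 := by
    simpa using (hasDerivAt_pow k (1 : ℝ)).mul_const (f (x, y))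
  refine h2.unique (h3.congr_of_eventuallyEq ?_)
  filter_upwards [lt_mem_nhds (zero_lt_one : (0 : ℝ) < 1)] with c hc
  exact hom c hc

namespace ProjSystem

variable {U : Set E} {ϑ : E → E →L[ℝ] ℝ} {σ : E → ℝ} {F P : E × E → ℝ}

theorem contDiffAt_F (S : ProjSystem U ϑ σ F P) {x y : E} (hx : x ∈ U) (hy : y ≠ 0) :
    ContDiffAt ℝ ∞ F (x, y) :=
  S.smooth_F.contDiffAt (slit_mem_nhds S.isOpen hx hy)

theorem contDiffAt_P (S : ProjSystem U ϑ σ F P) {x y : E} (hx : x ∈ U) (hy : y ≠ 0) :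
    ContDiffAt ℝ ∞ P (x, y) :=
  S.smooth_P.contDiffAt (slit_mem_nhds S.isOpen hx hy)

theorem contDiffAt_form (S : ProjSystem U ϑ σ F P) {x : E} (hx : x ∈ U) : ContDiffAt ℝ ∞ ϑ x :=
  S.smooth_form.contDiffAt (S.isOpen.mem_nhds hx)

theorem contDiffAt_fun (S : ProjSystem U ϑ σ F P) {x : E} (hx : x ∈ U) : ContDiffAt ℝ ∞ σ x :=
  S.smooth_fun.contDiffAt (S.isOpen.mem_nhds hx)

theorem dY_F_self (S : ProjSystem U ϑ σ F P) {x y : E} (hx : x ∈ U) (hy : y ≠ 0) :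
    fderiv ℝ F (x, y) (0, y) = F (x, y) := by
  have := fderiv_radial (f := F) 1 ((S.contDiffAt_F hx hy).differentiableAt (by simp))
    (fun c hc => by rw [S.hom_F x hx y hy c hc, pow_one])
  simpa using this

theorem dY_P_self (S : ProjSystem U ϑ σ F P) {x y : E} (hx : x ∈ U) (hy : y ≠ 0) :
    fderiv ℝ P (x, y) (0, y) = P (x, y) := by
  have := fderiv_radial (f := P) 1 ((S.contDiffAt_P hx hy).differentiableAt (by simp))
    (fun c hc => by rw [S.hom_P x hx y hy c hc, pow_one])
  simpa using this

theorem spray_F (S : ProjSystem U ϑ σ F P) {x y : E} (hx : x ∈ U) (hy : y ≠ 0) :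
    fderiv ℝ F (x, y) (y, 0) = 2 * P (x, y) * F (x, y) := by
  rw [S.dX_F x hx y hy y, S.dY_F_self hx hy, S.dY_P_self hx hy]; ring

theorem spray_P (S : ProjSystem U ϑ σ F P) {x y : E} (hx : x ∈ U) (hy : y ≠ 0) :
    fderiv ℝ P (x, y) (y, 0) =
      P (x, y) ^ 2 - 3 * ϑ x y * F (x, y) - σ x * F (x, y) ^ 2 := by
  rw [S.dX_P x hx y hy y, S.dY_F_self hx hy, S.dY_P_self hx hy]; ring

end ProjSystem

theorem hasFDerivAt_fderiv_apply {V : Type*} [NormedAddCommGroup V] [NormedSpace ℝ V]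
    {f : V → ℝ} {p : V} (hf : ContDiffAt ℝ ∞ f p) (d : V) :
    HasFDerivAt (fun q => fderiv ℝ f q d) ((fderiv ℝ (fderiv ℝ f) p).flip d) p := by
  have h1 : DifferentiableAt ℝ (fderiv ℝ f) p :=
    (hf.fderiv_right (m := 1) (by
      rw [one_add_one_eq_two]
      exact WithTop.coe_le_coe.2 (le_top : (2 : ℕ∞) ≤ ⊤))).differentiableAt (by simp)
  have := h1.hasFDerivAt.clm_apply (hasFDerivAt_const d p)
  refine this.congr_fderiv ?_
  ext; simp

theorem second_fderiv_symm {V : Type*} [NormedAddCommGroup V] [NormedSpace ℝ V]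
    {f : V → ℝ} {p : V} (hf : ContDiffAt ℝ ∞ f p) (d e : V) :
    fderiv ℝ (fderiv ℝ f) p d e = fderiv ℝ (fderiv ℝ f) p e d :=
  (hf.isSymmSndFDerivAt (by simpa using WithTop.coe_le_coe.2 (le_top : (2 : ℕ∞) ≤ ⊤))) d e

theorem hasFDerivAt_form {ϑ : E → E →L[ℝ] ℝ} {x y : E} (h : DifferentiableAt ℝ ϑ x) :
    HasFDerivAt (fun q : E × E => ϑ q.1 q.2)
      (((fderiv ℝ ϑ x).flip y).comp (ContinuousLinearMap.fst ℝ E E)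
        + (ϑ x).comp (ContinuousLinearMap.snd ℝ E E)) (x, y) := by
  have h1 : HasFDerivAt (fun q : E × E => ϑ q.1)
      ((fderiv ℝ ϑ x).comp (ContinuousLinearMap.fst ℝ E E)) (x, y) :=
    HasFDerivAt.comp (x, y) (g := ϑ) (f := Prod.fst) h.hasFDerivAt hasFDerivAt_fst
  have := h1.clm_apply (hasFDerivAt_snd (𝕜 := ℝ) (p := (x, y)))
  refine this.congr_fderiv ?_
  ext <;> simp

theorem hasFDerivAt_form_const {ϑ : E → E →L[ℝ] ℝ} {x y : E} (w : E)
    (h : DifferentiableAt ℝ ϑ x) :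
    HasFDerivAt (fun q : E × E => ϑ q.1 w)
      (((fderiv ℝ ϑ x).flip w).comp (ContinuousLinearMap.fst ℝ E E)) (x, y) := by
  have h1 : HasFDerivAt (fun q : E × E => ϑ q.1)
      ((fderiv ℝ ϑ x).comp (ContinuousLinearMap.fst ℝ E E)) (x, y) :=
    HasFDerivAt.comp (x, y) (g := ϑ) (f := Prod.fst) h.hasFDerivAt hasFDerivAt_fst
  have := h1.clm_apply (hasFDerivAt_const w (x, y))
  refine this.congr_fderiv ?_
  ext <;> simp

theorem hasFDerivAt_base {σ : E → ℝ} {x y : E} (h : DifferentiableAt ℝ σ x) :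
    HasFDerivAt (fun q : E × E => σ q.1)
      ((fderiv ℝ σ x).comp (ContinuousLinearMap.fst ℝ E E)) (x, y) :=
  HasFDerivAt.comp (x, y) (g := σ) (f := Prod.fst) h.hasFDerivAt hasFDerivAt_fst

namespace ProjSystem

variable {U : Set E} {ϑ : E → E →L[ℝ] ℝ} {σ : E → ℝ} {F P : E × E → ℝ}

theorem second_F (S : ProjSystem U ϑ σ F P) {x y : E} (hx : x ∈ U) (hy : y ≠ 0) (w : E)
    (e : E × E) :
    fderiv ℝ (fderiv ℝ F) (x, y) e (w, 0) =
      fderiv ℝ P (x, y) e * fderiv ℝ F (x, y) (0, w)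
      + P (x, y) * fderiv ℝ (fderiv ℝ F) (x, y) e (0, w)
      + fderiv ℝ F (x, y) e * fderiv ℝ P (x, y) (0, w)
      + F (x, y) * fderiv ℝ (fderiv ℝ P) (x, y) e (0, w) := by
  have hF := S.contDiffAt_F hx hy
  have hP := S.contDiffAt_P hx hy
  have hF1 := (hF.differentiableAt (by simp)).hasFDerivAt
  have hP1 := (hP.differentiableAt (by simp)).hasFDerivAt
  have h := (hP1.mul (hasFDerivAt_fderiv_apply hF (0, w))).add
    (hF1.mul (hasFDerivAt_fderiv_apply hP (0, w)))
  have h' := h.congr_of_eventuallyEq (f₁ := fun q => fderiv ℝ F q (w, 0)) (by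
    filter_upwards [slit_mem_nhds S.isOpen hx hy] with q hq
    exact S.dX_F q.1 hq.1 q.2 hq.2 w)
  have := congrArg (fun L => L e) ((hasFDerivAt_fderiv_apply hF (w, 0)).unique h')
  simp at this
  rw [this]; ring

theorem second_P (S : ProjSystem U ϑ σ F P) {x y : E} (hx : x ∈ U) (hy : y ≠ 0) (w : E)
    (e : E × E) :
    fderiv ℝ (fderiv ℝ P) (x, y) e (w, 0) =
      fderiv ℝ P (x, y) e * fderiv ℝ P (x, y) (0, w)
      + P (x, y) * fderiv ℝ (fderiv ℝ P) (x, y) e (0, w)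
      - fderiv ℝ ϑ x e.1 w * F (x, y) - ϑ x w * fderiv ℝ F (x, y) e
      - 2 * (fderiv ℝ ϑ x e.1 y + ϑ x e.2) * fderiv ℝ F (x, y) (0, w)
      - 2 * ϑ x y * fderiv ℝ (fderiv ℝ F) (x, y) e (0, w)
      - fderiv ℝ σ x e.1 * F (x, y) * fderiv ℝ F (x, y) (0, w)
      - σ x * fderiv ℝ F (x, y) e * fderiv ℝ F (x, y) (0, w)
      - σ x * F (x, y) * fderiv ℝ (fderiv ℝ F) (x, y) e (0, w) := by
  have hF := S.contDiffAt_F hx hy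
  have hP := S.contDiffAt_P hx hy
  have hϑ := (S.contDiffAt_form hx).differentiableAt (by simp)
  have hσ := (S.contDiffAt_fun hx).differentiableAt (by simp)
  have hF1 := (hF.differentiableAt (by simp)).hasFDerivAt
  have hP1 := (hP.differentiableAt (by simp)).hasFDerivAt
  have hFw := hasFDerivAt_fderiv_apply hF (0, w)
  have h := (((hP1.mul (hasFDerivAt_fderiv_apply hP (0, w))).sub
    ((hasFDerivAt_form_const (y := y) w hϑ).mul hF1)).sub
    (((hasFDerivAt_form (y := y) hϑ).const_mul 2).mul hFw)).sub
    (((hasFDerivAt_base (y := y) hσ).mul hF1).mul hFw)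
  have h' := h.congr_of_eventuallyEq (f₁ := fun q => fderiv ℝ P q (w, 0)) (by
    filter_upwards [slit_mem_nhds S.isOpen hx hy] with q hq
    exact S.dX_P q.1 hq.1 q.2 hq.2 w)
  have := congrArg (fun L => L e) ((hasFDerivAt_fderiv_apply hP (w, 0)).unique h')
  simp at this
  rw [this]; ring

/-- The integrability condition of the system. -/
theorem integrability (S : ProjSystem U ϑ σ F P) {x y : E} (hx : x ∈ U) (hy : y ≠ 0) (v w : E) :
    fderiv ℝ F (x, y) (0, v) *
      (2 * (ϑ x w * P (x, y) + ϑ x y * fderiv ℝ P (x, y) (0, w)) - 2 * fderiv ℝ ϑ x w y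
        - fderiv ℝ σ x w * F (x, y))
    - fderiv ℝ F (x, y) (0, w) *
      (2 * (ϑ x v * P (x, y) + ϑ x y * fderiv ℝ P (x, y) (0, v)) - 2 * fderiv ℝ ϑ x v y
        - fderiv ℝ σ x v * F (x, y))
    = (fderiv ℝ ϑ x w v - fderiv ℝ ϑ x v w) * F (x, y) := by
  have hF := S.contDiffAt_F hx hy
  have hP := S.contDiffAt_P hx hy
  have a1 := S.second_P hx hy w (v, 0)
  have a2 := S.second_P hx hy v (w, 0)
  have b1 := S.second_P hx hy v (0, w)
  have b2 := S.second_P hx hy w (0, v)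
  have c1 := S.second_F hx hy v (0, w)
  have c2 := S.second_F hx hy w (0, v)
  have d1 := S.dX_F x hx y hy v
  have d2 := S.dX_F x hx y hy w
  have e1 := S.dX_P x hx y hy v
  have e2 := S.dX_P x hx y hy w
  -- `a1` and `a2` now express the same mixed horizontal derivative of P in two ways. The remaining
  -- rewrites reduce both to first derivatives and vertical Hessians; the Hessians are symmetric and
  -- cancel.
  rw [second_fderiv_symm hP (v, 0) (w, 0)] at a1
  rw [second_fderiv_symm hP (v, 0) (0, w), second_fderiv_symm hF (v, 0) (0, w)] at a1
  rw [second_fderiv_symm hP (w, 0) (0, v), second_fderiv_symm hF (w, 0) (0, v)] at a2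
  rw [second_fderiv_symm hP (0, w) (0, v), second_fderiv_symm hF (0, w) (0, v)] at b1
  rw [second_fderiv_symm hP (0, w) (0, v), second_fderiv_symm hF (0, w) (0, v)] at c1
  simp only [map_zero, zero_apply, zero_add, add_zero, zero_mul, sub_zero] at a1 a2 b1 b2
  rw [b1, c1, d1, e1] at a1
  rw [b2, c2, d2, e2] at a2
  rw [a2] at a1
  linear_combination a1

end ProjSystem

end

/-! ### Consequences of integrability -/

section

variable {E : Type*} [NormedAddCommGroup E] [NormedSpace ℝ E]

theorem hasFDerivAt_fiber {f : E × E → ℝ} {x y : E} (hf : DifferentiableAt ℝ f (x, y)) :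
    HasFDerivAt (fun z => f (x, z))
      ((fderiv ℝ f (x, y)).comp (ContinuousLinearMap.inr ℝ E E)) y :=
  HasFDerivAt.comp y (g := f) (f := fun z => (x, z)) hf.hasFDerivAt (hasFDerivAt_prodMk_right x y)

namespace ProjSystem

variable {U : Set E} {ϑ : E → E →L[ℝ] ℝ} {σ : E → ℝ} {F P : E × E → ℝ}

/-- This is `integrability` with one of its two directions equal to y, where Euler's relation
removes the derivatives of F and P in that direction. Only dθ survives on the right. -/
theorem hasFDerivAt_quotient (S : ProjSystem U ϑ σ F P) {x y : E} (hx : x ∈ U) (hy : y ≠ 0) :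
    HasFDerivAt (fun z => (2 * ϑ x z * P (x, z) - fderiv ℝ ϑ x z z - fderiv ℝ σ x z * F (x, z))
        / F (x, z) ^ 2)
      ((2 / F (x, y) ^ 2) • ((fderiv ℝ ϑ x).flip y - fderiv ℝ ϑ x y)) y := by
  have hF := hasFDerivAt_fiber ((S.contDiffAt_F hx hy).differentiableAt (by simp))
  have hP := hasFDerivAt_fiber ((S.contDiffAt_P hx hy).differentiableAt (by simp))
  have hϑ : HasFDerivAt (fun z => 2 * ϑ x z) _ y := (ϑ x).hasFDerivAt.const_mul 2
  have hσ : HasFDerivAt (fun z => fderiv ℝ σ x z) _ y := (fderiv ℝ σ x).hasFDerivAt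
  have hT : HasFDerivAt (fun z => fderiv ℝ ϑ x z z) _ y :=
    (fderiv ℝ ϑ x).hasFDerivAt.clm_apply (hasFDerivAt_id y)
  have hne := S.F_ne x hx y hy
  have h := (((hϑ.mul hP).sub hT).sub (hσ.mul hF)).mul
    ((hasDerivAt_inv (pow_ne_zero 2 hne)).comp_hasFDerivAt y (hF.pow 2))
  simp only [div_eq_mul_inv (_ - _)]
  refine h.congr_fderiv ?_
  ext w
  have key := S.integrability hx hy w y
  rw [S.dY_F_self hx hy, S.dY_P_self hx hy] at key
  simp
  field_simp
  linear_combination -key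

/-- The 1-form of the system is closed. -/
theorem form_closed (S : ProjSystem U ϑ σ F P) {x : E} (hx : x ∈ U) (a b : E) :
    fderiv ℝ ϑ x a b = fderiv ℝ ϑ x b a := by
  by_cases hab : LinearIndependent ℝ ![a, b]
  · have hne : ∀ t : ℝ, Real.cos t • a + Real.sin t • b ≠ 0 := by
      intro t h
      have := LinearIndependent.pair_iff.1 hab _ _ h
      have h1 := Real.cos_sq_add_sin_sq t
      rw [this.1, this.2] at h1
      norm_num at h1
    set g : ℝ → E := fun t => Real.cos t • a + Real.sin t • b with hg
    have hder : ∀ t : ℝ, HasDerivAt g (-Real.sin t • a + Real.cos t • b) t := fun t =>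
      ((Real.hasDerivAt_cos t).smul_const a).add ((Real.hasDerivAt_sin t).smul_const b)
    have hcomp := fun t => (S.hasFDerivAt_quotient hx (hne t)).comp_hasDerivAt t (hder t)
    -- Rolle's theorem on the circle through a and b: the quotient takes the same value at both
    -- ends, and its derivative is dθ(a, b), up to sign, times the nowhere vanishing 2/F².
    obtain ⟨t, -, ht⟩ := exists_hasDerivAt_eq_zero (Real.two_pi_pos)
      (fun t _ => (hcomp t).continuousAt.continuousWithinAt)
      (by simp [hg]) (fun t _ => hcomp t)
    have hF := S.F_ne x hx _ (hne t)
    have h2 : 2 / F (x, g t) ^ 2 ≠ 0 := div_ne_zero two_ne_zero (pow_ne_zero 2 hF)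
    simp only [smul_apply, sub_apply, smul_eq_mul, mul_eq_zero,
      ContinuousLinearMap.flip_apply] at ht
    have ht := ht.resolve_left h2
    simp at ht
    linear_combination (-1 : ℝ) * ht -
      (fderiv ℝ ϑ x a b - fderiv ℝ ϑ x b a) * Real.cos_sq_add_sin_sq t
  · by_cases ha : a = 0
    · simp [ha]
    · rw [LinearIndependent.pair_iff' ha] at hab
      push Not at hab
      obtain ⟨r, rfl⟩ := hab
      simp

/-- Since θ is closed, the quotient has zero vertical derivative, hence is constant on the punctured
fibre, which is connected in dimension at least two. Reading the constant off at one fixed vector e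
shows that it is smooth in x. -/
theorem exists_quotient (S : ProjSystem U ϑ σ F P) (hE : 1 < Module.rank ℝ E) :
    ∃ f : E → ℝ, ContDiffOn ℝ ∞ f U ∧ ∀ x ∈ U, ∀ y, y ≠ 0 →
      2 * ϑ x y * P (x, y) =
        fderiv ℝ ϑ x y y + fderiv ℝ σ x y * F (x, y) + f x * F (x, y) ^ 2 := by
  have : Nontrivial E := by
    rw [← rank_pos_iff_nontrivial (R := ℝ)]
    exact lt_trans zero_lt_one hE
  obtain ⟨e, he⟩ := exists_ne (0 : E)
  refine ⟨fun x => (2 * ϑ x e * P (x, e) - fderiv ℝ ϑ x e e - fderiv ℝ σ x e * F (x, e))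
        / F (x, e) ^ 2, ?_, ?_⟩
  · intro x hx
    apply ContDiffAt.contDiffWithinAt
    have hF : ContDiffAt ℝ ∞ (fun x => F (x, e)) x :=
      ContDiffAt.comp x (g := F) (f := fun x => (x, e)) (S.contDiffAt_F hx he) (by fun_prop)
    have hP : ContDiffAt ℝ ∞ (fun x => P (x, e)) x :=
      ContDiffAt.comp x (g := P) (f := fun x => (x, e)) (S.contDiffAt_P hx he) (by fun_prop)
    have hϑ := S.contDiffAt_form hx
    have hσ := S.contDiffAt_fun hx
    have hϑ' : ContDiffAt ℝ ∞ (fderiv ℝ ϑ) x := hϑ.fderiv_right (by simp)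
    have hσ' : ContDiffAt ℝ ∞ (fderiv ℝ σ) x := hσ.fderiv_right (by simp)
    have hne := S.F_ne x hx e he
    refine ContDiffAt.div ?_ (hF.pow 2) (pow_ne_zero 2 hne)
    exact (((contDiffAt_const.mul (hϑ.clm_apply contDiffAt_const)).mul hP).sub
      ((hϑ'.clm_apply contDiffAt_const).clm_apply contDiffAt_const)).sub
      ((hσ'.clm_apply contDiffAt_const).mul hF)
  · intro x hx y hy
    have hconst : (2 * ϑ x y * P (x, y) - fderiv ℝ ϑ x y y - fderiv ℝ σ x y * F (x, y))
        / F (x, y) ^ 2 = (2 * ϑ x e * P (x, e) - fderiv ℝ ϑ x e e - fderiv ℝ σ x e * F (x, e))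
        / F (x, e) ^ 2 := by
      refine IsOpen.is_const_of_fderiv_eq_zero (𝕜 := ℝ) (s := ({0}ᶜ : Set E))
        (f := fun z => (2 * ϑ x z * P (x, z) - fderiv ℝ ϑ x z z - fderiv ℝ σ x z * F (x, z))
        / F (x, z) ^ 2) isOpen_compl_singleton
        (isConnected_compl_singleton_of_one_lt_rank hE 0).isPreconnected ?_ ?_ hy he
      · intro z hz
        exact (S.hasFDerivAt_quotient hx hz).differentiableAt.differentiableWithinAt
      · intro z hz
        rw [(S.hasFDerivAt_quotient hx hz).fderiv]
        ext w
        simp [S.form_closed hx z w]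
    have hne := S.F_ne x hx y hy
    simp only
    rw [← hconst]
    field_simp
    ring

end ProjSystem

end

/-! ### Common factors of bivariate polynomials -/

section

section PolynomialAlgebra

open Polynomial

/-- Over an integrally closed domain, a monic polynomial and two further polynomials have a monic
common divisor which is their gcd over the fraction field. -/
theorem exists_monic_gcd {R : Type*} [CommRing R] [IsDomain R] [IsIntegrallyClosed R]
    {M : R[X]} (hM : M.Monic) (N₁ N₂ : R[X]) :
    ∃ g : R[X], g.Monic ∧ g ∣ M ∧ g ∣ N₁ ∧ g ∣ N₂ ∧
      ∃ d : R, d ≠ 0 ∧ ∃ a b c : R[X], C d * g = a * M + b * N₁ + c * N₂ := by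
  let K := FractionRing R
  let ι := algebraMap R K
  have hι : Function.Injective ι := IsFractionRing.injective R K
  have hM0 : M.map ι ≠ 0 := (hM.map ι).ne_zero
  let I : Ideal K[X] := Ideal.span {M.map ι, N₁.map ι, N₂.map ι}
  let γ := Submodule.IsPrincipal.generator I
  have hdvd : ∀ p ∈ I, γ ∣ p := fun p hp =>
    (Submodule.IsPrincipal.mem_iff_generator_dvd I).1 hp
  have h0 := hdvd (M.map ι) (Ideal.subset_span (by simp))
  have h1 := hdvd (N₁.map ι) (Ideal.subset_span (by simp))
  have h2 := hdvd (N₂.map ι) (Ideal.subset_span (by simp))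
  have hγ0 : γ ≠ 0 := ne_zero_of_dvd_ne_zero hM0 h0
  -- Gauss's lemma: over an integrally closed domain a divisor of a monic polynomial over the
  -- fraction field is, up to a constant, defined over the domain itself.
  obtain ⟨g, hg⟩ := IsIntegrallyClosed.eq_map_mul_C_of_dvd K hM h0
  have hl : γ.leadingCoeff ≠ 0 := leadingCoeff_ne_zero.2 hγ0
  have hmon : g.Monic := by
    have := congrArg leadingCoeff hg
    rw [leadingCoeff_mul, leadingCoeff_C] at this
    have h3 : (g.map ι).leadingCoeff = 1 := by
      exact mul_right_cancel₀ hl (by rw [one_mul]; exact this)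
    rw [leadingCoeff_map_of_injective hι] at h3
    exact hι (by rw [h3, map_one])
  have hgd : ∀ {p : R[X]}, γ ∣ p.map ι → g ∣ p := by
    intro p hp
    rw [← Polynomial.map_dvd_map ι hι hmon]
    exact dvd_trans ⟨_, hg.symm⟩ hp
  refine ⟨g, hmon, hgd h0, hgd h1, hgd h2, ?_⟩
  have hmem : g.map ι ∈ I := by
    have h4 : γ ∈ I := Submodule.IsPrincipal.generator_mem I
    have h5 : g.map ι = C (γ.leadingCoeff⁻¹) * γ := by
      have h6 : C (γ.leadingCoeff⁻¹) * (g.map ι * C γ.leadingCoeff) = C (γ.leadingCoeff⁻¹) * γ :=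
        congrArg _ hg
      rw [← h6, mul_left_comm, ← C_mul, inv_mul_cancel₀ hl, C_1, mul_one]
    rw [h5]
    exact I.mul_mem_left _ h4
  obtain ⟨a, b, c, habc⟩ := Submodule.mem_span_triple.1 hmem
  simp only [smul_eq_mul] at habc
  -- Clearing the denominators of the three Bézout coefficients produces the factor d.
  have clear : ∀ p : K[X], ∃ d : R, d ≠ 0 ∧ ∃ q : R[X], q.map ι = C (ι d) * p := by
    intro p
    obtain ⟨d, hd0, hd⟩ := IsLocalization.integerNormalization_spec (nonZeroDivisors R) p
    refine ⟨d, nonZeroDivisors.ne_zero hd0, _, hd.trans ?_⟩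
    rw [← algebraMap_smul K d p, smul_eq_C_mul]
  obtain ⟨d₁, hd₁, a', ha⟩ := clear a
  obtain ⟨d₂, hd₂, b', hb⟩ := clear b
  obtain ⟨d₃, hd₃, c', hc⟩ := clear c
  refine ⟨d₁ * d₂ * d₃, mul_ne_zero (mul_ne_zero hd₁ hd₂) hd₃,
    C (d₂ * d₃) * a', C (d₁ * d₃) * b', C (d₁ * d₂) * c', ?_⟩
  apply Polynomial.map_injective ι hι
  simp only [Polynomial.map_mul, Polynomial.map_add, Polynomial.map_C, map_mul, ha, hb, hc]
  rw [← habc]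
  ring

theorem continuous_evalEval {F : ℝ → ℝ} (hF : Continuous F) (p : ℝ[X][X]) :
    Continuous fun v => p.evalEval v (F v) := by
  induction p using Polynomial.induction_on' with
  | add p q hp hq => 
    simp only [evalEval_add]
    exact hp.add hq
  | monomial n a =>
    have : (fun v => (monomial n a).evalEval v (F v)) = fun v => a.eval v * F v ^ n := by
      funext v
      rw [← C_mul_X_pow_eq_monomial]
      simp [evalEval_mul, evalEval_pow, evalEval_X, evalEval_C]
    rw [this]
    exact a.continuous.mul (hF.pow n)

/-- Away from the finitely many roots of d the function φ vanishes, and the complement of a finite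
set is dense. This allows division by a polynomial in the parameter of a line. -/
theorem eq_zero_of_polynomial_mul_eq_zero {φ : ℝ → ℝ} (hφ : Continuous φ) {d : ℝ[X]} (hd : d ≠ 0)
    (h : ∀ v, d.eval v * φ v = 0) (v : ℝ) : φ v = 0 := by
  have hfin : {v | d.eval v = 0}.Finite := by
    refine (d.roots.toFinset.finite_toSet).subset ?_
    intro v hv
    simpa [hd] using hv
  have hdense : Dense {v | d.eval v = 0}ᶜ := hfin.countable.dense_compl ℝ
  have hclosed : IsClosed {v | φ v = 0} := isClosed_eq hφ continuous_const
  have : {v | φ v = 0} = univ := by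
    rw [← hclosed.closure_eq]
    refine (hdense.mono ?_).closure_eq
    intro v hv
    exact (mul_eq_zero.1 (h v)).resolve_left hv
  exact (this ▸ mem_univ v : v ∈ {v | φ v = 0})

/-- If `F > 0 > G` are roots of a quartic and of its two first prolongations, whose specializations
at `0` are as below, then `F + G` and `F * G` are polynomials. -/
theorem exists_polynomial_sum_prod {F G : ℝ → ℝ} (hF : Continuous F) (hG : Continuous G)
    (hFpos : ∀ v, 0 < F v) (hGneg : ∀ v, G v < 0) {f : ℝ} (hf : f ≠ 0)
    {M N₁ N₂ : ℝ[X][X]} (hM : M.Monic)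
    (hMF : ∀ v, M.evalEval v (F v) = 0) (hMG : ∀ v, M.evalEval v (G v) = 0)
    (h1F : ∀ v, N₁.evalEval v (F v) = 0) (h1G : ∀ v, N₁.evalEval v (G v) = 0)
    (h2F : ∀ v, N₂.evalEval v (F v) = 0) (h2G : ∀ v, N₂.evalEval v (G v) = 0)
    {q h : ℝ[X]} (hq : q = C f * (X - C (F 0)) * (X - C (G 0)))
    (hh : h = C (3 * f * F 0 * G 0) + C (f * (F 0 + G 0)) * X - C (3 * f) * X ^ 2)
    (k : ℝ) (hk : k ≠ 0)
    (hM0 : M.map (evalRingHom 0) = C k * (q * h))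
    (hN1 : N₁.map (evalRingHom 0) = q * X * derivative (q * h))
    (hN2 : N₂.map (evalRingHom 0) = q * X * derivative (q * X * derivative (q * h))) :
    ∃ b m : ℝ[X], ∀ v, F v + G v = b.eval v ∧ F v * G v = m.eval v := by
  obtain ⟨g, hg, gM, g1, g2, d, hd, a, b, c, hcomb⟩ := exists_monic_gcd hM N₁ N₂
  -- By the Bézout identity d(v) g(v, T(v)) = 0, and continuity removes d.
  have root : ∀ T : ℝ → ℝ, Continuous T → (∀ v, M.evalEval v (T v) = 0) →
      (∀ v, N₁.evalEval v (T v) = 0) → (∀ v, N₂.evalEval v (T v) = 0) →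
      ∀ v, g.evalEval v (T v) = 0 := by
    intro T hT e0 e1 e2
    refine eq_zero_of_polynomial_mul_eq_zero (continuous_evalEval hT g) hd ?_
    intro v
    have := congrArg (evalEval v (T v)) hcomb
    simpa [evalEval_mul, evalEval_add, evalEval_C, e0, e1, e2] using this
  have gF := root F hF hMF h1F h2F
  have gG := root G hG hMG h1G h2G
  set g₀ := g.map (evalRingHom 0) with hg₀
  have hF0 : (F 0 : ℂ) ≠ 0 := by exact_mod_cast (hFpos 0).ne'
  have hG0 : (G 0 : ℂ) ≠ 0 := by exact_mod_cast (hGneg 0).ne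
  have hfc : (f : ℂ) ≠ 0 := by exact_mod_cast hf
  have d0 : g₀ ∣ q * X * derivative (q * h) := hN1 ▸ Polynomial.map_dvd _ g1
  have d2 : g₀ ∣ q * X * derivative (q * X * derivative (q * h)) :=
    hN2 ▸ Polynomial.map_dvd _ g2
  have dM : g₀ ∣ q * h := by
    have : g₀ ∣ C k * (q * h) := hM0 ▸ Polynomial.map_dvd _ gM
    have h3 := this.mul_left (C k⁻¹)
    rwa [← mul_assoc, ← C_mul, inv_mul_cancel₀ hk, C_1, one_mul] at h3
  -- Suppose z is a common complex zero. It is neither 0 nor a zero of q, so the first prolongation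
  -- gives h'(z) = 0 and then the second gives h''(z) = 0, against h'' = −6f. The first prolongation
  -- alone would not exclude a double root of h.
  have hcop : IsCoprime g₀ h := by
    rw [isCoprime_iff_aeval_ne_zero_of_isAlgClosed ℝ ℂ]
    intro z
    by_contra hcon
    push Not at hcon
    obtain ⟨hz1, hz2⟩ := hcon
    have hqz : aeval z q = (f : ℂ) * (z - F 0) * (z - G 0) := by
      rw [hq]; simp
    have hhz : aeval z h = 3 * f * F 0 * G 0 + f * (F 0 + G 0) * z - 3 * f * z ^ 2 := by
      rw [hh]; simp
    have hhz' : aeval z (derivative h) = (f : ℂ) * (F 0 + G 0) - 6 * f * z := by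
      rw [hh]; simp; ring
    have hhz'' : aeval z (derivative (derivative h)) = -6 * (f : ℂ) := by
      rw [hh]; simp; ring
    have z0 : z ≠ 0 := by
      rintro rfl
      rw [hhz] at hz2
      simp [hF0, hG0, hfc] at hz2
    have q0 : aeval z q ≠ 0 := by
      rw [hqz]
      intro h4
      rw [hhz] at hz2
      -- At the roots of q one finds h(F₀) = 2fF₀(2G₀ − F₀) and h(G₀) = 2fG₀(2F₀ − G₀), both nonzero
      -- because F₀ > 0 > G₀.
      rcases mul_eq_zero.1 h4 with h5 | h5
      · have h6 := (mul_eq_zero.1 h5).resolve_left hfc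
        have : z = F 0 := by linear_combination h6
        subst this
        have h7 : (f : ℂ) * F 0 * (2 * (2 * G 0 - F 0)) = 0 := by linear_combination hz2
        have h8 : (2 * (2 * G 0 - F 0) : ℂ) = 0 :=
          (mul_eq_zero.1 h7).resolve_left (mul_ne_zero hfc hF0)
        have h9 : 2 * (2 * G 0 - F 0) = 0 := by exact_mod_cast h8
        linarith [hFpos 0, hGneg 0]
      · have : z = G 0 := by linear_combination h5
        subst this
        have h7 : (f : ℂ) * G 0 * (2 * (2 * F 0 - G 0)) = 0 := by linear_combination hz2
        have h8 : (2 * (2 * F 0 - G 0) : ℂ) = 0 :=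
          (mul_eq_zero.1 h7).resolve_left (mul_ne_zero hfc hG0)
        have h9 : 2 * (2 * F 0 - G 0) = 0 := by exact_mod_cast h8
        linarith [hFpos 0, hGneg 0]
    have ev : ∀ {p : ℝ[X]}, g₀ ∣ p → aeval z p = 0 := by
      rintro p ⟨r, rfl⟩
      rw [map_mul, hz1, zero_mul]
    have e1 := ev d0
    simp only [derivative_mul, map_mul, map_add, aeval_X, hz2, mul_zero, zero_add] at e1
    have e1' : aeval z (derivative h) = 0 := by
      simpa [q0, z0] using e1
    have e2 := ev d2
    simp only [derivative_mul, derivative_X, map_mul, map_add, aeval_X, hz2,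
      e1', mul_zero, zero_add, add_zero] at e2
    rw [hhz''] at e2
    simp [q0, z0, hfc] at e2
  have hdq : g₀ ∣ q := hcop.dvd_of_dvd_mul_right dM
  have hq0 : q ≠ 0 := by
    rw [hq]
    exact mul_ne_zero (mul_ne_zero (C_ne_zero.2 hf) (X_sub_C_ne_zero _)) (X_sub_C_ne_zero _)
  have hdeg : g.natDegree ≤ 2 := by
    have h1 : g₀.natDegree = g.natDegree := hg.natDegree_map _
    rw [← h1]
    refine (natDegree_le_of_dvd hdq hq0).trans ?_
    rw [hq]
    compute_degree
  have hexp : ∀ v T, g.evalEval v T =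
      (g.coeff 0).eval v + (g.coeff 1).eval v * T + (g.coeff 2).eval v * T ^ 2 := by
    intro v T
    rw [evalEval, eval_eq_sum_range' (Nat.lt_succ_of_le hdeg)]
    simp [Finset.sum_range_succ]
  have hlc : g.coeff g.natDegree = 1 := hg
  -- The monic g has the distinct roots F and G, so its degree is neither 0 nor 1; in degree two
  -- Vieta's formulas give the sum and the product.
  interval_cases hn : g.natDegree
  · have c1 : g.coeff 1 = 0 := coeff_eq_zero_of_natDegree_lt (by omega)
    have c2 : g.coeff 2 = 0 := coeff_eq_zero_of_natDegree_lt (by omega)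
    have := gF 0
    rw [hexp, hlc, c1, c2] at this
    simp at this
  · have c2 : g.coeff 2 = 0 := coeff_eq_zero_of_natDegree_lt (by omega)
    have e1 := gF 0
    have e2 := gG 0
    rw [hexp, hlc, c2] at e1 e2
    simp at e1 e2
    linarith [hFpos 0, hGneg 0]
  · refine ⟨-(g.coeff 1), g.coeff 0, fun v => ?_⟩
    have e1 := gF v
    have e2 := gG v
    rw [hexp, hlc] at e1 e2
    simp at e1 e2
    have hne : F v - G v ≠ 0 := by linarith [hFpos v, hGneg v]
    have hs : F v + G v = -(g.coeff 1).eval v := by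
      apply mul_left_cancel₀ hne
      linear_combination e1 - e2
    refine ⟨by simpa using hs, ?_⟩
    linear_combination F v * hs - e1

end PolynomialAlgebra

end

/-! ### Polynomial families over a base -/

section

variable {E : Type*} [NormedAddCommGroup E] [NormedSpace ℝ E]

theorem hasFDerivAt_base_slice {f : E × E → ℝ} {x y : E} (hf : DifferentiableAt ℝ f (x, y)) :
    HasFDerivAt (fun z => f (z, y))
      ((fderiv ℝ f (x, y)).comp (ContinuousLinearMap.inl ℝ E E)) x :=
  HasFDerivAt.comp x (g := f) (f := fun z => (z, y)) hf.hasFDerivAt (hasFDerivAt_prodMk_left x y)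

namespace ProjSystem

variable {U : Set E} {ϑ : E → E →L[ℝ] ℝ} {σ : E → ℝ} {F P : E × E → ℝ}

theorem slice_F (S : ProjSystem U ϑ σ F P) {x y : E} (hx : x ∈ U) (hy : y ≠ 0) :
    DifferentiableAt ℝ (fun z => F (z, y)) x ∧
      fderiv ℝ (fun z => F (z, y)) x y = 2 * P (x, y) * F (x, y) := by
  have h := hasFDerivAt_base_slice ((S.contDiffAt_F hx hy).differentiableAt (by simp))
  refine ⟨h.differentiableAt, ?_⟩
  rw [h.fderiv, ← S.spray_F hx hy]
  simp

theorem slice_P (S : ProjSystem U ϑ σ F P) {x y : E} (hx : x ∈ U) (hy : y ≠ 0) :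
    DifferentiableAt ℝ (fun z => P (z, y)) x ∧
      fderiv ℝ (fun z => P (z, y)) x y =
        P (x, y) ^ 2 - 3 * ϑ x y * F (x, y) - σ x * F (x, y) ^ 2 := by
  have h := hasFDerivAt_base_slice ((S.contDiffAt_P hx hy).differentiableAt (by simp))
  refine ⟨h.differentiableAt, ?_⟩
  rw [h.fderiv, ← S.spray_P hx hy]
  simp

theorem contDiffAt_dform (S : ProjSystem U ϑ σ F P) {x : E} (hx : x ∈ U) (y z : E) :
    ContDiffAt ℝ ∞ (fun x => fderiv ℝ ϑ x y z) x :=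
  (((S.contDiffAt_form hx).fderiv_right (m := ∞) (by simp)).clm_apply contDiffAt_const).clm_apply
    contDiffAt_const

theorem contDiffAt_dfun (S : ProjSystem U ϑ σ F P) {x : E} (hx : x ∈ U) (y : E) :
    ContDiffAt ℝ ∞ (fun x => fderiv ℝ σ x y) x :=
  ((S.contDiffAt_fun hx).fderiv_right (m := ∞) (by simp)).clm_apply contDiffAt_const

theorem hasFDerivAt_form_apply (S : ProjSystem U ϑ σ F P) {x : E} (hx : x ∈ U) (y : E) :
    HasFDerivAt (fun z => ϑ z y) ((fderiv ℝ ϑ x).flip y) x := by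
  have h := (((S.contDiffAt_form hx).differentiableAt (by simp)).hasFDerivAt).clm_apply
    (hasFDerivAt_const y x)
  refine h.congr_fderiv ?_
  ext; simp

/-- The metric satisfies a quartic equation whose coefficients are polynomial in the direction. -/
theorem quartic (S : ProjSystem U ϑ σ F P) {f : E → ℝ} (hf : ContDiffOn ℝ ∞ f U)
    (hq : ∀ x ∈ U, ∀ y, y ≠ 0 → 2 * ϑ x y * P (x, y) =
      fderiv ℝ ϑ x y y + fderiv ℝ σ x y * F (x, y) + f x * F (x, y) ^ 2)
    {x y : E} (hx : x ∈ U) (hy : y ≠ 0) :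
    (3 * fderiv ℝ ϑ x y y ^ 2 - 2 * ϑ x y * fderiv ℝ (fun z => fderiv ℝ ϑ z y y) x y)
    + (2 * fderiv ℝ ϑ x y y * fderiv ℝ σ x y - 12 * ϑ x y ^ 3
        - 2 * ϑ x y * fderiv ℝ (fun z => fderiv ℝ σ z y) x y) * F (x, y)
    - (fderiv ℝ σ x y ^ 2 + 4 * ϑ x y ^ 2 * σ x + 2 * ϑ x y * fderiv ℝ f x y) * F (x, y) ^ 2
    - 4 * f x * fderiv ℝ σ x y * F (x, y) ^ 3 - 3 * f x ^ 2 * F (x, y) ^ 4 = 0 := by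
  obtain ⟨dF, eF⟩ := S.slice_F hx hy
  obtain ⟨dP, eP⟩ := S.slice_P hx hy
  have dc := ((S.contDiffAt_dform hx y y).differentiableAt (by simp)).hasFDerivAt
  have ds := ((S.contDiffAt_dfun hx y).differentiableAt (by simp)).hasFDerivAt
  have df := ((hf.contDiffAt (S.isOpen.mem_nhds hx)).differentiableAt (by simp)).hasFDerivAt
  have hϑ := S.hasFDerivAt_form_apply hx y
  have h1 := (hϑ.const_mul 2).mul dP.hasFDerivAt
  have h2 := (dc.add (ds.mul dF.hasFDerivAt)).add (df.mul (dF.hasFDerivAt.pow 2))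
  have h3 := h1.congr_of_eventuallyEq (f₁ := (fun z => fderiv ℝ ϑ z y y) + (fun z => fderiv ℝ σ z y)
      * (fun z => F (z, y)) + f * fun z => F (z, y) ^ 2) (by
    filter_upwards [S.isOpen.mem_nhds hx] with z hz
    exact (hq z hz y hy).symm)
  have h4 := congrArg (fun L => L y) (h2.unique h3)
  simp [eF, eP] at h4
  have h5 := hq x hx y hy
  -- The differentiated relation, multiplied by −2θ, involves P only through θP and its square; the
  -- undifferentiated relation `h5` removes these.
  linear_combination (-(2 * ϑ x y)) * h4 - (3 * fderiv ℝ ϑ x y y + 2 * ϑ x y * P (x, y) -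
    fderiv ℝ σ x y * F (x, y) - 3 * f x * F (x, y) ^ 2) * h5

end ProjSystem

/-- Families of bivariate polynomials, in the parameter `v` of the directions `a + v • b` and
in a further variable, with coefficients smooth on `O`. -/
inductive PolyFamily (O : Set E) : (E → ℝ → ℝ → ℝ) → Prop
  | monomial (a : E → ℝ) (ha : ContDiffOn ℝ ∞ a O) (i j : ℕ) :
      PolyFamily O (fun x v T => a x * v ^ i * T ^ j)
  | add {R S : E → ℝ → ℝ → ℝ} (hR : PolyFamily O R) (hS : PolyFamily O S) :
      PolyFamily O (fun x v T => R x v T + S x v T)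
  | congr {R S : E → ℝ → ℝ → ℝ} (hR : PolyFamily O R)
      (h : ∀ x ∈ O, ∀ v T, S x v T = R x v T) : PolyFamily O S

namespace PolyFamily

variable {O : Set E} {R S : E → ℝ → ℝ → ℝ}

theorem coeff {a : E → ℝ} (ha : ContDiffOn ℝ ∞ a O) : PolyFamily O (fun x _ _ => a x) :=
  (monomial a ha 0 0).congr (by simp)

theorem const (r : ℝ) : PolyFamily O (fun _ _ _ => r) := coeff contDiffOn_const

theorem param : PolyFamily O (fun _ v _ => v) :=
  (monomial (fun _ => 1) contDiffOn_const 1 0).congr (by simp)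

theorem var : PolyFamily O (fun _ _ T => T) :=
  (monomial (fun _ => 1) contDiffOn_const 0 1).congr (by simp)

theorem mul (hR : PolyFamily O R) (hS : PolyFamily O S) :
    PolyFamily O (fun x v T => R x v T * S x v T) := by
  induction hR with
  | monomial a ha i j =>
    induction hS with
    | monomial b hb k l =>
      refine (monomial (fun x => a x * b x) (ha.mul hb) (i + k) (j + l)).congr ?_
      intro x _ v T
      ring
    | add _ _ h1 h2 =>
      refine (h1.add h2).congr ?_
      intro x _ v T
      ring
    | congr _ h h1 =>
      refine h1.congr ?_
      intro x hx v T
      rw [h x hx v T]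
  | add _ _ h1 h2 =>
    refine (h1.add h2).congr ?_
    intro x _ v T
    ring
  | congr _ h h1 =>
    refine h1.congr ?_
    intro x hx v T
    rw [h x hx v T]

theorem sub (hR : PolyFamily O R) (hS : PolyFamily O S) :
    PolyFamily O (fun x v T => R x v T - S x v T) := by
  refine (hR.add ((const (-1)).mul hS)).congr ?_
  intro x _ v T
  ring

theorem pow (hR : PolyFamily O R) (n : ℕ) : PolyFamily O (fun x v T => R x v T ^ n) := by
  induction n with
  | zero => exact (const 1).congr (by simp)
  | succ n ih => exact (ih.mul hR).congr (by intro x _ v T; ring)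

/-- Differentiation in the base direction `a + v • b`. -/
theorem base_deriv (hO : IsOpen O) (a b : E) (hR : PolyFamily O R) :
    (∀ x ∈ O, ∀ v T, DifferentiableAt ℝ (fun z => R z v T) x) ∧
      PolyFamily O (fun x v T => fderiv ℝ (fun z => R z v T) x (a + v • b)) := by
  induction hR with
  | monomial c hc i j =>
    have hd : ∀ x ∈ O, DifferentiableAt ℝ c x := fun x hx =>
      (hc.contDiffAt (hO.mem_nhds hx)).differentiableAt (by simp)
    have hsm : ∀ d : E, ContDiffOn ℝ ∞ (fun x => fderiv ℝ c x d) O := fun d =>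
      (hc.fderiv_of_isOpen hO (by simp)).clm_apply contDiffOn_const
    refine ⟨fun x hx v T => ((hd x hx).mul_const _).mul_const _, ?_⟩
    refine ((monomial _ (hsm a) i j).add (monomial _ (hsm b) (i + 1) j)).congr ?_
    intro x hx v T
    have h := (((hd x hx).hasFDerivAt.mul_const (v ^ i)).mul_const (T ^ j)).fderiv
    rw [h]
    simp
    ring
  | add _ _ h1 h2 =>
    refine ⟨fun x hx v T => (h1.1 x hx v T).add (h2.1 x hx v T), (h1.2.add h2.2).congr ?_⟩
    intro x hx v T
    have h := ((h1.1 x hx v T).hasFDerivAt.add (h2.1 x hx v T).hasFDerivAt).fderiv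
    exact (congrArg (fun L => L (a + v • b)) h)
  | congr _ h h1 =>
    have hev : ∀ x ∈ O, ∀ v T, (fun z => _) =ᶠ[𝓝 x] (fun z => _) := fun x hx v T => by
      filter_upwards [hO.mem_nhds hx] with z hz using h z hz v T
    refine ⟨fun x hx v T => (h1.1 x hx v T).congr_of_eventuallyEq (hev x hx v T),
      h1.2.congr ?_⟩
    intro x hx v T
    rw [(hev x hx v T).fderiv_eq]

/-- Differentiation in the last variable. -/
theorem var_deriv (hR : PolyFamily O R) :
    (∀ x ∈ O, ∀ v T, DifferentiableAt ℝ (R x v) T) ∧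
      PolyFamily O (fun x v T => deriv (R x v) T) := by
  induction hR with
  | monomial c hc i j =>
    refine ⟨fun x _ v T => by fun_prop, ?_⟩
    -- For j = 0 the truncated exponent j − 1 is harmless, because the factor j vanishes.
    refine (((monomial c hc i (j - 1))).mul (const (j : ℝ))).congr ?_
    intro x _ v T
    simp
    ring
  | add _ _ h1 h2 =>
    refine ⟨fun x hx v T => (h1.1 x hx v T).add (h2.1 x hx v T), (h1.2.add h2.2).congr ?_⟩
    intro x hx v T
    exact deriv_add (h1.1 x hx v T) (h2.1 x hx v T)
  | congr _ h h1 =>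
    have hev : ∀ x ∈ O, ∀ v, _ = _ := fun x hx v => funext (h x hx v)
    refine ⟨fun x hx v T => by rw [hev x hx v]; exact h1.1 x hx v T, h1.2.congr ?_⟩
    intro x hx v T
    rw [hev x hx v]

/-- The chain rule for substituting a function of the base point for the last variable. -/
theorem chain (hO : IsOpen O) (hR : PolyFamily O R) {φ : E → ℝ} {x : E} (hx : x ∈ O)
    (hφ : DifferentiableAt ℝ φ x) (v : ℝ) (d : E) :
    DifferentiableAt ℝ (fun z => R z v (φ z)) x ∧
    fderiv ℝ (fun z => R z v (φ z)) x d =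
      fderiv ℝ (fun z => R z v (φ x)) x d + deriv (R x v) (φ x) * fderiv ℝ φ x d := by
  induction hR with
  | monomial c hc i j =>
    have hd : DifferentiableAt ℝ c x :=
      (hc.contDiffAt (hO.mem_nhds hx)).differentiableAt (by simp)
    have h := (hd.hasFDerivAt.mul_const (v ^ i)).mul (hφ.hasFDerivAt.pow j)
    have h2 := (hd.hasFDerivAt.mul_const (v ^ i)).mul_const (φ x ^ j)
    refine ⟨h.differentiableAt, ?_⟩
    have e1 := congrArg (fun L => L d) h.fderiv
    have e2 := congrArg (fun L => L d) h2.fderiv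
    have e3 : deriv (fun T => c x * v ^ i * T ^ j) (φ x) = c x * v ^ i * (j * φ x ^ (j - 1)) := by
      simp
    rw [e2, e3]
    refine e1.trans ?_
    simp
    ring
  | @add R S hR hS h1 h2 =>
    refine ⟨h1.1.add h2.1, ?_⟩
    have e1 : fderiv ℝ (fun z => R z v (φ z) + S z v (φ z)) x d = _ :=
      congrArg (fun L => L d) (h1.1.hasFDerivAt.add h2.1.hasFDerivAt).fderiv
    have hr := (hR.base_deriv hO 0 0).1 x hx v (φ x)
    have hs := (hS.base_deriv hO 0 0).1 x hx v (φ x)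
    have e2 : fderiv ℝ (fun z => R z v (φ x) + S z v (φ x)) x d = _ :=
      congrArg (fun L => L d) (hr.hasFDerivAt.add hs.hasFDerivAt).fderiv
    have e3 : deriv (fun T => R x v T + S x v T) (φ x) = _ :=
      deriv_add (hR.var_deriv.1 x hx v (φ x)) (hS.var_deriv.1 x hx v (φ x))
    rw [e1, e2, e3]
    simp only [add_apply]
    rw [h1.2, h2.2]
    ring
  | @congr R S hR h h1 =>
    have hev : (fun z => S z v (φ z)) =ᶠ[𝓝 x] (fun z => R z v (φ z)) := by
      filter_upwards [hO.mem_nhds hx] with z hz using h z hz v _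
    have hev2 : (fun z => S z v (φ x)) =ᶠ[𝓝 x] (fun z => R z v (φ x)) := by
      filter_upwards [hO.mem_nhds hx] with z hz using h z hz v _
    have hev3 : S x v = R x v := funext (h x hx v)
    rw [hev.fderiv_eq, hev2.fderiv_eq, hev3]
    exact ⟨h1.1.congr_of_eventuallyEq hev, h1.2⟩

open Polynomial in
theorem exists_polynomial (hR : PolyFamily O R) {x : E} (hx : x ∈ O) :
    ∃ p : ℝ[X][X], ∀ v T, R x v T = p.evalEval v T := by
  induction hR with
  | monomial c hc i j =>
    refine ⟨C (C (c x) * X ^ i) * X ^ j, fun v T => ?_⟩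
    simp [evalEval_mul, evalEval_pow, evalEval_X, evalEval_C]
  | add _ _ h1 h2 =>
    obtain ⟨p, hp⟩ := h1
    obtain ⟨q, hq⟩ := h2
    exact ⟨p + q, fun v T => by rw [evalEval_add, ← hp, ← hq]⟩
  | congr _ h h1 =>
    obtain ⟨p, hp⟩ := h1
    exact ⟨p, fun v T => by rw [h x hx, hp]⟩

open Polynomial in
theorem exists_polynomial_param {r : E → ℝ → ℝ} (hR : PolyFamily O (fun x v _ => r x v))
    {x : E} (hx : x ∈ O) : ∃ p : ℝ[X], ∀ v, r x v = p.eval v := by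
  obtain ⟨p, hp⟩ := hR.exists_polynomial hx
  refine ⟨p.eval 0, fun v => ?_⟩
  rw [hp v 0, evalEval]
  simp

end PolyFamily

end

/-! ### Reflected pairs and prolongation -/

section

variable {E : Type*} [NormedAddCommGroup E] [NormedSpace ℝ E]

namespace ProjSystem

variable {U : Set E} {ϑ : E → E →L[ℝ] ℝ} {σ : E → ℝ} {F P : E × E → ℝ}

theorem family_form (S : ProjSystem U ϑ σ F P) (a b : E) :
    PolyFamily U (fun x v _ => ϑ x (a + v • b)) := by
  have h : ∀ d : E, ContDiffOn ℝ ∞ (fun x => ϑ x d) U := fun d =>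
    S.smooth_form.clm_apply contDiffOn_const
  refine ((PolyFamily.coeff (h a)).add (PolyFamily.param.mul (PolyFamily.coeff (h b)))).congr ?_
  intro x _ v T
  simp

theorem family_dfun (S : ProjSystem U ϑ σ F P) {f : E → ℝ} (hf : ContDiffOn ℝ ∞ f U) (a b : E) :
    PolyFamily U (fun x v _ => fderiv ℝ f x (a + v • b)) :=
  ((PolyFamily.coeff hf).base_deriv S.isOpen a b).2

/-- The quantity c is the derivative of x ↦ θ(x)(y) in the direction y itself, so it arises from
`family_form` by base differentiation. -/
theorem family_dform (S : ProjSystem U ϑ σ F P) (a b : E) :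
    PolyFamily U (fun x v _ => fderiv ℝ ϑ x (a + v • b) (a + v • b)) := by
  refine (((S.family_form a b)).base_deriv S.isOpen a b).2.congr ?_
  intro x hx v T
  rw [(S.hasFDerivAt_form_apply hx _).fderiv]
  rfl

end ProjSystem

/-- The prolongation of an algebraic relation along the spray. -/
noncomputable def prolong (ϑ : E → E →L[ℝ] ℝ) (σ f : E → ℝ) (a b : E) (R : E → ℝ → ℝ → ℝ)
    (x : E) (v T : ℝ) : ℝ :=
  ϑ x (a + v • b) * fderiv ℝ (fun z => R z v T) x (a + v • b) +
    (fderiv ℝ ϑ x (a + v • b) (a + v • b) + fderiv ℝ σ x (a + v • b) * T + f x * T ^ 2) * T *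
      deriv (R x v) T

section Prolong

variable {U : Set E} {ϑ : E → E →L[ℝ] ℝ} {σ f : E → ℝ} {F P : E × E → ℝ} {a b : E}
  {R : E → ℝ → ℝ → ℝ}

theorem prolong_family (S : ProjSystem U ϑ σ F P) (hf : ContDiffOn ℝ ∞ f U)
    (hR : PolyFamily U R) : PolyFamily U (prolong ϑ σ f a b R) := by
  have hT := PolyFamily.var (O := U)
  exact ((S.family_form a b).mul (hR.base_deriv S.isOpen a b).2).add
    (((((S.family_dform a b).add ((S.family_dfun S.smooth_fun a b).mul hT)).add
      ((PolyFamily.coeff hf).mul (hT.pow 2))).mul hT).mul hR.var_deriv.2)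

/-- Differentiating R = 0 along y gives ∂_y R + 2PF R_T = 0. After multiplication by θ, the relation
replaces 2θP by c + sF + fF², so P disappears and the coefficients stay polynomial. The equation
must hold at all nearby base points, whence the use of families over U. -/
theorem prolong_vanish (S : ProjSystem U ϑ σ F P)
    (hq : ∀ x ∈ U, ∀ y, y ≠ 0 → 2 * ϑ x y * P (x, y) =
      fderiv ℝ ϑ x y y + fderiv ℝ σ x y * F (x, y) + f x * F (x, y) ^ 2)
    (hR : PolyFamily U R) {v : ℝ} (hv : a + v • b ≠ 0)
    (h : ∀ x ∈ U, R x v (F (x, a + v • b)) = 0) :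
    ∀ x ∈ U, prolong ϑ σ f a b R x v (F (x, a + v • b)) = 0 := by
  intro x hx
  obtain ⟨dF, eF⟩ := S.slice_F hx hv
  have h1 := (hR.chain S.isOpen hx dF v (a + v • b)).2
  have h2 : (fun z => R z v (F (z, a + v • b))) =ᶠ[𝓝 x] fun _ => (0 : ℝ) := by
    filter_upwards [S.isOpen.mem_nhds hx] with z hz using h z hz
  rw [h2.fderiv_eq, eF] at h1
  simp only [fderiv_fun_const, Pi.zero_apply, zero_apply] at h1
  have h3 := hq x hx _ hv
  unfold prolong
  rw [← h3]
  linear_combination (-(ϑ x (a + v • b))) * h1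

/-- In a kernel direction the base derivative drops out and prolongation becomes the operator q T
d/dT. Both prolongations can thus be computed at v = 0 without knowing their other coefficients. -/
theorem prolong_kernel {x : E} (hx : ϑ x a = 0) (T : ℝ) :
    prolong ϑ σ f a b R x 0 T =
      (fderiv ℝ ϑ x a a + fderiv ℝ σ x a * T + f x * T ^ 2) * T * deriv (R x 0) T := by
  simp [prolong, hx]

end Prolong

/-- Two solutions `F > 0 > G` of the same system, related by the reflection of directions. -/
structure ProjPair (U : Set E) (ϑ : E → E →L[ℝ] ℝ) (σ f : E → ℝ) (F P G Q : E × E → ℝ) :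
    Prop where
  fst : ProjSystem U ϑ σ F P
  snd : ProjSystem U ϑ σ G Q
  smooth_f : ContDiffOn ℝ ∞ f U
  rel_fst : ∀ x ∈ U, ∀ y, y ≠ 0 → 2 * ϑ x y * P (x, y) =
      fderiv ℝ ϑ x y y + fderiv ℝ σ x y * F (x, y) + f x * F (x, y) ^ 2
  rel_snd : ∀ x ∈ U, ∀ y, y ≠ 0 → 2 * ϑ x y * Q (x, y) =
      fderiv ℝ ϑ x y y + fderiv ℝ σ x y * G (x, y) + f x * G (x, y) ^ 2
  pos : ∀ x ∈ U, ∀ y, y ≠ 0 → 0 < F (x, y)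
  reflect : ∀ x ∈ U, ∀ y, G (x, y) = -F (x, -y)
  zero : ∀ x ∈ U, F (x, 0) = 0

namespace ProjPair

variable {U : Set E} {ϑ : E → E →L[ℝ] ℝ} {σ f : E → ℝ} {F P G Q : E × E → ℝ}

theorem neg (S : ProjPair U ϑ σ f F P G Q) {x y : E} (hx : x ∈ U) (hy : y ≠ 0) :
    G (x, y) < 0 := by
  rw [S.reflect x hx y]
  linarith [S.pos x hx (-y) (neg_ne_zero.2 hy)]

open Polynomial in
/-- At a point where neither `θ` nor `f` vanishes, the sum and the product of the two solutions
are polynomial along lines transverse to the kernel of `θ`. -/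
theorem exists_polynomial_of_ne_zero (S : ProjPair U ϑ σ f F P G Q) {x a b : E} (hx : x ∈ U)
    (hfx : f x ≠ 0) (ha : ϑ x a = 0) (hab : ∀ v : ℝ, a + v • b ≠ 0) :
    ∃ p m : ℝ[X], ∀ v, F (x, a + v • b) + G (x, a + v • b) = p.eval v ∧
      F (x, a + v • b) * G (x, a + v • b) = m.eval v := by
  have fθ := S.fst.family_form a b
  have fc := S.fst.family_dform a b
  have fs := S.fst.family_dfun S.fst.smooth_fun a b
  have ff := S.fst.family_dfun S.smooth_f a b
  have fc1 := (fc.base_deriv S.fst.isOpen a b).2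
  have fs1 := (fs.base_deriv S.fst.isOpen a b).2
  have cσ := PolyFamily.coeff S.fst.smooth_fun
  have cf := PolyFamily.coeff S.smooth_f
  have k := fun r : ℝ => PolyFamily.const (O := U) r
  have hT := PolyFamily.var (O := U)
  have f0 := ((k 3).mul (fc.pow 2)).sub (((k 2).mul fθ).mul fc1)
  have f1 := ((((k 2).mul fc).mul fs).sub ((k 12).mul (fθ.pow 3))).sub (((k 2).mul fθ).mul fs1)
  have f2 := ((fs.pow 2).add (((k 4).mul (fθ.pow 2)).mul cσ)).add (((k 2).mul fθ).mul ff)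
  have f3 := ((k 4).mul cf).mul fs
  have f4 := (k 3).mul (cf.pow 2)
  have fR := (((f0.add (f1.mul hT)).sub (f2.mul (hT.pow 2))).sub (f3.mul (hT.pow 3))).sub
    (f4.mul (hT.pow 4))
  obtain ⟨p0, hp0⟩ := f0.exists_polynomial_param hx
  obtain ⟨p1, hp1⟩ := f1.exists_polynomial_param hx
  obtain ⟨p2, hp2⟩ := f2.exists_polynomial_param hx
  obtain ⟨p3, hp3⟩ := f3.exists_polynomial_param hx
  set R : E → ℝ → ℝ → ℝ := _
  have fR : PolyFamily U R := fR
  have vF : ∀ v, ∀ z ∈ U, R z v (F (z, a + v • b)) = 0 := fun v z hz =>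
    S.fst.quartic S.smooth_f S.rel_fst hz (hab v)
  have vG : ∀ v, ∀ z ∈ U, R z v (G (z, a + v • b)) = 0 := fun v z hz =>
    S.snd.quartic S.smooth_f S.rel_snd hz (hab v)
  have fR1 := prolong_family (a := a) (b := b) S.fst S.smooth_f fR
  have fR2 := prolong_family (a := a) (b := b) S.fst S.smooth_f fR1
  have vF1 := fun v => prolong_vanish S.fst S.rel_fst fR (hab v) (vF v)
  have vG1 := fun v => prolong_vanish S.snd S.rel_snd fR (hab v) (vG v)
  have vF2 := fun v => prolong_vanish S.fst S.rel_fst fR1 (hab v) (vF1 v)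
  have vG2 := fun v => prolong_vanish S.snd S.rel_snd fR1 (hab v) (vG1 v)
  obtain ⟨N₁, hN₁⟩ := fR1.exists_polynomial hx
  obtain ⟨N₂, hN₂⟩ := fR2.exists_polynomial hx
  -- The leading coefficient of the quartic is −3f²; its inverse makes M monic.
  set e : ℝ := (-3 * f x ^ 2)⁻¹ with he
  have he0 : -3 * f x ^ 2 ≠ 0 := mul_ne_zero (by norm_num) (pow_ne_zero 2 hfx)
  set M : ℝ[X][X] := X ^ 4 + (C (C e * p0) + C (C e * p1) * X - C (C e * p2) * X ^ 2
    - C (C e * p3) * X ^ 3) with hM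
  have hMmon : M.Monic := by
    refine monic_X_pow_add ?_
    have : (C (C e * p0) + C (C e * p1) * X - C (C e * p2) * X ^ 2
      - C (C e * p3) * X ^ 3 : ℝ[X][X]).degree ≤ 3 := by compute_degree
    exact lt_of_le_of_lt this (by norm_num)
  have hMe : ∀ v T, M.evalEval v T = e * R x v T := by
    intro v T
    have : R x v T = p0.eval v + p1.eval v * T - p2.eval v * T ^ 2 - p3.eval v * T ^ 3
        - 3 * f x ^ 2 * T ^ 4 := by
      rw [← hp0, ← hp1, ← hp2, ← hp3]
    rw [this, hM]
    simp only [evalEval_add, evalEval_sub, evalEval_mul, evalEval_pow, evalEval_X, evalEval_C,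
      eval_mul, eval_C]
    rw [he]
    field_simp
    ring
  have contF : Continuous fun v : ℝ => F (x, a + v • b) := continuous_iff_continuousAt.2 fun v =>
    ContinuousAt.comp (g := F) (f := fun v : ℝ => (x, a + v • b))
      (S.fst.contDiffAt_F hx (hab v)).continuousAt (by fun_prop)
  have contG : Continuous fun v : ℝ => G (x, a + v • b) := continuous_iff_continuousAt.2 fun v =>
    ContinuousAt.comp (g := G) (f := fun v : ℝ => (x, a + v • b))
      (S.snd.contDiffAt_F hx (hab v)).continuousAt (by fun_prop)
  have ha0 : a ≠ 0 := by simpa using hab 0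
  have rF := S.rel_fst x hx a ha0
  have rG := S.rel_snd x hx a ha0
  have pF := S.pos x hx a ha0
  have nG := S.neg hx ha0
  rw [ha, mul_zero, zero_mul] at rF rG
  -- On ker θ the relations say that F and G are the two distinct roots of c + sT + fT², so Vieta
  -- determines s and then c.
  have hs : fderiv ℝ σ x a = -(f x * (F (x, a) + G (x, a))) := by
    have : F (x, a) - G (x, a) ≠ 0 := by linarith
    apply mul_left_cancel₀ this
    linear_combination rG - rF
  have hc : fderiv ℝ ϑ x a a = f x * F (x, a) * G (x, a) := by
    linear_combination -rF - F (x, a) * hs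
  have hdir : a + (0 : ℝ) • b = a := by simp
  set q : ℝ[X] := C (f x) * (X - C (F (x, a + (0 : ℝ) • b))) * (X - C (G (x, a + (0 : ℝ) • b)))
    with hq
  set h : ℝ[X] := C (3 * f x * F (x, a + (0 : ℝ) • b) * G (x, a + (0 : ℝ) • b)) +
    C (f x * (F (x, a + (0 : ℝ) • b) + G (x, a + (0 : ℝ) • b))) * X - C (3 * f x) * X ^ 2 with hh
  have hqe : ∀ T, fderiv ℝ ϑ x a a + fderiv ℝ σ x a * T + f x * T ^ 2 = q.eval T := by
    intro T
    rw [hq, hs, hc, hdir]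
    simp
    ring
  -- At v = 0 the terms containing θ drop out and the quartic factors as (c + sT + fT²)(3c − sT −
  -- 3fT²).
  have hR0 : ∀ T, R x 0 T = (q * h).eval T := by
    intro T
    have : R x 0 T = (3 * fderiv ℝ ϑ x a a ^ 2) + 2 * fderiv ℝ ϑ x a a * fderiv ℝ σ x a * T
      - fderiv ℝ σ x a ^ 2 * T ^ 2 - 4 * f x * fderiv ℝ σ x a * T ^ 3 - 3 * f x ^ 2 * T ^ 4 := by
      simp only [R]
      simp [ha]
    rw [this, hq, hh, hs, hc, hdir]
    simp
    ring
  have hR1 : ∀ T, prolong ϑ σ f a b R x 0 T = (q * X * derivative (q * h)).eval T := by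
    intro T
    rw [prolong_kernel ha, hqe, funext hR0, Polynomial.deriv]
    simp
  have hR2 : ∀ T, prolong ϑ σ f a b (prolong ϑ σ f a b R) x 0 T =
      (q * X * derivative (q * X * derivative (q * h))).eval T := by
    intro T
    rw [prolong_kernel ha, hqe, funext hR1, Polynomial.deriv]
    simp only [eval_mul, eval_X]
  refine exists_polynomial_sum_prod contF contG (fun v => S.pos x hx _ (hab v))
    (fun v => S.neg hx (hab v)) hfx hMmon (N₁ := N₁) (N₂ := N₂) ?_ ?_ ?_ ?_ ?_ ?_ hq hh e
    (inv_ne_zero he0) ?_ ?_ ?_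
  · intro v; rw [hMe, vF v x hx, mul_zero]
  · intro v; rw [hMe, vG v x hx, mul_zero]
  · intro v; rw [← hN₁, vF1 v x hx]
  · intro v; rw [← hN₁, vG1 v x hx]
  · intro v; rw [← hN₂, vF2 v x hx]
  · intro v; rw [← hN₂, vG2 v x hx]
  · refine Polynomial.funext fun T => ?_
    rw [map_evalRingHom_eval, hMe, hR0, eval_mul (p := C e), eval_C]
  · refine Polynomial.funext fun T => ?_
    rw [map_evalRingHom_eval, ← hN₁, hR1]
  · refine Polynomial.funext fun T => ?_
    rw [map_evalRingHom_eval, ← hN₂, hR2]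

end ProjPair

end

/-! ### The case of a vanishing quotient -/

section

variable {E : Type*} [NormedAddCommGroup E] [NormedSpace ℝ E]

namespace ProjPair

variable {U : Set E} {ϑ : E → E →L[ℝ] ℝ} {σ f : E → ℝ} {F P G Q : E × E → ℝ}

/-- When θ(d) = 0 and f = 0 the relation is the affine equation c + sT = 0 with the two distinct
solutions F and G, so s = 0. -/
theorem dfun_eq_zero (S : ProjPair U ϑ σ f F P G Q) {x d : E} (hx : x ∈ U) (hf : f x = 0)
    (hd : ϑ x d = 0) : fderiv ℝ σ x d = 0 := by
  rcases eq_or_ne d 0 with rfl | hd0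
  · exact map_zero _
  have rF := S.rel_fst x hx d hd0
  have rG := S.rel_snd x hx d hd0
  rw [hd, hf] at rF rG
  have : F (x, d) - G (x, d) ≠ 0 := by linarith [S.pos x hx d hd0, S.neg hx hd0]
  refine (mul_eq_zero.1 (?_ : (F (x, d) - G (x, d)) * _ = 0)).resolve_left this
  linear_combination rG - rF

open Polynomial in
/-- At a point near which `f` vanishes, the sum and the product of the two solutions are
polynomial along lines transverse to the kernel of `θ`, unless the leading coefficient of the
reduced equation vanishes. -/
theorem exists_polynomial_of_eq_zero (S : ProjPair U ϑ σ f F P G Q) {x a b : E} (hx : x ∈ U)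
    (hfx : f =ᶠ[𝓝 x] 0) (ha : ϑ x a = 0) (hb : ϑ x b ≠ 0) (hab : ∀ v : ℝ, a + v • b ≠ 0)
    (hκ : fderiv ℝ σ x b ^ 2 + 4 * ϑ x b ^ 2 * σ x ≠ 0) :
    ∃ p m : ℝ[X], ∀ v, F (x, a + v • b) + G (x, a + v • b) = p.eval v ∧
      F (x, a + v • b) * G (x, a + v • b) = m.eval v := by
  have fc := S.fst.family_dform a b
  have fs := S.fst.family_dfun S.fst.smooth_fun a b
  obtain ⟨pc, hpc⟩ := fc.exists_polynomial_param hx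
  obtain ⟨pc1, hpc1⟩ := (fc.base_deriv S.fst.isOpen a b).2.exists_polynomial_param hx
  obtain ⟨ps1, hps1⟩ := (fs.base_deriv S.fst.isOpen a b).2.exists_polynomial_param hx
  have hf0 : f x = 0 := hfx.self_of_nhds
  have hdf : fderiv ℝ f x = 0 := by
    rw [hfx.fderiv_eq]; simp
  have contF : Continuous fun v : ℝ => F (x, a + v • b) := continuous_iff_continuousAt.2 fun v =>
    ContinuousAt.comp (g := F) (f := fun v : ℝ => (x, a + v • b))
      (S.fst.contDiffAt_F hx (hab v)).continuousAt (by fun_prop)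
  have contG : Continuous fun v : ℝ => G (x, a + v • b) := continuous_iff_continuousAt.2 fun v =>
    ContinuousAt.comp (g := G) (f := fun v : ℝ => (x, a + v • b))
      (S.snd.contDiffAt_F hx (hab v)).continuousAt (by fun_prop)
  have hdir : a + (0 : ℝ) • b = a := by simp
  have ha0 : a ≠ 0 := by simpa using hab 0
  have hFG : ∀ v : ℝ, F (x, a + v • b) - G (x, a + v • b) ≠ 0 := fun v => by
    linarith [S.pos x hx _ (hab v), S.neg hx (hab v)]
  have rF := S.rel_fst x hx a ha0
  rw [ha, hf0] at rF
  have hsa := S.dfun_eq_zero hx hf0 ha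
  have hca : pc.eval 0 = 0 := by
    rw [← hpc, hdir]
    rw [hsa] at rF
    linear_combination -rF
  have hθ : ∀ v : ℝ, ϑ x (a + v • b) = v * ϑ x b := fun v => by simp [ha]
  have hs : ∀ v : ℝ, fderiv ℝ σ x (a + v • b) = v * fderiv ℝ σ x b := fun v => by simp [hsa]
  -- Since c(a) = 0, the polynomial c(a + vb) is divisible by v, as are θ and s.
  obtain ⟨pc', rfl⟩ : X ∣ pc := by rwa [X_dvd_iff, coeff_zero_eq_eval_zero]
  set θb := ϑ x b
  set sb := fderiv ℝ σ x b
  -- With f = 0 near x the quartic is at most quadratic in T, and v divides all its coefficients;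
  -- continuity permits the cancellation at v = 0.
  have quad : ∀ T : ℝ → ℝ, Continuous T → (∀ v,
      (3 * (X * pc').eval v ^ 2 - 2 * (v * θb) * pc1.eval v)
      + (2 * (X * pc').eval v * (v * sb) - 12 * (v * θb) ^ 3 - 2 * (v * θb) * ps1.eval v) * T v
      - ((v * sb) ^ 2 + 4 * (v * θb) ^ 2 * σ x) * T v ^ 2 = 0) → ∀ v,
      (3 * v * pc'.eval v ^ 2 - 2 * θb * pc1.eval v)
      + (2 * v * pc'.eval v * sb - 12 * v ^ 2 * θb ^ 3 - 2 * θb * ps1.eval v) * T v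
      - v * (sb ^ 2 + 4 * θb ^ 2 * σ x) * T v ^ 2 = 0 := by
    intro T hT h
    refine eq_zero_of_polynomial_mul_eq_zero (d := X) ?_ X_ne_zero fun v => ?_
    · have h1 := pc'.continuous
      have h2 := pc1.continuous
      have h3 := ps1.continuous
      fun_prop
    · have := h v
      simp only [eval_mul, eval_X] at this ⊢
      linear_combination this
  have qF := quad _ contF (fun v => by
    have := S.fst.quartic S.smooth_f S.rel_fst hx (hab v)
    rw [hpc, hpc1, hps1, hθ, hs, hf0, hdf] at this
    simp only [zero_apply] at this
    linear_combination this)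
  have qG := quad _ contG (fun v => by
    have := S.snd.quartic S.smooth_f S.rel_snd hx (hab v)
    rw [hpc, hpc1, hps1, hθ, hs, hf0, hdf] at this
    simp only [zero_apply] at this
    linear_combination this)
  -- At v = 0 the reduced equation is affine in T but has the two roots F and G. Both its
  -- coefficients vanish there, and a second factor v splits off.
  have hs10 : ps1.eval 0 = 0 := by
    have h1 := qF 0
    have h2 := qG 0
    refine (mul_eq_zero.1 (?_ : (2 * θb * (F (x, a + (0 : ℝ) • b) - G (x, a + (0 : ℝ) • b))) * _
      = 0)).resolve_left (mul_ne_zero (mul_ne_zero two_ne_zero hb) (hFG 0))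
    linear_combination h2 - h1
  have hc10 : pc1.eval 0 = 0 := by
    have h1 := qF 0
    rw [hs10] at h1
    refine (mul_eq_zero.1 (?_ : (2 * θb) * _ = 0)).resolve_left (mul_ne_zero two_ne_zero hb)
    linear_combination -h1
  obtain ⟨pc1', rfl⟩ : X ∣ pc1 := by rwa [X_dvd_iff, coeff_zero_eq_eval_zero]
  obtain ⟨ps1', rfl⟩ : X ∣ ps1 := by rwa [X_dvd_iff, coeff_zero_eq_eval_zero]
  have quad2 : ∀ T : ℝ → ℝ, Continuous T → (∀ v,
      (3 * v * pc'.eval v ^ 2 - 2 * θb * (X * pc1').eval v)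
      + (2 * v * pc'.eval v * sb - 12 * v ^ 2 * θb ^ 3 - 2 * θb * (X * ps1').eval v) * T v
      - v * (sb ^ 2 + 4 * θb ^ 2 * σ x) * T v ^ 2 = 0) → ∀ v,
      (3 * pc'.eval v ^ 2 - 2 * θb * pc1'.eval v)
      + (2 * pc'.eval v * sb - 12 * v * θb ^ 3 - 2 * θb * ps1'.eval v) * T v
      - (sb ^ 2 + 4 * θb ^ 2 * σ x) * T v ^ 2 = 0 := by
    intro T hT h
    refine eq_zero_of_polynomial_mul_eq_zero (d := X) ?_ X_ne_zero fun v => ?_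
    · have h1 := pc'.continuous
      have h2 := pc1'.continuous
      have h3 := ps1'.continuous
      fun_prop
    · have := h v
      simp only [eval_mul, eval_X] at this ⊢
      linear_combination this
  have rF := quad2 _ contF qF
  have rG := quad2 _ contG qG
  set κ := sb ^ 2 + 4 * θb ^ 2 * σ x
  -- What remains is a quadratic equation with constant leading coefficient −κ, and Vieta's formulas
  -- give the two polynomials.
  refine ⟨C κ⁻¹ * (2 * pc' * C sb - 12 * X * C (θb ^ 3) - 2 * C θb * ps1'),
    -C κ⁻¹ * (3 * pc' ^ 2 - 2 * C θb * pc1'), fun v => ?_⟩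
  have hsum : κ * (F (x, a + v • b) + G (x, a + v • b)) =
      2 * pc'.eval v * sb - 12 * v * θb ^ 3 - 2 * θb * ps1'.eval v := by
    apply mul_left_cancel₀ (hFG v)
    linear_combination rG v - rF v
  constructor
  · simp
    field_simp
    linear_combination hsum
  · simp
    field_simp
    linear_combination F (x, a + v • b) * hsum + rF v

/-- The leading coefficient of the reduced equation does not vanish on any open set. -/
theorem exists_leading_ne_zero (S : ProjPair U ϑ σ f F P G Q) {W : Set E} (hW : IsOpen W)
    (hWU : W ⊆ U) (hWn : W.Nonempty) (hf : ∀ x ∈ W, f x = 0) {b : E}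
    (hb : ∀ x ∈ W, ϑ x b ≠ 0) :
    ∃ x ∈ W, fderiv ℝ σ x b ^ 2 + 4 * ϑ x b ^ 2 * σ x ≠ 0 := by
  by_contra! hcon
  have hb0 : b ≠ 0 := by
    rintro rfl
    obtain ⟨x, hx⟩ := hWn
    exact hb x hx (map_zero _)
  -- If the leading coefficient vanishes throughout W, the equation is affine with two distinct
  -- roots, so its linear coefficient vanishes too.
  have hlin : ∀ x ∈ W, 2 * fderiv ℝ ϑ x b b * fderiv ℝ σ x b - 12 * ϑ x b ^ 3
        - 2 * ϑ x b * fderiv ℝ (fun z => fderiv ℝ σ z b) x b = 0 := by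
    intro x hx
    have h1 := S.fst.quartic S.smooth_f S.rel_fst (hWU hx) hb0
    have h2 := S.snd.quartic S.smooth_f S.rel_snd (hWU hx) hb0
    have hev : f =ᶠ[𝓝 x] 0 := by
      filter_upwards [hW.mem_nhds hx] with z hz using hf z hz
    have hdf : fderiv ℝ f x = 0 := by
      rw [hev.fderiv_eq]; simp
    rw [hf x hx, hdf] at h1 h2
    simp only [zero_apply] at h1 h2
    have hk := hcon x hx
    have hne : F (x, b) - G (x, b) ≠ 0 := by
      linarith [S.pos x (hWU hx) _ hb0, S.neg (hWU hx) hb0]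
    refine (mul_eq_zero.1 (?_ : (F (x, b) - G (x, b)) * _ = 0)).resolve_left hne
    linear_combination h1 - h2 + (F (x, b) ^ 2 - G (x, b) ^ 2) * hk
  -- Eliminating the second derivative of σ between `hlin` and the derivative of the leading
  -- coefficient along b leaves −8θ³s = 0. With s = 0 on W, `hlin` reduces to −12θ³ = 0, which is
  -- absurd.
  have hs : ∀ x ∈ W, fderiv ℝ σ x b = 0 := by
    intro x hx
    have ds := ((S.fst.contDiffAt_dfun (hWU hx) b).differentiableAt (by simp)).hasFDerivAt
    have dθ := S.fst.hasFDerivAt_form_apply (hWU hx) b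
    have dσ := ((S.fst.contDiffAt_fun (hWU hx)).differentiableAt (by simp)).hasFDerivAt
    have hd := (ds.pow 2).add (((dθ.pow 2).const_mul (4 : ℝ)).mul dσ)
    have hz := (hasFDerivAt_const (𝕜 := ℝ) (0 : ℝ) x).congr_of_eventuallyEq
      (f₁ := (fun z => fderiv ℝ σ z b ^ 2) + (fun z => 4 * ϑ z b ^ 2) * σ) (by
      filter_upwards [hW.mem_nhds hx] with z hz using hcon z hz)
    have := congrArg (fun L : E →L[ℝ] ℝ => L b) (hd.unique hz)
    simp at this
    have h8 : (-8 * ϑ x b ^ 3) * fderiv ℝ σ x b = 0 := by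
      linear_combination fderiv ℝ σ x b * hlin x hx + ϑ x b * this
        - 2 * fderiv ℝ ϑ x b b * hcon x hx
    exact (mul_eq_zero.1 h8).resolve_left
      (mul_ne_zero (by norm_num) (pow_ne_zero 3 (hb x hx)))
  obtain ⟨x, hx⟩ := hWn
  have hev : (fun z => fderiv ℝ σ z b) =ᶠ[𝓝 x] 0 := by
    filter_upwards [hW.mem_nhds hx] with z hz using hs z hz
  have h1 := hlin x hx
  rw [hs x hx, hev.fderiv_eq] at h1
  have : ϑ x b ^ 3 = 0 := by
    simp at h1
    simp [h1]
  exact pow_ne_zero 3 (hb x hx) this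

end ProjPair

end

/-! ### From planes to linear and quadratic forms -/

section

variable {E : Type*} [NormedAddCommGroup E] [NormedSpace ℝ E]

section Planes

open Polynomial

variable {B : E → ℝ} {k : ℕ} {a b : E}

theorem tendsto_add_inv_smul (hB : ContinuousAt B b) :
    Tendsto (fun v : ℝ => B (b + v⁻¹ • a)) atTop (𝓝 (B b)) := by
  refine hB.tendsto.comp ?_
  have : Tendsto (fun v : ℝ => b + v⁻¹ • a) atTop (𝓝 (b + (0 : ℝ) • a)) :=
    tendsto_const_nhds.add (tendsto_inv_atTop_zero.smul_const a)
  simpa using this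

theorem eval_eq_of_homogeneous {p : ℝ[X]} (hom : ∀ (c : ℝ) (y : E), B (c • y) = c ^ k * B y)
    (hp : ∀ v : ℝ, B (a + v • b) = p.eval v) {v : ℝ} (hv : v ≠ 0) :
    p.eval v = v ^ k * B (b + v⁻¹ • a) := by
  rw [← hp, ← hom, smul_add, smul_smul, mul_inv_cancel₀ hv, one_smul, add_comm]

/-- By homogeneity p(v) = vᵏ B(b + v⁻¹a), and the last factor converges as v tends to infinity; so p
grows no faster than vᵏ. -/
theorem degree_le_of_homogeneous {p : ℝ[X]} (hB : ContinuousAt B b)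
    (hom : ∀ (c : ℝ) (y : E), B (c • y) = c ^ k * B y)
    (hp : ∀ v : ℝ, B (a + v • b) = p.eval v) : p.degree < (k + 1 : ℕ) := by
  rw [← degree_X_pow (R := ℝ) (k + 1), ← div_tendsto_atTop_zero_iff_degree_lt _ _
    (pow_ne_zero _ X_ne_zero)]
  have h : Tendsto (fun v : ℝ => B (b + v⁻¹ • a) * v⁻¹) atTop (𝓝 (B b * 0)) :=
    (tendsto_add_inv_smul hB).mul tendsto_inv_atTop_zero
  rw [mul_zero] at h
  refine h.congr' ?_
  filter_upwards [eventually_ne_atTop (0 : ℝ)] with v hv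
  rw [eval_eq_of_homogeneous hom hp hv, eval_pow, eval_X]
  generalize B (b + v⁻¹ • a) = β
  field_simp
  ring

/-- The degree bound makes p affine. Its constant term is B(a) and its slope is the limit B(b) at
infinity; scaling passes from the line a + vb to the plane. -/
theorem linear_on_plane {p : ℝ[X]} (hB : ContinuousAt B b)
    (hom : ∀ (c : ℝ) (y : E), B (c • y) = c * B y)
    (hp : ∀ v : ℝ, B (a + v • b) = p.eval v) (s t : ℝ) :
    B (s • a + t • b) = s * B a + t * B b := by
  have hom' : ∀ (c : ℝ) (y : E), B (c • y) = c ^ 1 * B y := by simpa using hom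
  have hdeg : p.natDegree < 2 := by
    rcases eq_or_ne p 0 with rfl | hp0
    · simp
    · exact (natDegree_lt_iff_degree_lt hp0).2 (degree_le_of_homogeneous hB hom' hp)
  have hexp : ∀ v, p.eval v = p.coeff 0 + p.coeff 1 * v := by
    intro v
    rw [eval_eq_sum_range' hdeg]
    simp [Finset.sum_range_succ]
  have ha : B a = p.coeff 0 := by
    have := hp 0
    rw [hexp] at this
    simpa using this
  have hb : B b = p.coeff 1 := by
    refine tendsto_nhds_unique (tendsto_add_inv_smul (a := a) hB) ?_
    have h : Tendsto (fun v : ℝ => p.coeff 0 * v⁻¹ + p.coeff 1) atTop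
        (𝓝 (p.coeff 0 * 0 + p.coeff 1)) :=
      (tendsto_const_nhds.mul tendsto_inv_atTop_zero).add tendsto_const_nhds
    rw [mul_zero, zero_add] at h
    refine h.congr' ?_
    filter_upwards [eventually_ne_atTop (0 : ℝ)] with v hv
    have := eval_eq_of_homogeneous hom' hp hv
    rw [hexp] at this
    generalize B (b + v⁻¹ • a) = β at this ⊢
    field_simp
    linear_combination this
  rcases eq_or_ne s 0 with rfl | hs
  · simp [hom]
  · have : s • a + t • b = s • (a + (t / s) • b) := by
      rw [smul_add, smul_smul, mul_div_cancel₀ _ hs]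
    rw [this, hom, hp, hexp, ha, hb]
    field_simp

/-- As in the linear case, with p of degree at most two; its middle coefficient is found from the
value at v = 1. -/
theorem quadratic_on_plane {p : ℝ[X]} (hB : ContinuousAt B b)
    (hom : ∀ (c : ℝ) (y : E), B (c • y) = c ^ 2 * B y)
    (hp : ∀ v : ℝ, B (a + v • b) = p.eval v) (s t : ℝ) :
    B (s • a + t • b) = s ^ 2 * B a + t ^ 2 * B b + s * t * (B (a + b) - B a - B b) := by
  have hdeg : p.natDegree < 3 := by
    rcases eq_or_ne p 0 with rfl | hp0
    · simp
    · exact (natDegree_lt_iff_degree_lt hp0).2 (degree_le_of_homogeneous hB hom hp)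
  have hexp : ∀ v, p.eval v = p.coeff 0 + p.coeff 1 * v + p.coeff 2 * v ^ 2 := by
    intro v
    rw [eval_eq_sum_range' hdeg]
    simp [Finset.sum_range_succ]
  have ha : B a = p.coeff 0 := by
    have := hp 0
    rw [hexp] at this
    simpa using this
  have hab : B (a + b) = p.coeff 0 + p.coeff 1 + p.coeff 2 := by
    have := hp 1
    rw [hexp] at this
    simpa using this
  have hb : B b = p.coeff 2 := by
    refine tendsto_nhds_unique (tendsto_add_inv_smul (a := a) hB) ?_
    have h : Tendsto (fun v : ℝ => p.coeff 0 * (v⁻¹ * v⁻¹) + p.coeff 1 * v⁻¹ + p.coeff 2) atTop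
        (𝓝 (p.coeff 0 * (0 * 0) + p.coeff 1 * 0 + p.coeff 2)) :=
      ((tendsto_const_nhds.mul (tendsto_inv_atTop_zero.mul tendsto_inv_atTop_zero)).add
        (tendsto_const_nhds.mul tendsto_inv_atTop_zero)).add tendsto_const_nhds
    simp only [mul_zero, zero_add] at h
    refine h.congr' ?_
    filter_upwards [eventually_ne_atTop (0 : ℝ)] with v hv
    have := eval_eq_of_homogeneous hom hp hv
    rw [hexp] at this
    generalize B (b + v⁻¹ • a) = β at this ⊢
    field_simp
    linear_combination this
  rcases eq_or_ne s 0 with rfl | hs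
  · simp [hom]
  · have : s • a + t • b = s • (a + (t / s) • b) := by
      rw [smul_add, smul_smul, mul_div_cancel₀ _ hs]
    rw [this, hom, hp, hexp, ha, hb, hab]
    field_simp
    ring

end Planes

/-- `B` is additive and `M` is quadratic. -/
structure IsLinQuad (B M : E → ℝ) : Prop where
  add : ∀ y z, B (y + z) = B y + B z
  quad : ∀ y z (s t : ℝ), M (s • y + t • z) =
    s ^ 2 * M y + t ^ 2 * M z + s * t * (M (y + z) - M y - M z)

/-- Homogeneous functions which are linear and quadratic, respectively, on the planes transverse to
a hyperplane are linear and quadratic everywhere. -/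
theorem isLinQuad_of_transverse {B M : E → ℝ} {ϑ : E →L[ℝ] ℝ} (hϑ : ϑ ≠ 0)
    (homB : ∀ (c : ℝ) (y : E), B (c • y) = c * B y)
    (homM : ∀ (c : ℝ) (y : E), M (c • y) = c ^ 2 * M y)
    (rayB : ∀ y d, Tendsto (fun ε : ℝ => B (y + ε • d)) (𝓝[>] 0) (𝓝 (B y)))
    (rayM : ∀ y d, Tendsto (fun ε : ℝ => M (y + ε • d)) (𝓝[>] 0) (𝓝 (M y)))
    (h : ∀ a b, a ≠ 0 → ϑ a = 0 → ϑ b ≠ 0 → ∀ s t : ℝ,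
      B (s • a + t • b) = s * B a + t * B b ∧
      M (s • a + t • b) = s ^ 2 * M a + t ^ 2 * M b + s * t * (M (a + b) - M a - M b)) :
    IsLinQuad B M := by
  have B0 : B 0 = 0 := by simpa using homB 0 0
  have M0 : M 0 = 0 := by simpa using homM 0 0
  have h' : ∀ a b, ϑ a = 0 → ϑ b ≠ 0 → ∀ s t : ℝ,
      B (s • a + t • b) = s * B a + t * B b ∧
      M (s • a + t • b) = s ^ 2 * M a + t ^ 2 * M b + s * t * (M (a + b) - M a - M b) := by
    intro a b ha hb s t
    rcases eq_or_ne a 0 with rfl | ha0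
    · simp [B0, M0, homB, homM]
    · exact h a b ha0 ha hb s t
  have key : ∀ y z, ϑ z ≠ 0 → B (y + z) = B y + B z ∧ ∀ s t : ℝ, M (s • y + t • z) =
      s ^ 2 * M y + t ^ 2 * M z + s * t * (M (y + z) - M y - M z) := by
    intro y z hz
    -- Because θ(z) ≠ 0, the vector y splits along ker θ ⊕ ℝz, and both y and z then lie in one
    -- transverse plane.
    obtain ⟨a, r, ha, rfl⟩ : ∃ a : E, ∃ r : ℝ, ϑ a = 0 ∧ y = a + r • z := by
      refine ⟨y - (ϑ y / ϑ z) • z, ϑ y / ϑ z, ?_, by simp⟩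
      simp [div_mul_cancel₀ _ hz]
    have e1 : a + r • z = (1 : ℝ) • a + r • z := by simp
    have e2 : a + r • z + z = (1 : ℝ) • a + (r + 1) • z := by rw [add_smul]; simp [add_assoc]
    refine ⟨?_, fun s t => ?_⟩
    · rw [e2, e1, (h' a z ha hz _ _).1, (h' a z ha hz _ _).1]
      ring
    · have e3 : s • (a + r • z) + t • z = s • a + (s * r + t) • z := by
        rw [smul_add, smul_smul, add_smul, add_assoc]
      rw [e3, e2, e1, (h' a z ha hz _ _).2, (h' a z ha hz _ _).2, (h' a z ha hz _ _).2]
      ring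
  obtain ⟨w, hw⟩ : ∃ w, ϑ w ≠ 0 := by
    by_contra! hcon
    exact hϑ (ContinuousLinearMap.ext hcon)
  -- A kernel vector z is pushed off the kernel by εw; the identities then pass to the limit along
  -- rays.
  have pert : ∀ z, ϑ z = 0 → ∀ᶠ ε : ℝ in 𝓝[>] 0, ϑ (z + ε • w) ≠ 0 := by
    intro z hz
    filter_upwards [self_mem_nhdsWithin] with ε hε
    simp [hz, hw, (mem_Ioi.1 hε).ne']
  have all : ∀ y z, B (y + z) = B y + B z ∧ ∀ s t : ℝ, M (s • y + t • z) =
      s ^ 2 * M y + t ^ 2 * M z + s * t * (M (y + z) - M y - M z) := by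
    intro y z
    by_cases hz : ϑ z = 0
    · constructor
      · refine tendsto_nhds_unique (rayB (y + z) w) (((rayB z w).const_add (B y)).congr' ?_)
        filter_upwards [pert z hz] with ε hε
        rw [add_assoc, (key y _ hε).1]
      · intro s t
        have h1 := ((((rayM z w).const_mul (t ^ 2)).const_add (s ^ 2 * M y))).add
          ((((rayM (y + z) w).sub_const (M y)).sub (rayM z w)).const_mul (s * t))
        refine tendsto_nhds_unique (rayM (s • y + t • z) (t • w)) (h1.congr' ?_)
        filter_upwards [pert z hz] with ε hε
        have e : s • y + t • z + ε • t • w = s • y + t • (z + ε • w) := by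
          rw [smul_add, add_assoc, smul_comm ε t w]
        rw [e, (key y _ hε).2, add_assoc y z]
    · exact key y z hz
  exact ⟨fun y z => (all y z).1, fun y z => (all y z).2⟩

/-- Two functions that are continuous on `U` and agree on a set whose closure contains `x ∈ U`
agree at `x`. -/
theorem eq_of_mem_closure {X : Type*} [TopologicalSpace X] {U D : Set X}
    {g h : X → ℝ} (hg : ContinuousOn g U) (hh : ContinuousOn h U) (hD : D ⊆ U)
    (e : ∀ x ∈ D, g x = h x) {x : X} (hx : x ∈ U) (hxD : x ∈ closure D) : g x = h x := by
  have : (𝓝[D] x).NeBot := mem_closure_iff_nhdsWithin_neBot.1 hxD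
  refine tendsto_nhds_unique ((hg x hx).mono_left (nhdsWithin_mono x hD))
    (((hh x hx).mono_left (nhdsWithin_mono x hD)).congr' ?_)
  filter_upwards [self_mem_nhdsWithin] with z hz using (e z hz).symm

namespace ProjPair

variable {U : Set E} {ϑ : E → E →L[ℝ] ℝ} {σ f : E → ℝ} {F P G Q : E × E → ℝ}

theorem hom_F (S : ProjPair U ϑ σ f F P G Q) {x : E} (hx : x ∈ U) (y : E) {c : ℝ} (hc : 0 ≤ c) :
    F (x, c • y) = c * F (x, y) := by
  rcases hc.eq_or_lt with rfl | hc
  · simp [S.zero x hx]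
  · rcases eq_or_ne y 0 with rfl | hy
    · simp [S.zero x hx]
    · exact S.fst.hom_F x hx y hy c hc

/-- A negative scalar c exchanges the roles of the two solutions: F(cy) = cG(y) and G(cy) = cF(y).
Symmetric expressions are therefore homogeneous for all real c. -/
theorem hom_sum (S : ProjPair U ϑ σ f F P G Q) {x : E} (hx : x ∈ U) (c : ℝ) (y : E) :
    F (x, c • y) + G (x, c • y) = c * (F (x, y) + G (x, y)) := by
  simp only [S.reflect x hx]
  rcases le_total 0 c with hc | hc
  · rw [← smul_neg, S.hom_F hx _ hc, S.hom_F hx _ hc]; ring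
  · have h1 : c • y = (-c) • (-y) := by simp
    have h2 : -(c • y) = (-c) • y := by simp
    rw [h2, h1, S.hom_F hx _ (neg_nonneg.2 hc), S.hom_F hx _ (neg_nonneg.2 hc)]; ring

theorem hom_prod (S : ProjPair U ϑ σ f F P G Q) {x : E} (hx : x ∈ U) (c : ℝ) (y : E) :
    F (x, c • y) * G (x, c • y) = c ^ 2 * (F (x, y) * G (x, y)) := by
  simp only [S.reflect x hx]
  rcases le_total 0 c with hc | hc
  · rw [← smul_neg, S.hom_F hx _ hc, S.hom_F hx _ hc]; ring
  · have h1 : c • y = (-c) • (-y) := by simp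
    have h2 : -(c • y) = (-c) • y := by simp
    rw [h2, h1, S.hom_F hx _ (neg_nonneg.2 hc), S.hom_F hx _ (neg_nonneg.2 hc)]; ring

/-- At y = 0 no smoothness is available and the limit comes from positive homogeneity, whence the
one-sided form. -/
theorem ray_F (S : ProjPair U ϑ σ f F P G Q) {x : E} (hx : x ∈ U) (y d : E) :
    Tendsto (fun ε : ℝ => F (x, y + ε • d)) (𝓝[>] 0) (𝓝 (F (x, y))) := by
  rcases eq_or_ne y 0 with rfl | hy
  · have h : Tendsto (fun ε : ℝ => ε * F (x, d)) (𝓝[>] 0) (𝓝 (0 * F (x, d))) :=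
      (tendsto_id.mono_left nhdsWithin_le_nhds).mul_const _
    rw [zero_mul] at h
    rw [S.zero x hx]
    refine h.congr' ?_
    filter_upwards [self_mem_nhdsWithin] with ε hε
    rw [zero_add, S.hom_F hx d (mem_Ioi.1 hε).le]
  · have h : ContinuousAt (fun ε : ℝ => F (x, y + ε • d)) 0 :=
      ContinuousAt.comp (g := F) (f := fun ε : ℝ => (x, y + ε • d))
        (by simpa using (S.fst.contDiffAt_F hx hy).continuousAt) (by fun_prop)
    have := h.tendsto.mono_left (nhdsWithin_le_nhds (s := Ioi 0))
    simpa using this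

theorem ray_G (S : ProjPair U ϑ σ f F P G Q) {x : E} (hx : x ∈ U) (y d : E) :
    Tendsto (fun ε : ℝ => G (x, y + ε • d)) (𝓝[>] 0) (𝓝 (G (x, y))) := by
  simp only [S.reflect x hx]
  have := (S.ray_F hx (-y) (-d)).neg
  refine this.congr fun ε => ?_
  rw [neg_add, smul_neg]

theorem isLinQuad_of_polynomial (S : ProjPair U ϑ σ f F P G Q) {x : E} (hx : x ∈ U)
    (hϑ : ϑ x ≠ 0)
    (h : ∀ a b, ϑ x a = 0 → ϑ x b ≠ 0 → (∀ v : ℝ, a + v • b ≠ 0) →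
      ∃ p m : Polynomial ℝ, ∀ v, F (x, a + v • b) + G (x, a + v • b) = p.eval v ∧
      F (x, a + v • b) * G (x, a + v • b) = m.eval v) :
    IsLinQuad (fun y => F (x, y) + G (x, y)) (fun y => F (x, y) * G (x, y)) := by
  refine isLinQuad_of_transverse hϑ (S.hom_sum hx) (S.hom_prod hx)
    (fun y d => (S.ray_F hx y d).add (S.ray_G hx y d))
    (fun y d => (S.ray_F hx y d).mul (S.ray_G hx y d)) ?_
  intro a b ha0 ha hb s t
  have hb0 : b ≠ 0 := by
    rintro rfl
    exact hb (map_zero _)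
  have hab : ∀ v : ℝ, a + v • b ≠ 0 := by
    intro v hv
    have h1 := congrArg (ϑ x) hv
    simp [ha, hb] at h1
    rw [h1] at hv
    exact ha0 (by simpa using hv)
  obtain ⟨p, m, hpm⟩ := h a b ha hb hab
  have cF : ContinuousAt (fun y => F (x, y)) b :=
    ContinuousAt.comp (g := F) (f := fun y => (x, y))
      (S.fst.contDiffAt_F hx hb0).continuousAt (by fun_prop)
  have cG : ContinuousAt (fun y => G (x, y)) b :=
    ContinuousAt.comp (g := G) (f := fun y => (x, y))
      (S.snd.contDiffAt_F hx hb0).continuousAt (by fun_prop)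
  exact ⟨linear_on_plane (B := fun y => F (x, y) + G (x, y)) (cF.add cG) (S.hom_sum hx)
      (fun v => (hpm v).1) s t,
    quadratic_on_plane (B := fun y => F (x, y) * G (x, y)) (cF.mul cG) (S.hom_prod hx)
      (fun v => (hpm v).2) s t⟩

theorem continuousOn_slice_F (S : ProjPair U ϑ σ f F P G Q) (y : E) :
    ContinuousOn (fun x => F (x, y)) U := by
  rcases eq_or_ne y 0 with rfl | hy
  · exact continuousOn_const.congr fun x hx => S.zero x hx
  · intro x hx
    exact (S.fst.slice_F hx hy).1.continuousAt.continuousWithinAt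

theorem continuousOn_slice_G (S : ProjPair U ϑ σ f F P G Q) (y : E) :
    ContinuousOn (fun x => G (x, y)) U :=
  (S.continuousOn_slice_F (-y)).neg.congr fun x hx => S.reflect x hx y

theorem isLinQuad_of_closure (S : ProjPair U ϑ σ f F P G Q) {D : Set E} (hD : D ⊆ U)
    (h : ∀ x ∈ D, IsLinQuad (fun y => F (x, y) + G (x, y)) (fun y => F (x, y) * G (x, y)))
    {x : E} (hx : x ∈ U) (hxD : x ∈ closure D) :
    IsLinQuad (fun y => F (x, y) + G (x, y)) (fun y => F (x, y) * G (x, y)) := by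
  have cB := fun y => (S.continuousOn_slice_F y).add (S.continuousOn_slice_G y)
  have cM := fun y => (S.continuousOn_slice_F y).mul (S.continuousOn_slice_G y)
  refine ⟨fun y z => ?_, fun y z s t => ?_⟩
  · exact eq_of_mem_closure (cB (y + z)) ((cB y).add (cB z)) hD
      (fun x hx => (h x hx).add y z) hx hxD
  · exact eq_of_mem_closure (cM (s • y + t • z))
      (((continuousOn_const.mul (cM y)).add (continuousOn_const.mul (cM z))).add
        (continuousOn_const.mul (((cM (y + z)).sub (cM y)).sub (cM z)))) hD
      (fun x hx => (h x hx).quad y z s t) hx hxD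

/-- Where `θ ≠ 0`, the sum of the two solutions is linear and their product is quadratic. -/
theorem isLinQuad_of_form_ne_zero (S : ProjPair U ϑ σ f F P G Q) {x : E} (hx : x ∈ U)
    (hϑ : ϑ x ≠ 0) :
    IsLinQuad (fun y => F (x, y) + G (x, y)) (fun y => F (x, y) * G (x, y)) := by
  refine S.isLinQuad_of_closure (D := {x ∈ U | IsLinQuad (fun y => F (x, y) + G (x, y))
    (fun y => F (x, y) * G (x, y))}) (sep_subset _ _) (fun x hx => hx.2) hx ?_
  obtain ⟨b, hb⟩ : ∃ b, ϑ x b ≠ 0 := by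
    by_contra! hcon
    exact hϑ (ContinuousLinearMap.ext hcon)
  have hVo : IsOpen {z ∈ U | ϑ z b ≠ 0} :=
    (S.fst.smooth_form.clm_apply contDiffOn_const).continuousOn.isOpen_inter_preimage
      S.fst.isOpen isOpen_compl_singleton
  rw [mem_closure_iff]
  intro O hO hxO
  have hne : ∀ z, ϑ z b ≠ 0 → ϑ z ≠ 0 := by
    rintro z hz h0
    rw [h0] at hz
    exact hz rfl
  -- In each neighbourhood of x, either f is nonzero at some point where θ(b) ≠ 0, or f vanishes on
  -- an open set and the reduced quadratic equation applies at a suitable point of it.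
  by_cases hcase : ∃ z ∈ O ∩ {z ∈ U | ϑ z b ≠ 0}, f z ≠ 0
  · obtain ⟨z, ⟨hzO, hzU, hzb⟩, hfz⟩ := hcase
    exact ⟨z, hzO, hzU, S.isLinQuad_of_polynomial hzU (hne z hzb) fun a b ha _ hab =>
      S.exists_polynomial_of_ne_zero hzU hfz ha hab⟩
  · push Not at hcase
    have hWo := hO.inter hVo
    obtain ⟨z, hzW, hκ⟩ := S.exists_leading_ne_zero hWo (fun z hz => hz.2.1)
      ⟨x, hxO, hx, hb⟩ hcase (fun z hz => hz.2.2)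
    refine ⟨z, hzW.1, hzW.2.1, S.isLinQuad_of_polynomial hzW.2.1 (hne z hzW.2.2) ?_⟩
    intro a b' ha hb' hab
    have hev : f =ᶠ[𝓝 z] 0 := by
      filter_upwards [hWo.mem_nhds hzW] with y hy using hcase y hy
    refine S.exists_polynomial_of_eq_zero hzW.2.1 hev ha hb' hab ?_
    -- Since f(z) = 0, dσ vanishes on ker θ. Replacing b by another transverse vector therefore
    -- multiplies the leading coefficient by r² ≠ 0.
    obtain ⟨r, hr⟩ : ∃ r, ϑ z b' = r * ϑ z b := ⟨ϑ z b' / ϑ z b, (div_mul_cancel₀ _ hzW.2.2).symm⟩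
    have h1 := S.dfun_eq_zero hzW.2.1 (hcase z hzW) (d := b' - r • b) (by simp [hr])
    have h2 : fderiv ℝ σ z b' = r * fderiv ℝ σ z b := by
      simpa [sub_eq_zero] using h1
    have hr0 : r ≠ 0 := by
      rintro rfl
      exact hb' (by simpa using hr)
    have h3 : fderiv ℝ σ z b' ^ 2 + 4 * ϑ z b' ^ 2 * σ z =
        r ^ 2 * (fderiv ℝ σ z b ^ 2 + 4 * ϑ z b ^ 2 * σ z) := by
      rw [h2, hr]; ring
    rw [h3]
    exact mul_ne_zero (pow_ne_zero 2 hr0) hκ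

end ProjPair

end

/-! ### Structure equations -/

section

variable {E : Type*} [NormedAddCommGroup E] [NormedSpace ℝ E]

namespace ProjPair

variable {U : Set E} {ϑ : E → E →L[ℝ] ℝ} {σ f : E → ℝ} {F P G Q : E × E → ℝ}

/-- Vieta's formula for the sum of the roots F, G of c + sT + fT² on ker θ. Once F + G is linear, it
says that dσ + f(F + G) is a multiple of θ; half of that multiple is the function L of
`exists_root`. -/
theorem dfun_add_eq_zero (S : ProjPair U ϑ σ f F P G Q) {x d : E} (hx : x ∈ U)
    (hd : ϑ x d = 0) : fderiv ℝ σ x d + f x * (F (x, d) + G (x, d)) = 0 := by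
  rcases eq_or_ne d 0 with rfl | hd0
  · simp [S.zero x hx, S.reflect x hx]
  have rF := S.rel_fst x hx d hd0
  have rG := S.rel_snd x hx d hd0
  rw [hd] at rF rG
  have : F (x, d) - G (x, d) ≠ 0 := by linarith [S.pos x hx d hd0, S.neg hx hd0]
  refine (mul_eq_zero.1 (?_ : (F (x, d) - G (x, d)) * _ = 0)).resolve_left this
  linear_combination rG - rF

/-- The vertical derivative of the linear function `F + G`. -/
theorem dY_sum (S : ProjPair U ϑ σ f F P G Q) {x y : E} (hx : x ∈ U) (hy : y ≠ 0)
    (hl : IsLinQuad (fun y => F (x, y) + G (x, y)) (fun y => F (x, y) * G (x, y))) (w : E) :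
    fderiv ℝ F (x, y) (0, w) + fderiv ℝ G (x, y) (0, w) = F (x, w) + G (x, w) := by
  have dF := hasFDerivAt_fiber ((S.fst.contDiffAt_F hx hy).differentiableAt (by simp))
  have dG := hasFDerivAt_fiber ((S.snd.contDiffAt_F hx hy).differentiableAt (by simp))
  have hline : HasDerivAt (fun t : ℝ => y + t • w) w 0 := by
    simpa using ((hasDerivAt_id (0 : ℝ)).smul_const w).const_add y
  have h := HasFDerivAt.comp_hasDerivAt (f := fun t : ℝ => y + t • w) (0 : ℝ)
    (by simpa using dF.add dG) hline
  have h2 : HasDerivAt (fun t : ℝ => (F (x, y) + G (x, y)) + t * (F (x, w) + G (x, w)))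
      (F (x, w) + G (x, w)) 0 := by
    simpa using ((hasDerivAt_id (0 : ℝ)).mul_const (F (x, w) + G (x, w))).const_add
      (F (x, y) + G (x, y))
  have h3 := h2.congr_of_eventuallyEq (Eventually.of_forall fun t => ?_) |>.unique h
  · simpa using h3.symm
  · have h4 := hl.add y (t • w)
    simp only [S.hom_sum hx] at h4
    exact h4

/-- The structure of the system at points where `θ ≠ 0`. -/
theorem exists_root (S : ProjPair U ϑ σ f F P G Q) (hE : 1 < Module.rank ℝ E) {x₀ : E}
    (hx₀ : x₀ ∈ U) (hϑ : ϑ x₀ ≠ 0) :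
    ∃ L : ℝ, f x₀ = L * (L ^ 2 + σ x₀) ∧ ∀ w, fderiv ℝ σ x₀ w = 6 * L * ϑ x₀ w ∧
      fderiv ℝ f x₀ w = (9 * L ^ 2 + σ x₀) * ϑ x₀ w := by
  obtain ⟨b, hb⟩ : ∃ b, ϑ x₀ b ≠ 0 := by
    by_contra! hcon
    exact hϑ (ContinuousLinearMap.ext hcon)
  have hb0 : b ≠ 0 := by
    rintro rfl
    exact hb (map_zero _)
  set W : Set E := {z ∈ U | ϑ z b ≠ 0} with hWdef
  have hW : IsOpen W :=
    (S.fst.smooth_form.clm_apply contDiffOn_const).continuousOn.isOpen_inter_preimage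
      S.fst.isOpen isOpen_compl_singleton
  have hlin : ∀ x ∈ W, IsLinQuad (fun y => F (x, y) + G (x, y)) (fun y => F (x, y) * G (x, y)) := by
    intro x hx
    refine S.isLinQuad_of_form_ne_zero hx.1 ?_
    intro h0
    exact hx.2 (by rw [h0]; rfl)
  set L : E → ℝ := fun x => (fderiv ℝ σ x b + f x * (F (x, b) + G (x, b))) / (2 * ϑ x b) with hL
  have hLs : ∀ x ∈ W, ∀ y, fderiv ℝ σ x y + f x * (F (x, y) + G (x, y)) = 2 * L x * ϑ x y := by
    intro x hx y
    have hxb := hx.2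
    set r := ϑ x y / ϑ x b with hr
    have h1 := S.dfun_add_eq_zero hx.1 (d := y + (-r) • b) (by simp [hr, hxb])
    have h2 := (hlin x hx).add y ((-r) • b)
    simp only [S.hom_sum hx.1] at h2
    rw [h2] at h1
    simp only [map_add, map_smul, smul_eq_mul] at h1
    have h3 : 2 * L x * ϑ x y = r * (fderiv ℝ σ x b + f x * (F (x, b) + G (x, b))) := by
      rw [hL, hr]
      field_simp
    rw [h3]
    linear_combination h1
  have dL : ∀ x ∈ W, DifferentiableAt ℝ L x := by
    intro x hx
    have d1 := (S.fst.contDiffAt_dfun hx.1 b).differentiableAt (by simp)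
    have d2 := (S.smooth_f.contDiffAt (S.fst.isOpen.mem_nhds hx.1)).differentiableAt (by simp)
    have d3 := (S.fst.slice_F hx.1 hb0).1
    have d4 := (S.snd.slice_F hx.1 hb0).1
    have d5 := (S.fst.hasFDerivAt_form_apply hx.1 b).differentiableAt
    simp only [hL, div_eq_mul_inv]
    exact (d1.add (d2.mul (d3.add d4))).mul ((d5.const_mul 2).inv (mul_ne_zero two_ne_zero hx.2))
  -- Subtracting the two relations gives 2θ(P − Q) = (F − G)(s + f(F + G)) = 2Lθ(F − G). Division by
  -- θ is legitimate off its kernel, and continuity covers the kernel.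
  have hPQ : ∀ x ∈ W, ∀ y, y ≠ 0 → P (x, y) - Q (x, y) = L x * (F (x, y) - G (x, y)) := by
    intro x hx
    have gen : ∀ y, y ≠ 0 → ϑ x y ≠ 0 →
        P (x, y) - Q (x, y) = L x * (F (x, y) - G (x, y)) := by
      intro y hy hyθ
      have e1 := S.rel_fst x hx.1 y hy
      have e2 := S.rel_snd x hx.1 y hy
      apply mul_left_cancel₀ (mul_ne_zero two_ne_zero hyθ)
      linear_combination e1 - e2 + (F (x, y) - G (x, y)) * hLs x hx y
    intro y hy
    by_cases hyθ : ϑ x y = 0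
    · have cont : ∀ A : E × E → ℝ, ContinuousAt A (x, y) →
          Tendsto (fun ε : ℝ => A (x, y + ε • b)) (𝓝[>] 0) (𝓝 (A (x, y))) := by
        intro A hA
        have h : ContinuousAt (fun ε : ℝ => A (x, y + ε • b)) 0 :=
          ContinuousAt.comp (g := A) (f := fun ε : ℝ => (x, y + ε • b)) (by simpa using hA)
            (by fun_prop)
        have := h.tendsto.mono_left (nhdsWithin_le_nhds (s := Ioi 0))
        simpa using this
      have cF := cont F (S.fst.contDiffAt_F hx.1 hy).continuousAt
      have cG := cont G (S.snd.contDiffAt_F hx.1 hy).continuousAt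
      have cP := cont P (S.fst.contDiffAt_P hx.1 hy).continuousAt
      have cQ := cont Q (S.snd.contDiffAt_P hx.1 hy).continuousAt
      refine tendsto_nhds_unique (cP.sub cQ) (((cF.sub cG).const_mul (L x)).congr' ?_)
      filter_upwards [self_mem_nhdsWithin] with ε hε
      have hθε : ϑ x (y + ε • b) ≠ 0 := by
        simp [hyθ, hx.2, (mem_Ioi.1 hε).ne']
      refine (gen _ ?_ hθε).symm
      intro h0
      rw [h0] at hθε
      exact hθε (map_zero _)
    · exact gen y hy hyθ
  have hpos : ∀ x ∈ W, ∀ y, y ≠ 0 → F (x, y) - G (x, y) ≠ 0 := fun x hx y hy => by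
    linarith [S.pos x hx.1 y hy, S.neg hx.1 hy]
  -- The horizontal derivative of P − Q = L(F − G), rewritten with the two systems. The identity
  -- itself and its vertical derivative eliminate Q, and `dY_sum` replaces the vertical derivative
  -- of F + G by its value at w.
  have keyId : ∀ x ∈ W, ∀ y, y ≠ 0 → ∀ w,
      (F (x, y) - G (x, y)) * (2 * fderiv ℝ L x w + (L x ^ 2 + σ x) * (F (x, w) + G (x, w))
        + 2 * ϑ x w) =
      -(fderiv ℝ F (x, y) (0, w) - fderiv ℝ G (x, y) (0, w)) *
        ((L x ^ 2 + σ x) * (F (x, y) + G (x, y)) + 4 * ϑ x y) := by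
    intro x hx y hy w
    have hF := ((S.fst.contDiffAt_F hx.1 hy).differentiableAt (by simp)).hasFDerivAt
    have hG := ((S.snd.contDiffAt_F hx.1 hy).differentiableAt (by simp)).hasFDerivAt
    have hP := ((S.fst.contDiffAt_P hx.1 hy).differentiableAt (by simp)).hasFDerivAt
    have hQ := ((S.snd.contDiffAt_P hx.1 hy).differentiableAt (by simp)).hasFDerivAt
    have h1 := (hasFDerivAt_base (y := y) (dL x hx)).mul (hF.sub hG)
    have h2 := h1.congr_of_eventuallyEq (f₁ := P - Q) (by
      filter_upwards [slit_mem_nhds hW hx hy] with q hq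
      exact hPQ q.1 hq.1 q.2 hq.2)
    have h3 := (hP.sub hQ).unique h2
    have eX := congrArg (fun T => T (w, 0)) h3
    have eY := congrArg (fun T => T (0, w)) h3
    simp at eX eY
    rw [S.fst.dX_P x hx.1 y hy, S.snd.dX_P x hx.1 y hy, S.fst.dX_F x hx.1 y hy,
      S.snd.dX_F x hx.1 y hy] at eX
    have eP := hPQ x hx y hy
    have eB := S.dY_sum hx.1 hy (hlin x hx) w
    rw [← eB]
    have hQe : Q (x, y) = P (x, y) - L x * (F (x, y) - G (x, y)) := by linear_combination -eP
    have hQw : fderiv ℝ Q (x, y) (0, w) = fderiv ℝ P (x, y) (0, w) -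
        L x * (fderiv ℝ F (x, y) (0, w) - fderiv ℝ G (x, y) (0, w)) := by linear_combination -eY
    rw [hQe, hQw] at eX
    linear_combination -2 * eX
  -- `keyId` with y = w, where Euler's relation allows cancellation of F − G.
  have hdL : ∀ x ∈ W, ∀ w, fderiv ℝ L x w =
      -3 * ϑ x w - (L x ^ 2 + σ x) * (F (x, w) + G (x, w)) := by
    intro x hx w
    rcases eq_or_ne w 0 with rfl | hw
    · simp [S.zero x hx.1, S.reflect x hx.1]
    · have h := keyId x hx w hw w
      rw [S.fst.dY_F_self hx.1 hw, S.snd.dY_F_self hx.1 hw] at h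
      apply mul_left_cancel₀ (hpos x hx w hw)
      linear_combination (1 / 2) * h
  -- The left side is a linear form X, which in dimension at least two has a nonzero zero y. At this
  -- y the right side of `keyId` vanishes, and with `hdL` the left side reduces to −(F − G)(y) X(w).
  have hX : ∀ x ∈ W, ∀ w, (L x ^ 2 + σ x) * (F (x, w) + G (x, w)) + 4 * ϑ x w = 0 := by
    intro x hx
    set X : E → ℝ := fun w => (L x ^ 2 + σ x) * (F (x, w) + G (x, w)) + 4 * ϑ x w with hXdef
    obtain ⟨y, hy, hXy⟩ : ∃ y, y ≠ 0 ∧ X y = 0 := by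
      obtain ⟨u, hu⟩ : ∃ u : E, u ≠ 0 := ⟨b, hb0⟩
      obtain ⟨v, hv⟩ := exists_linearIndependent_pair_of_one_lt_rank hE hu
      by_cases hXu : X u = 0
      · exact ⟨u, hu, hXu⟩
      · refine ⟨v + (-(X v / X u)) • u, ?_, ?_⟩
        · intro h0
          have := LinearIndependent.pair_iff.1 hv (-(X v / X u)) 1 (by
            rw [one_smul, add_comm]; exact h0)
          exact one_ne_zero this.2
        · have e1 := (hlin x hx).add v ((-(X v / X u)) • u)
          simp only [S.hom_sum hx.1] at e1
          have e2 : X (v + (-(X v / X u)) • u) = X v + (-(X v / X u)) * X u := by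
            simp only [hXdef] at e1 ⊢
            rw [e1]
            simp only [map_add, map_smul, smul_eq_mul]
            ring
          rw [e2]
          field_simp
          ring
    intro w
    have h := keyId x hx y hy w
    rw [hdL x hx w] at h
    simp only [hXdef] at hXy
    rw [hXy] at h
    apply mul_left_cancel₀ (hpos x hx y hy)
    linear_combination -h
  have hdL' : ∀ x ∈ W, ∀ w, fderiv ℝ L x w = ϑ x w := by
    intro x hx w
    linear_combination hdL x hx w - hX x hx w
  -- The derivative of X(b) = 0 along b, after elimination of P, Q and c, becomes (F − G)²(f − L(L²
  -- + σ)) = 0.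
  have hs : ∀ x ∈ W, f x = L x * (L x ^ 2 + σ x) := by
    intro x hx
    have d1 := (S.fst.slice_F hx.1 hb0)
    have d2 := (S.snd.slice_F hx.1 hb0)
    have dσ := ((S.fst.contDiffAt_fun hx.1).differentiableAt (by simp)).hasFDerivAt
    have h1 := ((((dL x hx).hasFDerivAt.pow 2).add dσ).mul
      (d1.1.hasFDerivAt.add d2.1.hasFDerivAt)).add
      ((S.fst.hasFDerivAt_form_apply hx.1 b).const_mul 4)
    have h2 := (hasFDerivAt_const (𝕜 := ℝ) (0 : ℝ) x).congr_of_eventuallyEq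
      (f₁ := (L ^ 2 + σ) * ((fun z => F (z, b)) + fun z => G (z, b)) + fun z => 4 * ϑ z b) (by
      filter_upwards [hW.mem_nhds hx] with z hz using hX z hz b)
    have h3 := congrArg (fun T : E →L[ℝ] ℝ => T b) (h1.unique h2)
    simp [d1.2, d2.2, hdL' x hx] at h3
    have e0 := hX x hx b
    have e1 := S.rel_fst x hx.1 b hb0
    have e2 := S.rel_snd x hx.1 b hb0
    have e3 := hLs x hx b
    have hne := hpos x hx b hb0
    have hθb := hx.2
    have e4 : (F (x, b) - G (x, b)) ^ 2 * (f x - L x * (L x ^ 2 + σ x)) = 0 := by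
      have ePQ := hPQ x hx b hb0
      linear_combination -h3 + (L x ^ 2 + σ x) * (F (x, b) - G (x, b)) * ePQ
        + (P (x, b) + Q (x, b)) * e0 - 2 * (e1 + e2) - (F (x, b) + G (x, b)) * e3
    have := (mul_eq_zero.1 e4).resolve_left (pow_ne_zero 2 hne)
    linear_combination this
  have hx₀W : x₀ ∈ W := ⟨hx₀, hb⟩
  have hsig : ∀ w, fderiv ℝ σ x₀ w = 6 * L x₀ * ϑ x₀ w := by
    intro w
    linear_combination hLs x₀ hx₀W w - L x₀ * hX x₀ hx₀W w
      - (F (x₀, w) + G (x₀, w)) * hs x₀ hx₀W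
  refine ⟨L x₀, hs x₀ hx₀W, fun w => ⟨hsig w, ?_⟩⟩
  have dσ := ((S.fst.contDiffAt_fun hx₀).differentiableAt (by simp)).hasFDerivAt
  have d1 := (dL x₀ hx₀W).hasFDerivAt
  have h1 := (d1.mul ((d1.pow 2).add dσ)).congr_of_eventuallyEq (f₁ := f) (by
    filter_upwards [hW.mem_nhds hx₀W] with z hz using hs z hz)
  have h2 := congrArg (fun T : E →L[ℝ] ℝ => T w) h1.fderiv
  simp [hdL' x₀ hx₀W, hsig] at h2
  linear_combination h2

end ProjPair

end

/-! ### Unique continuation -/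

section

variable {E : Type*} [NormedAddCommGroup E] [NormedSpace ℝ E]

theorem le_of_mem_closure {X : Type*} [TopologicalSpace X] {U D : Set X}
    {g h : X → ℝ} (hg : ContinuousOn g U) (hh : ContinuousOn h U) (hD : D ⊆ U)
    (e : ∀ x ∈ D, g x ≤ h x) {x : X} (hx : x ∈ U) (hxD : x ∈ closure D) : g x ≤ h x := by
  have : (𝓝[D] x).NeBot := mem_closure_iff_nhdsWithin_neBot.1 hxD
  refine le_of_tendsto_of_tendsto ((hg x hx).mono_left (nhdsWithin_mono x hD))
    ((hh x hx).mono_left (nhdsWithin_mono x hD)) ?_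
  filter_upwards [self_mem_nhdsWithin] with z hz using e z hz

/-- The function L exists only where θ ≠ 0. As a root of this cubic it is controlled by quantities
that are continuous on all of U. -/
theorem abs_le_of_cubic {L s f : ℝ} (h : f = L * (L ^ 2 + s)) : |L| ≤ 1 + |s| + |f| := by
  by_contra! hcon
  have hL : 0 < |L| := by linarith [abs_nonneg s, abs_nonneg f]
  have h1 : |L| ^ 3 ≤ |f| + |L| * |s| := by
    have : L ^ 3 = f - L * s := by rw [h]; ring
    rw [← abs_pow, this, ← abs_mul]
    exact abs_sub _ _
  nlinarith [abs_nonneg s, abs_nonneg f, mul_pos hL hL, mul_nonneg (abs_nonneg f) hL.le]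

namespace ProjPair

variable {U : Set E} {ϑ : E → E →L[ℝ] ℝ} {σ f : E → ℝ} {F P G Q : E × E → ℝ}

/-- With θ = 0 and c = 0 the relation becomes s + fT = 0 for both T = F and T = G, which are nonzero
and distinct. -/
theorem vanish_of_form_vanish (S : ProjPair U ϑ σ f F P G Q) {x y : E} (hx : x ∈ U)
    (hy : y ≠ 0) (h : ϑ =ᶠ[𝓝 x] 0) : f x = 0 ∧ fderiv ℝ σ x y = 0 := by
  have h0 : ϑ x = 0 := h.self_of_nhds
  have h1 : fderiv ℝ ϑ x = 0 := by rw [h.fderiv_eq]; simp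
  have e1 := S.rel_fst x hx y hy
  have e2 := S.rel_snd x hx y hy
  rw [h0, h1] at e1 e2
  simp only [zero_apply] at e1 e2
  have p := S.pos x hx y hy
  have n := S.neg hx hy
  have a1 : fderiv ℝ σ x y + f x * F (x, y) = 0 := by
    apply mul_left_cancel₀ p.ne'
    linear_combination -e1
  have a2 : fderiv ℝ σ x y + f x * G (x, y) = 0 := by
    apply mul_left_cancel₀ n.ne
    linear_combination -e2
  have a3 : f x = 0 := by
    have : F (x, y) - G (x, y) ≠ 0 := by linarith
    apply mul_left_cancel₀ this
    linear_combination a1 - a2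
  exact ⟨a3, by simpa [a3] using a1⟩

theorem mem_closure_union {U : Set E} (hU : IsOpen U) (ϑ : E → E →L[ℝ] ℝ) {x : E} (hx : x ∈ U) :
    x ∈ closure ({x ∈ U | ϑ x ≠ 0} ∪ {x ∈ U | ϑ =ᶠ[𝓝 x] 0}) := by
  rw [mem_closure_iff]
  intro O hO hxO
  by_cases hcase : ∃ z ∈ O ∩ U, ϑ z ≠ 0
  · obtain ⟨z, hz, hz0⟩ := hcase
    exact ⟨z, hz.1, Or.inl ⟨hz.2, hz0⟩⟩
  · push Not at hcase
    refine ⟨x, hxO, Or.inr ⟨hx, ?_⟩⟩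
    filter_upwards [(hO.inter hU).mem_nhds ⟨hxO, hx⟩] with z hz using hcase z hz

/-- Where θ ≠ 0 this follows from the structure equations and the bound on L; in the interior of the
zero set of θ everything vanishes. The two sets together are dense in U, and both sides are
continuous. -/
theorem bounds (S : ProjPair U ϑ σ f F P G Q) (hE : 1 < Module.rank ℝ E) {x : E} (hx : x ∈ U)
    (y : E) :
    |fderiv ℝ σ x y| ≤ 6 * (1 + |σ x| + |f x|) * |ϑ x y| ∧
    |fderiv ℝ f x y| ≤ (9 * (1 + |σ x| + |f x|) ^ 2 + |σ x|) * |ϑ x y| := by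
  rcases eq_or_ne y 0 with rfl | hy
  · simp
  have hD : {x ∈ U | ϑ x ≠ 0} ∪ {x ∈ U | ϑ =ᶠ[𝓝 x] 0} ⊆ U :=
    union_subset (sep_subset _ _) (sep_subset _ _)
  have hcl := mem_closure_union S.fst.isOpen ϑ hx
  have cσ := S.fst.smooth_fun.continuousOn
  have cf := S.smooth_f.continuousOn
  have cϑ : ContinuousOn (fun x => ϑ x y) U :=
    (S.fst.smooth_form.clm_apply contDiffOn_const).continuousOn
  have cdσ : ContinuousOn (fun x => fderiv ℝ σ x y) U :=
    ((S.fst.smooth_fun.fderiv_of_isOpen S.fst.isOpen (m := ∞) (by simp)).clm_apply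
      contDiffOn_const).continuousOn
  have cdf : ContinuousOn (fun x => fderiv ℝ f x y) U :=
    ((S.smooth_f.fderiv_of_isOpen S.fst.isOpen (m := ∞) (by simp)).clm_apply
      contDiffOn_const).continuousOn
  have cK : ContinuousOn (fun x => 1 + |σ x| + |f x|) U :=
    (continuousOn_const.add cσ.abs).add cf.abs
  have pointwise : ∀ x ∈ {x ∈ U | ϑ x ≠ 0} ∪ {x ∈ U | ϑ =ᶠ[𝓝 x] 0},
      |fderiv ℝ σ x y| ≤ 6 * (1 + |σ x| + |f x|) * |ϑ x y| ∧
      |fderiv ℝ f x y| ≤ (9 * (1 + |σ x| + |f x|) ^ 2 + |σ x|) * |ϑ x y| := by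
    rintro x (⟨hxU, hx0⟩ | ⟨hxU, hx0⟩)
    · obtain ⟨L, hL, h⟩ := S.exists_root hE hxU hx0
      have hLb := abs_le_of_cubic hL
      rw [(h y).1, (h y).2, abs_mul, abs_mul, abs_mul]
      refine ⟨?_, ?_⟩
      · rw [abs_of_pos (by norm_num : (0 : ℝ) < 6)]
        gcongr
      · gcongr
        refine (abs_add_le _ _).trans ?_
        rw [abs_mul, abs_pow, abs_of_pos (by norm_num : (0 : ℝ) < 9)]
        gcongr
    · have h1 := S.vanish_of_form_vanish hxU hy hx0
      have hev : f =ᶠ[𝓝 x] 0 := by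
        filter_upwards [hx0.eventually_nhds, S.fst.isOpen.mem_nhds hxU] with z hz hzU
        exact (S.vanish_of_form_vanish hzU hy hz).1
      rw [h1.2, hev.fderiv_eq]
      constructor
      · simp; positivity
      · simp; positivity
  exact ⟨le_of_mem_closure cdσ.abs ((continuousOn_const.mul cK).mul cϑ.abs) hD
      (fun x hx => (pointwise x hx).1) hx hcl,
    le_of_mem_closure cdf.abs (((continuousOn_const.mul (cK.pow 2)).add cσ.abs).mul cϑ.abs) hD
      (fun x hx => (pointwise x hx).2) hx hcl⟩

/-- The common zeros of `θ` and `f` propagate along segments. -/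
theorem propagate (S : ProjPair U ϑ σ f F P G Q) (hE : 1 < Module.rank ℝ E) {x u : E}
    (hseg : ∀ t ∈ Icc (0 : ℝ) 1, x + t • u ∈ U) (hϑ : ϑ x = 0) (hf : f x = 0) :
    ϑ (x + u) u = 0 := by
  rcases eq_or_ne u 0 with rfl | hu
  · exact map_zero _
  have hline : ∀ t : ℝ, HasDerivAt (fun t : ℝ => x + t • u) u t := fun t => by
    simpa using ((hasDerivAt_id t).smul_const u).const_add x
  have contAlong : ∀ g : E → ℝ, ContinuousOn g U →
      ContinuousOn (fun t : ℝ => g (x + t • u)) (Icc 0 1) := fun g hg =>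
    hg.comp (by fun_prop) hseg
  have cσ := contAlong _ S.fst.smooth_fun.continuousOn
  have cf := contAlong _ S.smooth_f.continuousOn
  have cF := contAlong _ (S.continuousOn_slice_F u)
  have cP := contAlong (fun z => P (z, u)) fun z hz =>
    (S.fst.slice_P hz hu).1.continuousAt.continuousWithinAt
  set K : ℝ → ℝ := fun t => 1 + |σ (x + t • u)| + |f (x + t • u)|
  have cK : ContinuousOn K (Icc 0 1) := (continuousOn_const.add cσ.abs).add cf.abs
  set C₁ : ℝ → ℝ := fun t => 2 * |P (x + t • u, u)| + 6 * K t * |F (x + t • u, u)|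
    + |F (x + t • u, u)| ^ 2
  set C₂ : ℝ → ℝ := fun t => 9 * K t ^ 2 + |σ (x + t • u)|
  have cC : ContinuousOn (fun t => max (C₁ t) (C₂ t)) (Icc 0 1) := by
    refine ContinuousOn.sup ?_ ?_
    · exact ((continuousOn_const.mul cP.abs).add ((continuousOn_const.mul cK).mul cF.abs)).add
        (cF.abs.pow 2)
    · exact (continuousOn_const.mul (cK.pow 2)).add cσ.abs
  obtain ⟨C, hC⟩ := isCompact_Icc.bddAbove_image cC
  have hC' : ∀ t ∈ Icc (0 : ℝ) 1, C₁ t ≤ C ∧ C₂ t ≤ C := fun t ht =>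
    max_le_iff.1 (hC ⟨t, ht, rfl⟩)
  -- The derivative of θ(u) along the segment is c = 2θP − sF − fF², and s and df(u) are bounded by
  -- θ(u). Thus |z'| ≤ C|z| with z(0) = 0, and Grönwall's inequality gives z = 0.
  set z : ℝ → ℝ × ℝ := fun t => (ϑ (x + t • u) u, f (x + t • u))
  set z' : ℝ → ℝ × ℝ := fun t => (fderiv ℝ ϑ (x + t • u) u u, fderiv ℝ f (x + t • u) u)
  have hz : ∀ t ∈ Icc (0 : ℝ) 1, HasDerivAt z (z' t) t := by
    intro t ht
    have h1 := (S.fst.hasFDerivAt_form_apply (hseg t ht) u).comp_hasDerivAt t (hline t)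
    have h2 := ((S.smooth_f.contDiffAt (S.fst.isOpen.mem_nhds (hseg t ht))).differentiableAt
      (by simp)).hasFDerivAt.comp_hasDerivAt t (hline t)
    exact h1.prodMk h2
  have hbound : ∀ t ∈ Ico (0 : ℝ) 1, ‖z' t‖ ≤ C * ‖z t‖ := by
    intro t ht
    have ht' : t ∈ Icc (0 : ℝ) 1 := ⟨ht.1, ht.2.le⟩
    obtain ⟨b1, b2⟩ := S.bounds hE (hseg t ht') u
    obtain ⟨c1, c2⟩ := hC' t ht'
    have n1 : |ϑ (x + t • u) u| ≤ ‖z t‖ := norm_fst_le (z t)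
    have n2 : |f (x + t • u)| ≤ ‖z t‖ := norm_snd_le (z t)
    refine norm_prod_le_iff.2 ⟨?_, ?_⟩
    · have rel := S.rel_fst _ (hseg t ht') u hu
      have e : fderiv ℝ ϑ (x + t • u) u u = 2 * ϑ (x + t • u) u * P (x + t • u, u)
          - fderiv ℝ σ (x + t • u) u * F (x + t • u, u)
          - f (x + t • u) * F (x + t • u, u) ^ 2 := by linear_combination -rel
      have h1 : ‖(z' t).1‖ ≤ |2 * ϑ (x + t • u) u * P (x + t • u, u)|
          + |fderiv ℝ σ (x + t • u) u * F (x + t • u, u)|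
          + |f (x + t • u) * F (x + t • u, u) ^ 2| := by
        rw [Real.norm_eq_abs]
        simp only [z']
        rw [e]
        exact (abs_sub _ _).trans (add_le_add_left (abs_sub _ _) _)
      refine h1.trans ?_
      rw [abs_mul, abs_mul, abs_mul, abs_mul, abs_pow, abs_of_pos (two_pos (α := ℝ))]
      have h2 : 2 * |ϑ (x + t • u) u| * |P (x + t • u, u)|
          + |fderiv ℝ σ (x + t • u) u| * |F (x + t • u, u)|
          + |f (x + t • u)| * |F (x + t • u, u)| ^ 2 ≤
          2 * ‖z t‖ * |P (x + t • u, u)| + 6 * K t * ‖z t‖ * |F (x + t • u, u)|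
          + ‖z t‖ * |F (x + t • u, u)| ^ 2 := by
        have b1' : |fderiv ℝ σ (x + t • u) u| ≤ 6 * K t * ‖z t‖ :=
          b1.trans (mul_le_mul_of_nonneg_left n1 (by positivity))
        gcongr
      refine h2.trans ?_
      calc _ = C₁ t * ‖z t‖ := by simp only [C₁]; ring
        _ ≤ C * ‖z t‖ := by gcongr
    · refine (b2.trans ?_ : |fderiv ℝ f (x + t • u) u| ≤ C * ‖z t‖)
      exact mul_le_mul c2 n1 (abs_nonneg _) ((by positivity : 0 ≤ C₂ t).trans c2)
  have hzero := eq_zero_of_abs_deriv_le_mul_abs_self_of_eq_zero_right (f := z) (f' := z') (K := C)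
    (fun t ht => (hz t ht).continuousAt.continuousWithinAt)
    (fun t ht => (hz t ⟨ht.1, ht.2.le⟩).hasDerivWithinAt) (by simp [z, hϑ, hf]) hbound 1
    ⟨zero_le_one, le_rfl⟩
  have := congrArg Prod.fst hzero
  simpa [z] using this

/-- If `θ` vanishes on a nonempty open subset of the connected set `U`, it vanishes on `U`. -/
theorem form_eq_zero (S : ProjPair U ϑ σ f F P G Q) (hE : 1 < Module.rank ℝ E)
    (hUc : IsPreconnected U) {x₀ : E} (hx₀ : x₀ ∈ U) (h : ϑ =ᶠ[𝓝 x₀] 0) :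
    ∀ x ∈ U, ϑ x = 0 := by
  have hsub : U ⊆ {x | ϑ =ᶠ[𝓝 x] 0} := by
    refine hUc.subset_of_closure_inter_subset isOpen_setOfPred_eventually_nhds ⟨x₀, hx₀, h⟩ ?_
    rintro x₁ ⟨hcl, hx₁⟩
    obtain ⟨r, hr, hball⟩ := Metric.isOpen_iff.1 S.fst.isOpen x₁ hx₁
    obtain ⟨x₂, hx₂, hd⟩ := Metric.mem_closure_iff.1 hcl r hr
    have hx₂' : x₂ ∈ Metric.ball x₁ r := by rwa [Metric.mem_ball, dist_comm]
    have hev : ∀ᶠ z in 𝓝 x₂, ϑ =ᶠ[𝓝 z] 0 ∧ z ∈ Metric.ball x₁ r :=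
      hx₂.eventually_nhds.and (Metric.isOpen_ball.mem_nhds hx₂')
    obtain ⟨δ, hδ, hδb⟩ := Metric.eventually_nhds_iff_ball.1 hev
    obtain ⟨e, he⟩ : ∃ e : E, e ≠ 0 := by
      have : Nontrivial E := by
        rw [← rank_pos_iff_nontrivial (R := ℝ)]
        exact lt_trans zero_lt_one hE
      exact exists_ne 0
    -- Every z near x₂ is a common zero of θ and f, so propagation along the segment from z to x
    -- applies. Varying z over a ball gives all directions at x and forces θ = 0 there.
    have hvan : ∀ x ∈ Metric.ball x₁ r, ∀ z ∈ Metric.ball x₂ δ, ϑ x (x - z) = 0 := by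
      intro x hx z hz
      obtain ⟨hz0, hzb⟩ := hδb z hz
      have := S.propagate hE (x := z) (u := x - z) (fun t ht => ?_) hz0.self_of_nhds
        (S.vanish_of_form_vanish (hball hzb) he hz0).1
      · simpa using this
      · refine hball ((convex_ball x₁ r).segment_subset hzb hx ?_)
        rw [segment_eq_image']
        exact ⟨t, ht, rfl⟩
    have hzero : ∀ x ∈ Metric.ball x₁ r, ϑ x = 0 := by
      intro x hx
      ext d
      have h0 := hvan x hx x₂ (Metric.mem_ball_self hδ)
      obtain ⟨ε, hε, hεd⟩ : ∃ ε : ℝ, ε ≠ 0 ∧ x₂ + ε • d ∈ Metric.ball x₂ δ := by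
        have hc : Tendsto (fun ε : ℝ => x₂ + ε • d) (𝓝[≠] 0) (𝓝 x₂) := by
          have : ContinuousAt (fun ε : ℝ => x₂ + ε • d) 0 := by fun_prop
          simpa using this.tendsto.mono_left (nhdsWithin_le_nhds (s := {0}ᶜ))
        obtain ⟨ε, h1, h2⟩ := ((hc.eventually (Metric.ball_mem_nhds x₂ hδ)).and
          self_mem_nhdsWithin).exists
        exact ⟨ε, h2, h1⟩
      have h1 := hvan x hx _ hεd
      have h2 : ε * ϑ x d = 0 := by
        rw [map_sub, map_add, map_smul, smul_eq_mul] at h1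
        rw [map_sub] at h0
        linear_combination h0 - h1
      simpa using (mul_eq_zero.1 h2).resolve_left hε
    filter_upwards [Metric.ball_mem_nhds x₁ hr] with x hx using hzero x hx
  exact fun x hx => (hsub hx).self_of_nhds

/-- By `form_eq_zero` the zeros of θ have no interior, so every point of U is a limit of points
where θ ≠ 0. -/
theorem isLinQuad (S : ProjPair U ϑ σ f F P G Q) (hE : 1 < Module.rank ℝ E)
    (hUc : IsPreconnected U) (hϑ : ∃ x ∈ U, ϑ x ≠ 0) {x : E} (hx : x ∈ U) :
    IsLinQuad (fun y => F (x, y) + G (x, y)) (fun y => F (x, y) * G (x, y)) := by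
  refine S.isLinQuad_of_closure (D := {x ∈ U | ϑ x ≠ 0}) (sep_subset _ _)
    (fun x hx => S.isLinQuad_of_form_ne_zero hx.1 hx.2) hx ?_
  rw [mem_closure_iff]
  intro O hO hxO
  by_contra hcon
  have hev : ϑ =ᶠ[𝓝 x] 0 := by
    filter_upwards [(hO.inter S.fst.isOpen).mem_nhds ⟨hxO, hx⟩] with z hz
    by_contra hz0
    exact hcon ⟨z, hz.1, hz.2, hz0⟩
  obtain ⟨y, hy, hy0⟩ := hϑ
  exact hy0 (S.form_eq_zero hE hUc hx hev y hy)

end ProjPair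

end

/-! ### Reflection and Randers metrics -/

section

variable {E : Type*} [NormedAddCommGroup E] [NormedSpace ℝ E]

theorem hasFDerivAt_reflect {f : E × E → ℝ} {x y : E} (hf : DifferentiableAt ℝ f (x, -y)) :
    HasFDerivAt (fun q : E × E => -f (q.1, -q.2))
      (-(fderiv ℝ f (x, -y)).comp ((ContinuousLinearMap.fst ℝ E E).prod
        (-ContinuousLinearMap.snd ℝ E E))) (x, y) :=
  (HasFDerivAt.comp (x, y) (g := f) (f := fun q : E × E => (q.1, -q.2)) hf.hasFDerivAt
    (hasFDerivAt_fst.prodMk hasFDerivAt_snd.neg)).neg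

namespace ProjSystem

variable {U : Set E} {ϑ : E → E →L[ℝ] ℝ} {σ : E → ℝ} {F P : E × E → ℝ}

/-- The reflected pair `(-F(x, -y), -P(x, -y))` satisfies the same equations. -/
theorem reflect (S : ProjSystem U ϑ σ F P) :
    ProjSystem U ϑ σ (fun q => -F (q.1, -q.2)) (fun q => -P (q.1, -q.2)) := by
  have dF : ∀ x ∈ U, ∀ y, y ≠ 0 → ∀ v w, fderiv ℝ (fun q : E × E => -F (q.1, -q.2)) (x, y) (v, w)
      = -fderiv ℝ F (x, -y) (v, -w) := fun x hx y hy v w => by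
    rw [(hasFDerivAt_reflect ((S.contDiffAt_F hx (neg_ne_zero.2 hy)).differentiableAt
      (by simp))).fderiv]
    simp
  have dP : ∀ x ∈ U, ∀ y, y ≠ 0 → ∀ v w, fderiv ℝ (fun q : E × E => -P (q.1, -q.2)) (x, y) (v, w)
      = -fderiv ℝ P (x, -y) (v, -w) := fun x hx y hy v w => by
    rw [(hasFDerivAt_reflect ((S.contDiffAt_P hx (neg_ne_zero.2 hy)).differentiableAt
      (by simp))).fderiv]
    simp
  have hmap : MapsTo (fun q : E × E => (q.1, -q.2)) (U ×ˢ {0}ᶜ) (U ×ˢ {0}ᶜ) := fun q hq =>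
    ⟨hq.1, by simpa using hq.2⟩
  have hneg : ContDiffOn ℝ ∞ (fun q : E × E => (q.1, -q.2)) (U ×ˢ {0}ᶜ) :=
    (contDiff_fst.prodMk contDiff_snd.neg).contDiffOn
  have neg_pair : ∀ w : E, ((0 : E), -w) = -((0 : E), w) := fun w => by simp
  exact
    { isOpen := S.isOpen
      smooth_form := S.smooth_form
      smooth_fun := S.smooth_fun
      smooth_F := (S.smooth_F.comp hneg hmap).neg
      smooth_P := (S.smooth_P.comp hneg hmap).neg
      hom_F := fun x hx y hy c hc => by
        rw [← smul_neg, S.hom_F x hx _ (neg_ne_zero.2 hy) c hc, mul_neg]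
      hom_P := fun x hx y hy c hc => by
        rw [← smul_neg, S.hom_P x hx _ (neg_ne_zero.2 hy) c hc, mul_neg]
      F_ne := fun x hx y hy => neg_ne_zero.2 (S.F_ne x hx _ (neg_ne_zero.2 hy))
      dX_F := fun x hx y hy w => by
        rw [dF x hx y hy, dF x hx y hy, dP x hx y hy, neg_zero,
          S.dX_F x hx _ (neg_ne_zero.2 hy), neg_pair, map_neg, map_neg]
        ring
      dX_P := fun x hx y hy w => by
        rw [dP x hx y hy, dP x hx y hy, dF x hx y hy, neg_zero,
          S.dX_P x hx _ (neg_ne_zero.2 hy), neg_pair, map_neg, map_neg, map_neg]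
        ring }

/-- The same f serves both solutions: evaluated at −y, the relation for (F, P) is the relation for
the reflected pair at y, since θ and s are odd in y and c is even. -/
theorem exists_pair (S : ProjSystem U ϑ σ F P) (hE : 1 < Module.rank ℝ E)
    (hpos : ∀ x ∈ U, ∀ y, y ≠ 0 → 0 < F (x, y)) (hzero : ∀ x ∈ U, F (x, 0) = 0) :
    ∃ f, ProjPair U ϑ σ f F P (fun q => -F (q.1, -q.2)) (fun q => -P (q.1, -q.2)) := by
  obtain ⟨f, hf, rel⟩ := S.exists_quotient hE
  refine ⟨f, S, S.reflect, hf, rel, fun x hx y hy => ?_, hpos, fun _ _ _ => rfl, hzero⟩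
  have := rel x hx (-y) (neg_ne_zero.2 hy)
  simp only [map_neg, neg_apply] at this
  linear_combination this

end ProjSystem

namespace IsLinQuad

variable {B M : E → ℝ}

theorem smul (h : IsLinQuad B M) (hB : ∀ c : ℝ, 0 < c → ∀ y, B (c • y) = c * B y) (c : ℝ) (y : E) :
    B (c • y) = c * B y := by
  have h0 : B 0 = 0 := by simpa using h.add 0 0
  have hn : ∀ z, B (-z) = -B z := fun z => by
    have := h.add z (-z)
    rw [add_neg_cancel, h0] at this
    linarith
  rcases lt_trichotomy c 0 with hc | rfl | hc
  · have := hB (-c) (neg_pos.2 hc) y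
    rw [neg_smul, hn] at this
    linarith
  · simp [h0]
  · exact hB c hc y

end IsLinQuad

/-- The hypothesis with s = 1, t = −1 is the parallelogram law, and additivity of the polar form
follows by the argument of Jordan and von Neumann. -/
theorem exists_quadraticForm {N : E → ℝ}
    (h : ∀ (y z : E) (s t : ℝ),
      N (s • y + t • z) = s ^ 2 * N y + t ^ 2 * N z + s * t * (N (y + z) - N y - N z)) :
    ∃ q : QuadraticForm ℝ E, ∀ y, q y = N y := by
  have smul : ∀ (s : ℝ) y, N (s • y) = s ^ 2 * N y := fun s y => by
    simpa using h y 0 s 0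
  have par : ∀ y z, N (y + z) + N (y - z) = 2 * N y + 2 * N z := fun y z => by
    have := h y z 1 (-1)
    simp only [one_smul, neg_smul, ← sub_eq_add_neg] at this
    linarith
  have even : ∀ y, N (-y) = N y := fun y => by simpa using smul (-1) y
  refine ⟨QuadraticMap.ofPolar N (fun s y => by rw [smul, smul_eq_mul, sq]) ?_ ?_, fun y => rfl⟩
  · intro y z w
    have h1 := par (y + w) z
    have h2 := par (y + z) w
    have h3 := par y (w - z)
    have h4 := par w z
    rw [add_right_comm] at h1
    rw [show y + (w - z) = y + w - z by abel, show y - (w - z) = y + z - w by abel] at h3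
    have e : N (w + z) = N (z + w) := by rw [add_comm]
    simp only [QuadraticMap.polar]
    linarith
  · intro s y z
    have := h y z s 1
    simp only [one_smul] at this
    simp only [QuadraticMap.polar, smul_eq_mul, smul]
    rw [this]
    ring

/-- A metric whose odd part is linear and for which `F(x, y) F(x, -y)` is quadratic
is a Randers metric. -/
theorem isRandersMetric_of_isLinQuad {n : ℕ} {U : Set (Fin n → ℝ)}
    {F : (Fin n → ℝ) → (Fin n → ℝ) → ℝ}
    (hsm : ∀ y, ContDiffOn ℝ ∞ (fun x => F x y) U)
    (hpos : ∀ x ∈ U, ∀ y, y ≠ 0 → 0 < F x y) (hzero : ∀ x ∈ U, F x 0 = 0)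
    (hhom : ∀ x ∈ U, ∀ c : ℝ, 0 < c → ∀ y, F x (c • y) = c * F x y)
    (h : ∀ x ∈ U, IsLinQuad (fun y => F x y + -F x (-y)) (fun y => F x y * -F x (-y))) :
    IsRandersMetric U F := by
  -- N is α². With G = −F(x, −y) it equals (F + G)²/4 − FG, hence is quadratic.
  set N : (Fin n → ℝ) → (Fin n → ℝ) → ℝ := fun x y => ((F x y + F x (-y)) / 2) ^ 2 with hN
  have hBs : ∀ x ∈ U, ∀ (c : ℝ) y, F x (c • y) + -F x (-(c • y)) = c * (F x y + -F x (-y)) :=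
    fun x hx => (h x hx).smul fun c hc y => by
      simp only [← smul_neg, hhom x hx c hc]; ring
  have hquad : ∀ x ∈ U, ∃ q : QuadraticForm ℝ (Fin n → ℝ), ∀ y, q y = N x y := by
    intro x hx
    apply exists_quadraticForm
    intro y z s t
    have a1 := (h x hx).add (s • y) (t • z)
    have a2 := (h x hx).add y z
    have m := (h x hx).quad y z s t
    simp only [hBs x hx] at a1 a2 m
    have key : ∀ v, N x v = (F x v + -F x (-v)) ^ 2 / 4 - F x v * -F x (-v) := fun v => by
      simp only [hN]; ring
    rw [key (s • y + t • z), key (y + z), a1, a2, m, key, key]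
    ring
  have hNpos : ∀ x ∈ U, ∀ y, y ≠ 0 → 0 < N x y := fun x hx y hy => by
    have h1 := hpos x hx y hy
    have h2 := hpos x hx (-y) (neg_ne_zero.2 hy)
    simp only [hN]; positivity
  have hroot : ∀ x ∈ U, ∀ y, √(N x y) = (F x y + F x (-y)) / 2 := fun x hx y => by
    refine Real.sqrt_sq ?_
    rcases eq_or_ne y 0 with rfl | hy
    · simp [hzero x hx]
    · linarith [hpos x hx y hy, hpos x hx (-y) (neg_ne_zero.2 hy)]
  set a : (Fin n → ℝ) → Matrix (Fin n) (Fin n) ℝ := fun x => Matrix.of fun i j =>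
    (N x (Pi.single i 1 + Pi.single j 1) - N x (Pi.single i 1) - N x (Pi.single j 1)) / 2 with ha
  set b : (Fin n → ℝ) → (Fin n → ℝ) := fun x i =>
    (F x (Pi.single i 1) - F x (-Pi.single i 1)) / 2 with hb
  have hNa : ∀ x ∈ U, ∀ y, ∑ i, ∑ j, a x i j * y i * y j = N x y := by
    intro x hx y
    obtain ⟨q, hq⟩ := hquad x hx
    have h1 : q.polarBilin y y = 2 * N x y := by
      rw [← hq, QuadraticMap.polarBilin_apply_apply, QuadraticMap.polar_self, two_nsmul, two_mul]
    have h2 : q.polarBilin y y = ∑ i, ∑ j, 2 * (a x i j * y i * y j) := by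
      conv_lhs => rw [pi_eq_sum_univ' y]
      simp only [map_sum, LinearMap.sum_apply, map_smul, LinearMap.smul_apply, smul_eq_mul,
        Finset.mul_sum]
      rw [Finset.sum_comm]
      refine Finset.sum_congr rfl fun i _ => Finset.sum_congr rfl fun j _ => ?_
      simp only [QuadraticMap.polarBilin_apply_apply, QuadraticMap.polar, hq, ha, Matrix.of_apply]
      ring
    simp only [← Finset.mul_sum] at h2
    linarith
  have hBb : ∀ x ∈ U, ∀ y, (F x y - F x (-y)) / 2 = ∑ i, b x i * y i := by
    intro x hx y
    let L : (Fin n → ℝ) →ₗ[ℝ] ℝ :=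
      { toFun := fun y => F x y + -F x (-y)
        map_add' := (h x hx).add
        map_smul' := hBs x hx }
    have : L y = ∑ i, y i * L (Pi.single i 1) := by
      conv_lhs => rw [pi_eq_sum_univ' y]
      simp only [map_sum, map_smul, smul_eq_mul]
    have e : F x y - F x (-y) = ∑ i, y i * L (Pi.single i 1) := this
    rw [e, Finset.sum_div]
    refine Finset.sum_congr rfl fun i _ => ?_
    simp only [hb, L, LinearMap.coe_mk, AddHom.coe_mk]
    ring
  have hdot : ∀ x ∈ U, ∀ y, y ⬝ᵥ (a x).mulVec y = N x y := fun x hx y => by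
    rw [← hNa x hx y]
    simp only [dotProduct, Matrix.mulVec, Finset.mul_sum]
    exact Finset.sum_congr rfl fun i _ => Finset.sum_congr rfl fun j _ => by ring
  have hPD : ∀ x ∈ U, (a x).PosDef := fun x hx => by
    refine Matrix.PosDef.of_dotProduct_mulVec_pos ?_ fun y hy => ?_
    · ext i j
      simp only [ha, Matrix.conjTranspose_apply, Matrix.of_apply, star_trivial]
      rw [add_comm (Pi.single j 1 : Fin n → ℝ)]
      ring
    · rw [star_trivial, hdot x hx]
      exact hNpos x hx y hy
  have hFx : ∀ x ∈ U, ∀ y, F x y = √(N x y) + ∑ i, b x i * y i := fun x hx y => by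
    rw [← hBb x hx, hroot x hx]; ring
  have hNs : ∀ y, ContDiffOn ℝ ∞ (fun x => N x y) U := fun y =>
    (((hsm y).add (hsm (-y))).div_const 2).pow 2
  refine ⟨a, b, fun i j => (((hNs _).sub (hNs _)).sub (hNs _)).div_const 2,
    contDiffOn_pi.2 fun i => ((hsm _).sub (hsm _)).div_const 2, hPD, fun x hx => ?_,
    fun x hx y => by rw [hNa x hx, hFx x hx]⟩
  -- For the vector y dual to β one has ‖β‖² = N(y) = β(y). If y ≠ 0, then 0 < F(−y) = √N(y) − N(y),
  -- which forces √N(y) < 1.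
  set y := (a x)⁻¹.mulVec (b x) with hy
  have hay : (a x).mulVec y = b x := by
    rw [hy, Matrix.mulVec_mulVec, Matrix.mul_nonsing_inv _
      ((Matrix.isUnit_iff_isUnit_det _).1 (hPD x hx).isUnit), Matrix.one_mulVec]
  have hs : ∑ i, ∑ j, (a x)⁻¹ i j * b x i * b x j = N x y := by
    rw [← hdot x hx, hay, dotProduct_comm, hy]
    simp only [dotProduct, Matrix.mulVec, Finset.mul_sum]
    exact Finset.sum_congr rfl fun i _ => Finset.sum_congr rfl fun j _ => by ring
  have hby : ∑ i, b x i * y i = N x y := by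
    rw [← hdot x hx, hay, dotProduct_comm]; rfl
  rw [hs]
  rcases eq_or_ne y 0 with h0 | h0
  · simp [h0, hN, hzero x hx]
  · have h1 := hpos x hx (-y) (neg_ne_zero.2 h0)
    have h2 := hFx x hx (-y)
    have h3 : N x (-y) = N x y := by simp only [hN, neg_neg]; ring
    simp only [h3, Pi.neg_apply, mul_neg, Finset.sum_neg_distrib, hby] at h2
    have h4 := Real.sq_sqrt (hNpos x hx y h0).le
    have h5 := Real.sqrt_pos.2 (hNpos x hx y h0)
    by_contra! hcon
    nlinarith

end

/-! ### Partial derivatives and geodesics -/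

section

section Calculus

variable {n : ℕ} {U : Set (Fin n → ℝ)} {f g : (Fin n → ℝ) → (Fin n → ℝ) → ℝ}

/-- Smoothness on the slit tangent bundle of `U`. -/
def SlitSmooth (U : Set (Fin n → ℝ)) (f : (Fin n → ℝ) → (Fin n → ℝ) → ℝ) : Prop :=
  ContDiffOn ℝ ∞ (Function.uncurry f) (U ×ˢ {0}ᶜ)

theorem apply_eq_sum {V : Type*} [AddCommGroup V] [Module ℝ V] (L : (Fin n → ℝ) →ₗ[ℝ] V)
    (w : Fin n → ℝ) : L w = ∑ k, w k • L (Pi.single k 1) := by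
  conv_lhs => rw [pi_eq_sum_univ' w]
  simp only [map_sum, map_smul]

theorem sum_fst (L : (Fin n → ℝ) × (Fin n → ℝ) →L[ℝ] ℝ) (w : Fin n → ℝ) :
    ∑ k, L (Pi.single k 1, 0) * w k = L (w, 0) := by
  have := apply_eq_sum (L.toLinearMap ∘ₗ LinearMap.inl ℝ (Fin n → ℝ) (Fin n → ℝ)) w
  simp only [LinearMap.comp_apply, LinearMap.inl_apply, smul_eq_mul] at this
  simpa [mul_comm] using this.symm

theorem sum_snd (L : (Fin n → ℝ) × (Fin n → ℝ) →L[ℝ] ℝ) (w : Fin n → ℝ) :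
    ∑ k, L (0, Pi.single k 1) * w k = L (0, w) := by
  have := apply_eq_sum (L.toLinearMap ∘ₗ LinearMap.inr ℝ (Fin n → ℝ) (Fin n → ℝ)) w
  simp only [LinearMap.comp_apply, LinearMap.inr_apply, smul_eq_mul] at this
  simpa [mul_comm] using this.symm

theorem dX_of_differentiableAt {x y : Fin n → ℝ} (k : Fin n)
    (h : DifferentiableAt ℝ (Function.uncurry f) (x, y)) :
    dX k f x y = fderiv ℝ (Function.uncurry f) (x, y) (Pi.single k 1, 0) := by
  have := (HasFDerivAt.comp x (g := Function.uncurry f) (f := fun z => (z, y)) h.hasFDerivAt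
    ((hasFDerivAt_id x).prodMk (hasFDerivAt_const y x))).fderiv
  have h2 := congrArg (fun L => L (Pi.single k 1)) this
  simpa using! h2

theorem dY_of_differentiableAt {x y : Fin n → ℝ} (k : Fin n)
    (h : DifferentiableAt ℝ (Function.uncurry f) (x, y)) :
    dY k f x y = fderiv ℝ (Function.uncurry f) (x, y) (0, Pi.single k 1) := by
  have := (HasFDerivAt.comp y (g := Function.uncurry f) (f := fun z => (x, z)) h.hasFDerivAt
    ((hasFDerivAt_const x y).prodMk (hasFDerivAt_id y))).fderiv
  have h2 := congrArg (fun L => L (Pi.single k 1)) this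
  simpa using! h2

namespace SlitSmooth

variable {x y : Fin n → ℝ}

theorem contDiffAt (hf : SlitSmooth U f) (hU : IsOpen U) (hx : x ∈ U) (hy : y ≠ 0) :
    ContDiffAt ℝ ∞ (Function.uncurry f) (x, y) :=
  ContDiffOn.contDiffAt hf (slit_mem_nhds hU hx hy)

theorem differentiableAt (hf : SlitSmooth U f) (hU : IsOpen U) (hx : x ∈ U) (hy : y ≠ 0) :
    DifferentiableAt ℝ (Function.uncurry f) (x, y) :=
  (hf.contDiffAt hU hx hy).differentiableAt (by simp)

theorem dX_eq (hf : SlitSmooth U f) (hU : IsOpen U) (hx : x ∈ U) (hy : y ≠ 0) (k : Fin n) :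
    dX k f x y = fderiv ℝ (Function.uncurry f) (x, y) (Pi.single k 1, 0) :=
  dX_of_differentiableAt k (hf.differentiableAt hU hx hy)

theorem dY_eq (hf : SlitSmooth U f) (hU : IsOpen U) (hx : x ∈ U) (hy : y ≠ 0) (k : Fin n) :
    dY k f x y = fderiv ℝ (Function.uncurry f) (x, y) (0, Pi.single k 1) :=
  dY_of_differentiableAt k (hf.differentiableAt hU hx hy)

theorem fderiv_apply (hf : SlitSmooth U f) (hU : IsOpen U) (d : (Fin n → ℝ) × (Fin n → ℝ)) :
    ContDiffOn ℝ ∞ (fun q => fderiv ℝ (Function.uncurry f) q d) (U ×ˢ {0}ᶜ) :=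
  (ContDiffOn.fderiv_of_isOpen hf (isOpen_slit hU) (by simp)).clm_apply contDiffOn_const

theorem dX (hf : SlitSmooth U f) (hU : IsOpen U) (k : Fin n) : SlitSmooth U (dX k f) :=
  (hf.fderiv_apply hU (Pi.single k 1, 0)).congr fun _ hq => hf.dX_eq hU hq.1 hq.2 k

theorem dY (hf : SlitSmooth U f) (hU : IsOpen U) (k : Fin n) : SlitSmooth U (dY k f) :=
  (hf.fderiv_apply hU (0, Pi.single k 1)).congr fun _ hq => hf.dY_eq hU hq.1 hq.2 k

theorem fderiv_dY (hf : SlitSmooth U f) (hU : IsOpen U) (hx : x ∈ U) (hy : y ≠ 0) (k : Fin n)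
    (e : (Fin n → ℝ) × (Fin n → ℝ)) :
    fderiv ℝ (Function.uncurry (Finsler.dY k f)) (x, y) e =
      fderiv ℝ (fderiv ℝ (Function.uncurry f)) (x, y) e (0, Pi.single k 1) := by
  have h := (hasFDerivAt_fderiv_apply (hf.contDiffAt hU hx hy) (0, Pi.single k 1))
  have h' := h.congr_of_eventuallyEq (f₁ := Function.uncurry (Finsler.dY k f)) (by
    filter_upwards [slit_mem_nhds hU hx hy] with q hq using hf.dY_eq hU hq.1 hq.2 k)
  rw [h'.fderiv]; rfl

theorem dX_dY_eq (hf : SlitSmooth U f) (hU : IsOpen U) (hx : x ∈ U) (hy : y ≠ 0) (k l : Fin n) :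
    Finsler.dX l (Finsler.dY k f) x y = fderiv ℝ (fderiv ℝ (Function.uncurry f)) (x, y)
      (Pi.single l 1, 0) (0, Pi.single k 1) := by
  rw [(hf.dY hU k).dX_eq hU hx hy, hf.fderiv_dY hU hx hy]

theorem dY_dY_eq (hf : SlitSmooth U f) (hU : IsOpen U) (hx : x ∈ U) (hy : y ≠ 0) (k l : Fin n) :
    Finsler.dY l (Finsler.dY k f) x y = fderiv ℝ (fderiv ℝ (Function.uncurry f)) (x, y)
      (0, Pi.single l 1) (0, Pi.single k 1) := by
  rw [(hf.dY hU k).dY_eq hU hx hy, hf.fderiv_dY hU hx hy]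

end SlitSmooth

theorem hasFDerivAt_spray {f : (Fin n → ℝ) × (Fin n → ℝ) → ℝ} {x y : Fin n → ℝ}
    (hf : ContDiffAt ℝ ∞ f (x, y)) (e : (Fin n → ℝ) × (Fin n → ℝ)) :
    DifferentiableAt ℝ (fun q => fderiv ℝ f q (q.2, 0)) (x, y) ∧
    fderiv ℝ (fun q => fderiv ℝ f q (q.2, 0)) (x, y) e =
      fderiv ℝ (fderiv ℝ f) (x, y) e (y, 0) + fderiv ℝ f (x, y) (e.2, 0) := by
  have h1 : DifferentiableAt ℝ (fderiv ℝ f) (x, y) :=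
    (hf.fderiv_right (m := 1) (by
      rw [one_add_one_eq_two]; exact WithTop.coe_le_coe.2 (le_top : (2 : ℕ∞) ≤ ⊤))).differentiableAt
      (by simp)
  have h2 : HasFDerivAt (fun q : (Fin n → ℝ) × (Fin n → ℝ) => (q.2, (0 : Fin n → ℝ)))
      ((ContinuousLinearMap.snd ℝ _ _).prod 0) (x, y) :=
    hasFDerivAt_snd.prodMk (hasFDerivAt_const _ _)
  have h3 := h1.hasFDerivAt.clm_apply h2
  refine ⟨h3.differentiableAt, ?_⟩
  rw [h3.fderiv]
  simp [add_comm]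

/-- Euler's relation for the `y`-derivatives of a positively homogeneous function. -/
theorem fderiv_fderiv_radial (hU : IsOpen U) {f : (Fin n → ℝ) × (Fin n → ℝ) → ℝ}
    (hf : ContDiffOn ℝ ∞ f (U ×ˢ {0}ᶜ)) (k : ℕ)
    (hom : ∀ x ∈ U, ∀ y, y ≠ 0 → ∀ c : ℝ, 0 < c → f (x, c • y) = c ^ k * f (x, y))
    {x y : Fin n → ℝ} (hx : x ∈ U) (hy : y ≠ 0) (e : (Fin n → ℝ) × (Fin n → ℝ)) :
    fderiv ℝ (fderiv ℝ f) (x, y) e (0, y) + fderiv ℝ f (x, y) (0, e.2)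
      = k * fderiv ℝ f (x, y) e := by
  have hfa := hf.contDiffAt (slit_mem_nhds hU hx hy)
  have h1 : DifferentiableAt ℝ (fderiv ℝ f) (x, y) :=
    (hfa.fderiv_right (m := 1) (by
      rw [one_add_one_eq_two]; exact WithTop.coe_le_coe.2 (le_top : (2 : ℕ∞) ≤ ⊤))).differentiableAt
      (by simp)
  have h2 : HasFDerivAt (fun q : (Fin n → ℝ) × (Fin n → ℝ) => ((0 : Fin n → ℝ), q.2))
      ((0 : (Fin n → ℝ) × (Fin n → ℝ) →L[ℝ] (Fin n → ℝ)).prod (ContinuousLinearMap.snd ℝ _ _))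
      (x, y) :=
    (hasFDerivAt_const _ _).prodMk hasFDerivAt_snd
  have h3 := h1.hasFDerivAt.clm_apply h2
  have h4 := ((hfa.differentiableAt (by simp)).hasFDerivAt.const_mul (k : ℝ)).congr_of_eventuallyEq
    (f₁ := fun q => fderiv ℝ f q (0, q.2)) (by
      filter_upwards [slit_mem_nhds hU hx hy] with q hq
      exact fderiv_radial k
        ((hf.contDiffAt (slit_mem_nhds hU hq.1 hq.2)).differentiableAt (by simp)) (hom q.1 hq.1 q.2 hq.2))
  have := congrArg (fun L => L e) (h3.unique h4)
  simp at this
  linarith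

end Calculus

/-! ### Smoothness of the geodesic spray and existence of geodesics -/

section Geodesics

variable {n : ℕ} {U : Set (Fin n → ℝ)} {F : (Fin n → ℝ) → (Fin n → ℝ) → ℝ}

namespace IsFinslerMetric

theorem slitSmooth (hF : IsFinslerMetric U F) : SlitSmooth U F := hF.smooth

theorem slitSmooth_sqF (hF : IsFinslerMetric U F) : SlitSmooth U (sqF F) := hF.smooth.pow 2

theorem slitSmooth_fundTensor (hF : IsFinslerMetric U F) (hU : IsOpen U) (i j : Fin n) :
    SlitSmooth U (fun x y => fundTensor F x y i j) :=
  ContDiffOn.mul contDiffOn_const ((hF.slitSmooth_sqF.dY hU i).dY hU j)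

theorem contDiffOn_det {k : ℕ} {V : Type*} [NormedAddCommGroup V] [NormedSpace ℝ V] {s : Set V}
    {A : V → Matrix (Fin k) (Fin k) ℝ} (hA : ∀ i j, ContDiffOn ℝ ∞ (fun q => A q i j) s) :
    ContDiffOn ℝ ∞ (fun q => (A q).det) s := by
  simp only [Matrix.det_apply']
  exact ContDiffOn.sum fun τ _ => contDiffOn_const.mul (contDiffOn_prod fun i _ => hA _ _)

/-- Cramer's rule: adjugate over determinant, the latter being positive by strong convexity. -/
theorem slitSmooth_inv (hF : IsFinslerMetric U F) (hU : IsOpen U) (i j : Fin n) :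
    SlitSmooth U (fun x y => (fundTensor F x y)⁻¹ i j) := by
  have h : ∀ i j, ContDiffOn ℝ ∞ (fun q : (Fin n → ℝ) × (Fin n → ℝ) => fundTensor F q.1 q.2 i j)
      (U ×ˢ {0}ᶜ) := fun i j => hF.slitSmooth_fundTensor hU i j
  have h1 := contDiffOn_det h
  have h2 : ContDiffOn ℝ ∞ (fun q : (Fin n → ℝ) × (Fin n → ℝ) =>
      (fundTensor F q.1 q.2).adjugate i j) (U ×ˢ {0}ᶜ) := by
    simp only [Matrix.adjugate_apply]
    refine contDiffOn_det fun k l => ?_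
    by_cases hk : k = j
    · subst hk; simpa using contDiffOn_const
    · simpa [Matrix.updateRow_apply, hk] using h k l
  have h3 : ContDiffOn ℝ ∞ (fun q : (Fin n → ℝ) × (Fin n → ℝ) =>
      (fundTensor F q.1 q.2).det⁻¹ * (fundTensor F q.1 q.2).adjugate i j) (U ×ˢ {0}ᶜ) :=
    (h1.inv fun q hq => (hF.strongly_convex q.1 hq.1 q.2 hq.2).det_pos.ne').mul h2
  refine h3.congr fun q _ => ?_
  simp [Function.uncurry, Matrix.inv_def]

theorem slitSmooth_geodCoeff (hF : IsFinslerMetric U F) (hU : IsOpen U) (i : Fin n) :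
    SlitSmooth U (geodCoeff F i) := by
  have hΦ := hF.slitSmooth_sqF
  refine contDiffOn_const.mul (ContDiffOn.sum fun l _ => (hF.slitSmooth_inv hU i l).mul ?_)
  exact (ContDiffOn.sum fun m _ => ((hΦ.dY hU l).dX hU m).mul
    ((contDiff_apply ℝ ℝ m).comp contDiff_snd).contDiffOn).sub (hΦ.dX hU l)

end IsFinslerMetric

theorem mem_of_hasDerivAt {V : Type*} [NormedAddCommGroup V] [NormedSpace ℝ V] (W : Submodule ℝ V)
    (hW : IsClosed (W : Set V)) {γ : ℝ → V} {v : V} {t : ℝ} (h : HasDerivAt γ v t)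
    (hγ : ∀ᶠ s in 𝓝 t, γ s - γ t ∈ W) : v ∈ W := by
  refine hW.mem_of_tendsto h.tendsto_slope ?_
  filter_upwards [hγ.filter_mono nhdsWithin_le_nhds] with s hs
  exact W.smul_mem _ hs

/-- Picard–Lindelöf for the first order system x' = v, v' = −2G(x, v). The time interval is shrunk
so that the solution stays in U with nonzero velocity. -/
theorem IsFinslerMetric.exists_geodesic (hF : IsFinslerMetric U F) (hU : IsOpen U)
    {x v : Fin n → ℝ} (hx : x ∈ U) (hv : v ≠ 0) :
    ∃ (I : Set ℝ) (γ : ℝ → (Fin n → ℝ)), IsGeodesicOn U F I γ ∧ (0 : ℝ) ∈ I ∧ γ 0 = x ∧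
      deriv γ 0 = v := by
  set X : (Fin n → ℝ) × (Fin n → ℝ) → (Fin n → ℝ) × (Fin n → ℝ) :=
    fun q => (q.2, fun i => -(2 * geodCoeff F i q.1 q.2)) with hX
  have hXs : ContDiffAt ℝ 1 X (x, v) := by
    refine contDiffAt_snd.prodMk (contDiffAt_pi.2 fun i => ?_)
    exact (contDiffAt_const.mul (((hF.slitSmooth_geodCoeff hU i).contDiffAt hU hx hv).of_le
      (by exact_mod_cast le_top))).neg
  obtain ⟨α, h0, ε, hε, hα⟩ :=
    hXs.exists_forall_mem_closedBall_exists_eq_forall_mem_Ioo_hasDerivAt₀ 0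
  have hcont : ContinuousAt α 0 := (hα 0 (by constructor <;> linarith)).continuousAt
  have hev : ∀ᶠ t in 𝓝 (0 : ℝ), α t ∈ U ×ˢ ({0}ᶜ : Set (Fin n → ℝ)) :=
    hcont.eventually (by rw [h0]; exact slit_mem_nhds hU hx hv)
  obtain ⟨δ, hδ, hball⟩ := Metric.eventually_nhds_iff_ball.1 hev
  set r := min ε δ
  have hr : 0 < r := lt_min hε hδ
  have hI1 : ∀ t ∈ Ioo (-r) r, HasDerivAt α (X (α t)) t := fun t ht => hα t
    ⟨by linarith [ht.1, min_le_left ε δ], by linarith [ht.2, min_le_left ε δ]⟩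
  have hI2 : ∀ t ∈ Ioo (-r) r, α t ∈ U ×ˢ ({0}ᶜ : Set (Fin n → ℝ)) := fun t ht => hball t (by
    rw [Real.ball_eq_Ioo]
    exact ⟨by linarith [ht.1, min_le_right ε δ], by linarith [ht.2, min_le_right ε δ]⟩)
  have hγ : ∀ t ∈ Ioo (-r) r, HasDerivAt (fun t => (α t).1) (α t).2 t := fun t ht =>
    (hasFDerivAt_fst (𝕜 := ℝ) (p := α t)).comp_hasDerivAt t (hI1 t ht)
  have hγ' : ∀ t ∈ Ioo (-r) r, HasDerivAt (fun t => (α t).2)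
      (fun i => -(2 * geodCoeff F i (α t).1 (α t).2)) t := fun t ht =>
    (hasFDerivAt_snd (𝕜 := ℝ) (p := α t)).comp_hasDerivAt t (hI1 t ht)
  have h0I : (0 : ℝ) ∈ Ioo (-r) r := ⟨by linarith, hr⟩
  refine ⟨Ioo (-r) r, fun t => (α t).1, ⟨isOpen_Ioo, ordConnected_Ioo, fun t ht => (hI2 t ht).1,
    fun t ht => (hγ t ht).differentiableAt, fun t ht => ?_, fun t ht => ?_⟩, h0I,
    congrArg Prod.fst h0,
    by rw [(hγ 0 h0I).deriv, h0]⟩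
  · rw [(hγ t ht).deriv]; exact (hI2 t ht).2
  · rw [(hγ t ht).deriv]
    refine (hγ' t ht).congr_of_eventuallyEq ?_
    filter_upwards [isOpen_Ioo.mem_nhds ht] with s hs using (hγ s hs).deriv

/-- For a projectively flat metric the geodesic coefficients are radial. -/
theorem IsFinslerMetric.exists_projective_factor (hF : IsFinslerMetric U F) (hU : IsOpen U)
    (hflat : IsProjectivelyFlat U F) {x v : Fin n → ℝ} (hx : x ∈ U) (hv : v ≠ 0) :
    ∃ ρ : ℝ, ∀ i, geodCoeff F i x v = ρ * v i := by
  obtain ⟨I, γ, hγ, h0, hγ0, hγ'0⟩ := hF.exists_geodesic hU hx hv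
  obtain ⟨w, hw⟩ := (collinear_iff_of_mem (mem_image_of_mem γ h0)).1 (hflat I γ hγ)
  have hI := fun t (ht : t ∈ I) => hγ.isOpen.mem_nhds ht
  have hcl := (ℝ ∙ w).closed_of_finiteDimensional
  have hpos : ∀ t ∈ I, ∀ s ∈ I, γ s - γ t ∈ ℝ ∙ w := fun t ht s hs => by
    obtain ⟨r₁, h₁⟩ := hw _ (mem_image_of_mem γ hs)
    obtain ⟨r₂, h₂⟩ := hw _ (mem_image_of_mem γ ht)
    rw [h₁, h₂]
    refine Submodule.mem_span_singleton.2 ⟨r₁ - r₂, ?_⟩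
    simp [sub_smul]
  -- A curve contained in a line has velocity and acceleration in the direction of that line; as the
  -- velocity is nonzero, the acceleration −2G is a multiple of it.
  have hvel : ∀ t ∈ I, deriv γ t ∈ ℝ ∙ w := fun t ht =>
    mem_of_hasDerivAt _ hcl (hγ.differentiable t ht).hasDerivAt (by
      filter_upwards [hI t ht] with s hs using hpos t ht s hs)
  have hacc := mem_of_hasDerivAt _ hcl (hγ.geodesic_eq 0 h0) (by
      filter_upwards [hI 0 h0] with s hs using sub_mem (hvel s hs) (hvel 0 h0))
  have hv' := hvel 0 h0
  rw [hγ'0] at hv' hacc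
  rw [hγ0] at hacc
  obtain ⟨c, hc⟩ := Submodule.mem_span_singleton.1 hv'
  obtain ⟨d, hd⟩ := Submodule.mem_span_singleton.1 hacc
  have hc0 : c ≠ 0 := by rintro rfl; exact hv (by rw [← hc, zero_smul])
  refine ⟨-(d / c) / 2, fun i => ?_⟩
  have h1 := congrFun hc i
  have h2 := congrFun hd i
  simp only [Pi.smul_apply, smul_eq_mul] at h1 h2
  rw [← h1]
  field_simp
  linarith

end Geodesics

end

/-! ### The projective factor -/

section

theorem fderiv_base_smul {E : Type*} [NormedAddCommGroup E] [NormedSpace ℝ E] {U : Set E}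
    (hU : IsOpen U) {f : E × E → ℝ}
    (hf : ContDiffOn ℝ ∞ f (U ×ˢ {0}ᶜ)) (k : ℕ)
    (hom : ∀ x ∈ U, ∀ y, y ≠ 0 → ∀ c : ℝ, 0 < c → f (x, c • y) = c ^ k * f (x, y))
    {x y : E} (hx : x ∈ U) (hy : y ≠ 0) {c : ℝ} (hc : 0 < c) (w : E) :
    fderiv ℝ f (x, c • y) (w, 0) = c ^ k * fderiv ℝ f (x, y) (w, 0) := by
  have hcy : c • y ≠ 0 := smul_ne_zero hc.ne' hy
  have h1 := ((hf.contDiffAt (slit_mem_nhds hU hx hcy)).differentiableAt (by simp)).hasFDerivAt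
  have h2 := ((hf.contDiffAt (slit_mem_nhds hU hx hy)).differentiableAt (by simp)).hasFDerivAt
  have h3 := HasFDerivAt.comp (x, y) (g := f) (f := fun q : E × E => (q.1, c • q.2)) h1
    (hasFDerivAt_fst.prodMk (hasFDerivAt_snd.const_smul c))
  have h4 := (h2.const_mul (c ^ k)).congr_of_eventuallyEq
    (f₁ := f ∘ fun q : E × E => (q.1, c • q.2)) (by
      filter_upwards [slit_mem_nhds hU hx hy] with q hq using hom q.1 hq.1 q.2 hq.2 c hc)
  simpa using congrArg (fun L => L (w, 0)) (h3.unique h4)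

variable {n : ℕ} {U : Set (Fin n → ℝ)} {F : (Fin n → ℝ) → (Fin n → ℝ) → ℝ}

/-- The projective factor `P = [F²]_{x^m} y^m / (4 F²)`. -/
noncomputable def projFactor (F : (Fin n → ℝ) → (Fin n → ℝ) → ℝ) (x y : Fin n → ℝ) : ℝ :=
  fderiv ℝ (Function.uncurry (sqF F)) (x, y) (y, 0) / (4 * sqF F x y)

namespace IsFinslerMetric

variable {x y : Fin n → ℝ}

theorem pos (hF : IsFinslerMetric U F) (hx : x ∈ U) (hy : y ≠ 0) : 0 < F x y :=
  (hF.nonneg x hx y).lt_of_ne' fun h => hy ((hF.eq_zero_iff x hx y).1 h)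

theorem sqF_smul (hF : IsFinslerMetric U F) : ∀ x ∈ U, ∀ y, y ≠ 0 → ∀ c : ℝ, 0 < c →
    Function.uncurry (sqF F) (x, c • y) = c ^ 2 * Function.uncurry (sqF F) (x, y) := by
  intro x hx y _ c hc
  simp only [Function.uncurry, sqF, hF.homogeneous x hx y c hc.le]
  ring

theorem fderiv_sqF (hF : IsFinslerMetric U F) (hU : IsOpen U) (hx : x ∈ U) (hy : y ≠ 0)
    (e : (Fin n → ℝ) × (Fin n → ℝ)) :
    fderiv ℝ (Function.uncurry (sqF F)) (x, y) e =
      2 * F x y * fderiv ℝ (Function.uncurry F) (x, y) e := by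
  have h := (hF.slitSmooth.differentiableAt hU hx hy).hasFDerivAt.pow 2
  have h' : HasFDerivAt (Function.uncurry (sqF F)) _ (x, y) := h
  rw [h'.fderiv]
  simp [Function.uncurry]

theorem sum_fundTensor (hF : IsFinslerMetric U F) (hU : IsOpen U) (hx : x ∈ U) (hy : y ≠ 0)
    (u w : Fin n → ℝ) :
    ∑ i, ∑ j, fundTensor F x y i j * u i * w j =
      1 / 2 * fderiv ℝ (fderiv ℝ (Function.uncurry (sqF F))) (x, y) (0, w) (0, u) := by
  set L := fderiv ℝ (fderiv ℝ (Function.uncurry (sqF F))) (x, y)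
  have h1 : ∀ i, ∑ j, fundTensor F x y i j * u i * w j =
      1 / 2 * (L (0, w) (0, Pi.single i 1) * u i) := fun i => by
    have := sum_snd (L.flip (0, Pi.single i 1)) w
    simp only [ContinuousLinearMap.flip_apply] at this
    rw [← this, Finset.sum_mul, Finset.mul_sum]
    refine Finset.sum_congr rfl fun j _ => ?_
    simp only [fundTensor, Matrix.of_apply, hF.slitSmooth_sqF.dY_dY_eq hU hx hy, L]
    ring
  rw [Finset.sum_congr rfl fun i _ => h1 i, ← Finset.mul_sum, sum_snd]

theorem second_sqF_radial (hF : IsFinslerMetric U F) (hU : IsOpen U) (hx : x ∈ U) (hy : y ≠ 0)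
    (e : (Fin n → ℝ) × (Fin n → ℝ)) :
    fderiv ℝ (fderiv ℝ (Function.uncurry (sqF F))) (x, y) e (0, y)
      + fderiv ℝ (Function.uncurry (sqF F)) (x, y) (0, e.2)
      = 2 * fderiv ℝ (Function.uncurry (sqF F)) (x, y) e := by
  exact_mod_cast fderiv_fderiv_radial hU hF.slitSmooth_sqF 2 hF.sqF_smul hx hy e

/-- Lowering the index of Gⁱ = ρyⁱ with g removes the inverse matrix from the definition of Gⁱ, and
Euler's relation identifies 2g(y, ·) with the vertical derivative of F². -/
theorem second_sqF_of_radial (hF : IsFinslerMetric U F) (hU : IsOpen U) (hx : x ∈ U) (hy : y ≠ 0)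
    {ρ : ℝ} (hρ : ∀ i, geodCoeff F i x y = ρ * y i) (w : Fin n → ℝ) :
    fderiv ℝ (fderiv ℝ (Function.uncurry (sqF F))) (x, y) (y, 0) (0, w)
      - fderiv ℝ (Function.uncurry (sqF F)) (x, y) (w, 0)
      = 2 * ρ * fderiv ℝ (Function.uncurry (sqF F)) (x, y) (0, w) := by
  set Φ := Function.uncurry (sqF F) with hΦ
  set L := fderiv ℝ (fderiv ℝ Φ) (x, y) with hL
  have hs := hF.slitSmooth_sqF
  set b : Fin n → ℝ := fun l => 1 / 4 * (L (y, 0) (0, Pi.single l 1) -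
    fderiv ℝ Φ (x, y) (Pi.single l 1, 0)) with hb
  have h1 : (fundTensor F x y)⁻¹.mulVec b = ρ • y := by
    ext i
    rw [Pi.smul_apply, smul_eq_mul, ← hρ i]
    simp only [geodCoeff, Matrix.mulVec, dotProduct, Finset.mul_sum]
    refine Finset.sum_congr rfl fun l _ => ?_
    have h2 := sum_fst (L.flip (0, Pi.single l 1)) y
    simp only [ContinuousLinearMap.flip_apply] at h2
    simp only [hb, ← h2, hs.dX_dY_eq hU hx hy, hs.dX_eq hU hx hy]
    ring
  have h2 : b = (fundTensor F x y).mulVec (ρ • y) := by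
    rw [← h1, Matrix.mulVec_mulVec, Matrix.mul_nonsing_inv _
      ((Matrix.isUnit_iff_isUnit_det _).1 (hF.strongly_convex x hx y hy).isUnit),
      Matrix.one_mulVec]
  have h3 : ∑ i, w i * b i = ρ * (1 / 2 * L (0, y) (0, w)) := by
    rw [h2, ← hF.sum_fundTensor hU hx hy w y]
    simp only [Matrix.mulVec, dotProduct, Finset.mul_sum, Pi.smul_apply, smul_eq_mul]
    exact Finset.sum_congr rfl fun i _ => Finset.sum_congr rfl fun j _ => by ring
  have h4 : ∑ i, w i * b i = 1 / 4 * (L (y, 0) (0, w) - fderiv ℝ Φ (x, y) (w, 0)) := by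
    rw [← sum_snd (L (y, 0)) w, ← sum_fst (fderiv ℝ Φ (x, y)) w, ← Finset.sum_sub_distrib,
      Finset.mul_sum]
    exact Finset.sum_congr rfl fun i _ => by simp only [hb]; ring
  have h5 : L (0, y) (0, w) = fderiv ℝ Φ (x, y) (0, w) := by
    have := hF.second_sqF_radial hU hx hy (0, w)
    rw [second_fderiv_symm (hs.contDiffAt hU hx hy)] at this
    simp only at this
    linarith
  rw [h5] at h3
  linarith

theorem fderiv_sqF_self (hF : IsFinslerMetric U F) (hU : IsOpen U) (hx : x ∈ U) (hy : y ≠ 0) :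
    fderiv ℝ (Function.uncurry (sqF F)) (x, y) (0, y) = 2 * sqF F x y := by
  exact_mod_cast fderiv_radial 2 (hF.slitSmooth_sqF.differentiableAt hU hx hy)
    (hF.sqF_smul x hx y hy)

theorem sqF_pos (hF : IsFinslerMetric U F) (hx : x ∈ U) (hy : y ≠ 0) : 0 < sqF F x y :=
  pow_pos (hF.pos hx hy) 2

/-- Contracting the radial identity with y determines ρ, which so far existed only pointwise, by a
formula that is smooth on the slit bundle. -/
theorem geodCoeff_eq (hF : IsFinslerMetric U F) (hU : IsOpen U) (hflat : IsProjectivelyFlat U F)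
    (hx : x ∈ U) (hy : y ≠ 0) (i : Fin n) : geodCoeff F i x y = projFactor F x y * y i := by
  obtain ⟨ρ, hρ⟩ := hF.exists_projective_factor hU hflat hx hy
  have h1 := hF.second_sqF_of_radial hU hx hy hρ y
  have h2 := hF.second_sqF_radial hU hx hy (y, 0)
  rw [hF.fderiv_sqF_self hU hx hy] at h1
  simp only [Prod.mk_zero_zero, map_zero, add_zero] at h2
  have : projFactor F x y = ρ := by
    rw [projFactor, div_eq_iff (mul_pos four_pos (hF.sqF_pos hx hy)).ne']
    linarith
  rw [hρ, this]

theorem slitSmooth_projFactor (hF : IsFinslerMetric U F) (hU : IsOpen U) :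
    SlitSmooth U (projFactor F) := by
  refine ContDiffOn.div ?_ (contDiffOn_const.mul hF.slitSmooth_sqF) fun q hq =>
    (mul_pos four_pos (hF.sqF_pos hq.1 hq.2)).ne'
  exact (ContDiffOn.fderiv_of_isOpen hF.slitSmooth_sqF (isOpen_slit hU) (by simp)).clm_apply
    (contDiff_snd.prodMk contDiff_const).contDiffOn

theorem projFactor_smul (hF : IsFinslerMetric U F) (hU : IsOpen U) :
    ∀ x ∈ U, ∀ y, y ≠ 0 → ∀ c : ℝ, 0 < c →
      Function.uncurry (projFactor F) (x, c • y) = c * Function.uncurry (projFactor F) (x, y) := by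
  intro x hx y hy c hc
  have h1 := hF.sqF_smul x hx y hy c hc
  have h2 := fderiv_base_smul hU hF.slitSmooth_sqF 2 hF.sqF_smul hx hy hc (c • y)
  have h3 : ((c • y, 0) : (Fin n → ℝ) × (Fin n → ℝ)) = c • (y, 0) := by simp
  have h4 := (hF.sqF_pos hx hy).ne'
  simp only [Function.uncurry_apply_pair] at h1 ⊢
  rw [projFactor, projFactor, h2, h1, h3, map_smul, smul_eq_mul]
  field_simp

/-- Subtracting `second_sqF_of_radial` from the vertical derivative of 4PF² = [F²]_{x^m} y^m cancels
the mixed second derivative. -/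
theorem fderiv_base_eq (hF : IsFinslerMetric U F) (hU : IsOpen U) (hflat : IsProjectivelyFlat U F)
    (hx : x ∈ U) (hy : y ≠ 0) (w : Fin n → ℝ) :
    fderiv ℝ (Function.uncurry F) (x, y) (w, 0) =
      projFactor F x y * fderiv ℝ (Function.uncurry F) (x, y) (0, w)
      + F x y * fderiv ℝ (Function.uncurry (projFactor F)) (x, y) (0, w) := by
  have hs := hF.slitSmooth_sqF
  have hΦ := hs.contDiffAt hU hx hy
  have h1 := hF.second_sqF_of_radial hU hx hy (hF.geodCoeff_eq hU hflat hx hy) w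
  obtain ⟨h2, h3⟩ := hasFDerivAt_spray hΦ (0, w)
  have h4 := (((hF.slitSmooth_projFactor hU).differentiableAt hU hx hy).hasFDerivAt.mul
    (hs.differentiableAt hU hx hy).hasFDerivAt).const_mul 4
  have h5 := h4.congr_of_eventuallyEq
    (f₁ := fun q => fderiv ℝ (Function.uncurry (sqF F)) q (q.2, 0)) (by
      filter_upwards [slit_mem_nhds hU hx hy] with q hq
      have := (hF.sqF_pos hq.1 hq.2).ne'
      simp only [Function.uncurry, Pi.mul_apply, projFactor]
      field_simp)
  have h6 := congrArg (fun L => L (0, w)) (h2.hasFDerivAt.unique h5)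
  simp only [h3] at h6
  rw [second_fderiv_symm hΦ] at h6
  simp [hF.fderiv_sqF hU hx hy, sqF] at h6 h1
  have hp := hF.pos hx hy
  apply mul_left_cancel₀ (mul_pos four_pos hp).ne'
  linear_combination h6 - h1

end IsFinslerMetric

end

/-! ### The curvature of a projectively flat metric -/

section

variable {n : ℕ} {U : Set (Fin n → ℝ)}

/-- The Riemann curvature of a spray with radial coefficients `G^i = P y^i`. -/
theorem riemannCurv_of_radial {F P : (Fin n → ℝ) → (Fin n → ℝ) → ℝ} (hU : IsOpen U)
    (hP : SlitSmooth U P)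
    (hom : ∀ x ∈ U, ∀ y, y ≠ 0 → ∀ c : ℝ, 0 < c →
      Function.uncurry P (x, c • y) = c * Function.uncurry P (x, y))
    (hG : ∀ x ∈ U, ∀ y, y ≠ 0 → ∀ i, geodCoeff F i x y = P x y * y i)
    {x y : Fin n → ℝ} (hx : x ∈ U) (hy : y ≠ 0) (i k : Fin n) :
    riemannCurv F i k x y =
      (P x y ^ 2 - fderiv ℝ (Function.uncurry P) (x, y) (y, 0)) * (Pi.single k 1 : Fin n → ℝ) i
      + (2 * fderiv ℝ (Function.uncurry P) (x, y) (Pi.single k 1, 0)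
        - fderiv ℝ (fderiv ℝ (Function.uncurry P)) (x, y) (y, 0) (0, Pi.single k 1)
        - P x y * fderiv ℝ (Function.uncurry P) (x, y) (0, Pi.single k 1)) * y i := by
  have coord : ∀ (i : Fin n) (q : (Fin n → ℝ) × (Fin n → ℝ)),
      HasFDerivAt (fun q : (Fin n → ℝ) × (Fin n → ℝ) => q.2 i)
        ((ContinuousLinearMap.proj i).comp (ContinuousLinearMap.snd ℝ _ _)) q := fun i q =>
    ((ContinuousLinearMap.proj (R := ℝ) (φ := fun _ : Fin n => ℝ) i).comp
      (ContinuousLinearMap.snd ℝ (Fin n → ℝ) (Fin n → ℝ))).hasFDerivAt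
  have hGs : ∀ i, SlitSmooth U (geodCoeff F i) := fun i =>
    (ContDiffOn.mul hP ((contDiff_apply ℝ ℝ i).comp contDiff_snd).contDiffOn).congr
      fun q hq => hG q.1 hq.1 q.2 hq.2 i
  have first : ∀ (i : Fin n), ∀ x ∈ U, ∀ y, y ≠ 0 → ∀ e,
      fderiv ℝ (Function.uncurry (geodCoeff F i)) (x, y) e =
        fderiv ℝ (Function.uncurry P) (x, y) e * y i + P x y * e.2 i := by
    intro i x hx y hy e
    have h := ((hP.differentiableAt hU hx hy).hasFDerivAt.mul
      (coord i (x, y))).congr_of_eventuallyEq (f₁ := Function.uncurry (geodCoeff F i)) (by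
      filter_upwards [slit_mem_nhds hU hx hy] with q hq using hG q.1 hq.1 q.2 hq.2 i)
    rw [h.fderiv]
    simp [Function.uncurry]
    ring
  have second : ∀ (i : Fin n) (e d),
      fderiv ℝ (fderiv ℝ (Function.uncurry (geodCoeff F i))) (x, y) e d =
        fderiv ℝ (fderiv ℝ (Function.uncurry P)) (x, y) e d * y i
        + fderiv ℝ (Function.uncurry P) (x, y) d * e.2 i
        + fderiv ℝ (Function.uncurry P) (x, y) e * d.2 i := by
    intro i e d
    have h := (((hasFDerivAt_fderiv_apply (hP.contDiffAt hU hx hy) d).mul (coord i (x, y))).add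
      ((hP.differentiableAt hU hx hy).hasFDerivAt.mul_const (d.2 i))).congr_of_eventuallyEq
      (f₁ := fun q => fderiv ℝ (Function.uncurry (geodCoeff F i)) q d) (by
        filter_upwards [slit_mem_nhds hU hx hy] with q hq using first i q.1 hq.1 q.2 hq.2 d)
    have := congrArg (fun L => L e)
      ((hasFDerivAt_fderiv_apply ((hGs i).contDiffAt hU hx hy) d).unique h)
    simp at this
    rw [this]
    ring
  have hom1 : ∀ x ∈ U, ∀ y, y ≠ 0 → ∀ c : ℝ, 0 < c →
      Function.uncurry P (x, c • y) = c ^ 1 * Function.uncurry P (x, y) := by simpa using hom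
  have euler : fderiv ℝ (Function.uncurry P) (x, y) (0, y) = P x y := by
    simpa using fderiv_radial 1 (hP.differentiableAt hU hx hy) (hom1 x hx y hy)
  have euler2 : fderiv ℝ (fderiv ℝ (Function.uncurry P)) (x, y) (0, y) (0, Pi.single k 1) = 0 := by
    have := fderiv_fderiv_radial hU hP 1 hom1 hx hy (0, Pi.single k 1)
    rw [second_fderiv_symm (hP.contDiffAt hU hx hy)] at this
    simpa using this
  have t1 : ∑ l, dX l (dY k (geodCoeff F i)) x y * y l =
      fderiv ℝ (fderiv ℝ (Function.uncurry P)) (x, y) (y, 0) (0, Pi.single k 1) * y i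
      + fderiv ℝ (Function.uncurry P) (x, y) (y, 0) * (Pi.single k 1 : Fin n → ℝ) i := by
    have := sum_fst ((fderiv ℝ (fderiv ℝ (Function.uncurry (geodCoeff F i))) (x, y)).flip
      (0, Pi.single k 1)) y
    simp only [ContinuousLinearMap.flip_apply] at this
    simp only [(hGs i).dX_dY_eq hU hx hy]
    rw [this, second]
    simp
  have t2 : ∑ l, geodCoeff F l x y * dY l (dY k (geodCoeff F i)) x y =
      P x y * (fderiv ℝ (Function.uncurry P) (x, y) (0, Pi.single k 1) * y i
        + P x y * (Pi.single k 1 : Fin n → ℝ) i) := by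
    have := sum_snd ((fderiv ℝ (fderiv ℝ (Function.uncurry (geodCoeff F i))) (x, y)).flip
      (0, Pi.single k 1)) y
    simp only [ContinuousLinearMap.flip_apply] at this
    have h : fderiv ℝ (Function.uncurry P) (x, y) (0, Pi.single k 1) * y i
        + P x y * (Pi.single k 1 : Fin n → ℝ) i =
        fderiv ℝ (fderiv ℝ (Function.uncurry (geodCoeff F i))) (x, y) (0, y)
          (0, Pi.single k 1) := by
      rw [second, euler, euler2]; ring
    rw [h, ← this, Finset.mul_sum]
    refine Finset.sum_congr rfl fun l _ => ?_
    rw [(hGs i).dY_dY_eq hU hx hy, hG x hx y hy]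
    ring
  have t3 : ∑ l, dY l (geodCoeff F i) x y * dY k (geodCoeff F l) x y =
      3 * P x y * fderiv ℝ (Function.uncurry P) (x, y) (0, Pi.single k 1) * y i
        + P x y ^ 2 * (Pi.single k 1 : Fin n → ℝ) i := by
    have s1 := sum_snd (fderiv ℝ (Function.uncurry (geodCoeff F i)) (x, y)) y
    have s2 := sum_snd (fderiv ℝ (Function.uncurry (geodCoeff F i)) (x, y)) (Pi.single k 1)
    rw [first i x hx y hy, euler] at s1
    rw [first i x hx y hy] at s2
    have h : ∀ l, dY l (geodCoeff F i) x y * dY k (geodCoeff F l) x y =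
        fderiv ℝ (Function.uncurry P) (x, y) (0, Pi.single k 1) *
          (fderiv ℝ (Function.uncurry (geodCoeff F i)) (x, y) (0, Pi.single l 1) * y l)
        + P x y * (fderiv ℝ (Function.uncurry (geodCoeff F i)) (x, y) (0, Pi.single l 1)
          * (Pi.single k 1 : Fin n → ℝ) l) := fun l => by
      rw [(hGs i).dY_eq hU hx hy, (hGs l).dY_eq hU hx hy, first l x hx y hy]
      ring
    rw [Finset.sum_congr rfl fun l _ => h l, Finset.sum_add_distrib, ← Finset.mul_sum,
      ← Finset.mul_sum, s1, s2]
    simp only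
    ring
  rw [riemannCurv, t1, t2, t3, (hGs i).dX_eq hU hx hy, first i x hx y hy]
  simp only [Pi.zero_apply]
  ring

/-- A linear form on `ℝⁿ` from its coefficients. -/
noncomputable def coeffForm (c : Fin n → ℝ) : (Fin n → ℝ) →L[ℝ] ℝ :=
  ∑ i, c i • ContinuousLinearMap.proj i

theorem coeffForm_apply (c y : Fin n → ℝ) : coeffForm c y = ∑ i, c i * y i := by
  simp [coeffForm]

theorem contDiffOn_coeffForm {θ : (Fin n → ℝ) → (Fin n → ℝ)} (hθ : ContDiffOn ℝ ∞ θ U) :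
    ContDiffOn ℝ ∞ (fun x => coeffForm (θ x)) U :=
  ContDiffOn.sum fun i _ => (contDiffOn_pi.1 hθ i).smul contDiffOn_const

theorem coeffForm_ne_zero {c : Fin n → ℝ} (hc : c ≠ 0) : coeffForm c ≠ 0 := by
  intro h
  refine hc (funext fun i => ?_)
  have := congrArg (fun L => L (Pi.single i 1)) h
  simpa [coeffForm_apply, Pi.single_apply] using this

namespace IsFinslerMetric

variable {F : (Fin n → ℝ) → (Fin n → ℝ) → ℝ} {x y : Fin n → ℝ}

/-- The curvature data of a projectively flat metric whose flag curvature at the pole `y`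
is a constant `K`. -/
theorem curvature_of_flagCurv (hF : IsFinslerMetric U F) (hU : IsOpen U) (hn : 1 < n)
    (hflat : IsProjectivelyFlat U F) (hx : x ∈ U) (hy : y ≠ 0) {K : ℝ}
    (hK : ∀ u, LinearIndependent ℝ ![y, u] → flagCurv F x y u = K) :
    projFactor F x y ^ 2 - fderiv ℝ (Function.uncurry (projFactor F)) (x, y) (y, 0)
      = K * F x y ^ 2 ∧
    ∀ w, 2 * fderiv ℝ (Function.uncurry (projFactor F)) (x, y) (w, 0)
        - fderiv ℝ (fderiv ℝ (Function.uncurry (projFactor F))) (x, y) (y, 0) (0, w)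
        - projFactor F x y * fderiv ℝ (Function.uncurry (projFactor F)) (x, y) (0, w)
      = -K * F x y * fderiv ℝ (Function.uncurry F) (x, y) (0, w) := by
  set P := projFactor F
  set Ξ := P x y ^ 2 - fderiv ℝ (Function.uncurry P) (x, y) (y, 0) with hΞ
  set τ : (Fin n → ℝ) →ₗ[ℝ] ℝ :=
    (((2 : ℝ) • (fderiv ℝ (Function.uncurry P) (x, y)).comp (ContinuousLinearMap.inl ℝ _ _)
    - (fderiv ℝ (fderiv ℝ (Function.uncurry P)) (x, y) (y, 0)).comp (ContinuousLinearMap.inr ℝ _ _)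
    - P x y • (fderiv ℝ (Function.uncurry P) (x, y)).comp (ContinuousLinearMap.inr ℝ _ _) :
      (Fin n → ℝ) →L[ℝ] ℝ)).toLinearMap with hτ
  have τ_apply : ∀ w, τ w = 2 * fderiv ℝ (Function.uncurry P) (x, y) (w, 0)
        - fderiv ℝ (fderiv ℝ (Function.uncurry P)) (x, y) (y, 0) (0, w)
        - P x y * fderiv ℝ (Function.uncurry P) (x, y) (0, w) := fun w => by simp [hτ]
  set g : (Fin n → ℝ) →ₗ[ℝ] (Fin n → ℝ) →ₗ[ℝ] ℝ :=
    Matrix.toLinearMap₂' ℝ (fundTensor F x y) with hg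
  have g_apply : ∀ u w, g u w = ∑ i, ∑ j, fundTensor F x y i j * u i * w j := fun u w => by
    rw [hg, Matrix.toLinearMap₂'_apply]
    exact Finset.sum_congr rfl fun i _ => Finset.sum_congr rfl fun j _ => by
      simp only [smul_eq_mul]; ring
  have g_eq := fun u w => (g_apply u w).trans (hF.sum_fundTensor hU hx hy u w)
  have hΦ := hF.slitSmooth_sqF.contDiffAt hU hx hy
  have hp := hF.pos hx hy
  have g_symm : ∀ u w, g u w = g w u := fun u w => by
    rw [g_eq, g_eq, second_fderiv_symm hΦ]
  have g_rad : ∀ w, g y w = F x y * fderiv ℝ (Function.uncurry F) (x, y) (0, w) := fun w => by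
    have := hF.second_sqF_radial hU hx hy (0, w)
    rw [g_eq]
    rw [hF.fderiv_sqF hU hx hy] at this
    simp only at this
    linarith
  have g_self : g y y = F x y ^ 2 := by
    have := hF.fderiv_sqF_self hU hx hy
    rw [hF.fderiv_sqF hU hx hy, sqF] at this
    rw [g_rad]; linarith
  have g_pos : ∀ u, u ≠ 0 → 0 < g u u := fun u hu => by
    have := (hF.strongly_convex x hx y hy).dotProduct_mulVec_pos hu
    rw [star_trivial] at this
    convert! this using 1
    rw [g_apply]
    simp only [dotProduct, Matrix.mulVec, Finset.mul_sum]
    exact Finset.sum_congr rfl fun i _ => Finset.sum_congr rfl fun j _ => by ring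
  -- The Riemann curvature is Ξ times the identity plus τ ⊗ y, by `riemannCurv_of_radial`.
  have numerator : ∀ u, ∑ i, ∑ m, ∑ k, fundTensor F x y i m * riemannCurv F i k x y * u k * u m =
      Ξ * g u u + τ u * g y u := fun u => by
    have h1 : ∀ i, ∑ k, riemannCurv F i k x y * u k = Ξ * u i + τ u * y i := fun i => by
      have hτu : τ u = ∑ k, u k * τ (Pi.single k 1) := by
        simpa using apply_eq_sum τ u
      have hR : ∀ k, riemannCurv F i k x y =
          Ξ * (Pi.single k 1 : Fin n → ℝ) i + τ (Pi.single k 1) * y i := fun k => by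
        rw [τ_apply]
        exact riemannCurv_of_radial hU (hF.slitSmooth_projFactor hU)
          (hF.projFactor_smul hU) (fun x hx y hy i => hF.geodCoeff_eq hU hflat hx hy i) hx hy i k
      simp only [hR, hτu, add_mul, Finset.sum_add_distrib]
      congr 1
      · rw [Finset.sum_eq_single i]
        · simp
        · intro k _ hk; simp [hk.symm]
        · simp
      · rw [Finset.sum_mul]
        exact Finset.sum_congr rfl fun k _ => by ring
    rw [g_apply, g_apply, Finset.mul_sum, Finset.mul_sum, ← Finset.sum_add_distrib]
    refine Finset.sum_congr rfl fun i _ => ?_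
    rw [Finset.mul_sum, Finset.mul_sum, ← Finset.sum_add_distrib]
    refine Finset.sum_congr rfl fun m _ => ?_
    have : ∑ k, fundTensor F x y i m * riemannCurv F i k x y * u k * u m =
        fundTensor F x y i m * u m * ∑ k, riemannCurv F i k x y * u k := by
      rw [Finset.mul_sum]
      exact Finset.sum_congr rfl fun k _ => by ring
    rw [this, h1]
    ring
  have orth : ∀ u, u ≠ 0 → g y u = 0 → Ξ = K * F x y ^ 2 ∧ τ u = 0 ∧ τ y = -K * F x y ^ 2 := by
    intro u hu h0
    have hu2 := g_pos u hu
    -- For u orthogonal to y, the vectors y and cy + u span the same flag for every c. The value c =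
    -- 0 yields Ξ, and c = ±1 separate τ(u) from τ(y).
    have flag : ∀ c : ℝ, Ξ * (c ^ 2 * F x y ^ 2 + g u u) + (c * τ y + τ u) * (c * F x y ^ 2) =
        K * (F x y ^ 2 * g u u) := by
      intro c
      have hli : LinearIndependent ℝ ![y, c • y + u] := by
        rw [LinearIndependent.pair_iff]
        intro s t hst
        have h1 := congrArg (g y) hst
        simp only [map_add, map_smul, smul_eq_mul, h0, g_self, map_zero] at h1
        have h2 : s + t * c = 0 := by
          apply mul_right_cancel₀ (pow_pos hp 2).ne'
          linear_combination h1
        have h3 : t • u = 0 := by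
          rw [← hst, smul_add, smul_smul, ← add_assoc, ← add_smul, h2, zero_smul, zero_add]
        have h4 : t = 0 := (smul_eq_zero.1 h3).resolve_right hu
        exact ⟨by simpa [h4] using h2, h4⟩
      have h1 := hK _ hli
      have a1 : g (c • y + u) (c • y + u) = c ^ 2 * F x y ^ 2 + g u u := by
        simp only [map_add, map_smul, LinearMap.add_apply, LinearMap.smul_apply, smul_eq_mul,
          h0, g_symm u y, g_self]
        ring
      have a2 : g y (c • y + u) = c * F x y ^ 2 := by
        simp only [map_add, map_smul, smul_eq_mul, h0, g_self, add_zero]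
      have a3 : τ (c • y + u) = c * τ y + τ u := by simp
      rw [flagCurv, numerator, ← g_apply, ← g_apply, a1, a2, a3] at h1
      have hden : F x y ^ 2 * (c ^ 2 * F x y ^ 2 + g u u) - (c * F x y ^ 2) ^ 2 =
          F x y ^ 2 * g u u := by ring
      rw [hden, div_eq_iff (by positivity)] at h1
      exact h1
    have h1 : Ξ = K * F x y ^ 2 := by
      apply mul_right_cancel₀ hu2.ne'
      linear_combination flag 0
    have f1 := flag 1
    have f2 := flag (-1)
    rw [h1] at f1 f2
    have hp2 := (pow_pos hp 2).ne'
    refine ⟨h1, mul_right_cancel₀ hp2 ?_, mul_right_cancel₀ hp2 ?_⟩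
    · linear_combination (f1 - f2) / 2
    · linear_combination (f1 + f2) / 2
  -- A nonzero vector orthogonal to y exists because n > 1; it is obtained by projecting a vector
  -- outside the line of y.
  obtain ⟨v, hv, hv0⟩ : ∃ v, v ≠ 0 ∧ g y v = 0 := by
    obtain ⟨z, hz⟩ : ∃ z, z ∉ (ℝ ∙ y) := by
      by_contra! h
      have := finrank_span_singleton (K := ℝ) hy
      rw [(eq_top_iff.2 fun z _ => h z : (ℝ ∙ y) = ⊤), finrank_top,
        Module.finrank_fin_fun] at this
      omega
    refine ⟨z - (g y z / F x y ^ 2) • y, fun h => hz ?_, ?_⟩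
    · rw [sub_eq_zero.1 h]
      exact Submodule.smul_mem _ _ (Submodule.mem_span_singleton_self y)
    · rw [map_sub, map_smul, g_self, smul_eq_mul]
      field_simp
      ring
  obtain ⟨h1, -, h2⟩ := orth v hv hv0
  refine ⟨h1, fun w => ?_⟩
  set c := g y w / F x y ^ 2 with hc
  have hcF : c * F x y ^ 2 = g y w := by rw [hc]; field_simp
  have hw : g y (w - c • y) = 0 := by
    rw [map_sub, map_smul, g_self, smul_eq_mul, hcF, sub_self]
  have hτw : τ (w - c • y) = 0 := by
    rcases eq_or_ne (w - c • y) 0 with h0 | h0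
    · rw [h0, map_zero]
    · exact (orth _ h0 hw).2.1
  rw [map_sub, map_smul, smul_eq_mul, h2] at hτw
  rw [← τ_apply, mul_assoc, ← g_rad]
  linear_combination hτw - K * hcF

/-- The equation for P results from eliminating the mixed second derivative of P between the second
identity of `curvature_of_flagCurv` and the vertical derivative of the first, P² − P_{x^m} y^m = 3θF
+ σF². -/
theorem projSystem (hF : IsFinslerMetric U F) (hU : IsOpen U) (hn : 1 < n)
    (hflat : IsProjectivelyFlat U F) {θ : (Fin n → ℝ) → (Fin n → ℝ)} (hθ : ContDiffOn ℝ ∞ θ U)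
    {σ : (Fin n → ℝ) → ℝ} (hσ : ContDiffOn ℝ ∞ σ U)
    (hK : HasWeaklyIsotropicFlagCurv U F θ σ) :
    ProjSystem U (fun x => coeffForm (θ x)) σ (Function.uncurry F)
      (Function.uncurry (projFactor F)) where
  isOpen := hU
  smooth_form := contDiffOn_coeffForm hθ
  smooth_fun := hσ
  smooth_F := hF.slitSmooth
  smooth_P := hF.slitSmooth_projFactor hU
  hom_F := fun x hx y _ c hc => hF.homogeneous x hx y c hc.le
  hom_P := hF.projFactor_smul hU
  F_ne := fun x hx y hy => (hF.pos hx hy).ne'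
  dX_F := fun x hx y hy w => hF.fderiv_base_eq hU hflat hx hy w
  dX_P := by
    intro x hx y hy w
    have key := fun x hx y hy => hF.curvature_of_flagCurv (x := x) (y := y) hU hn hflat hx hy
      (K := 3 * coeffForm (θ x) y / F x y + σ x)
      (fun u hu => by rw [hK x hx y u hu, coeffForm_apply])
    have e1 := (key x hx y hy).2 w
    have hP := hF.slitSmooth_projFactor hU
    obtain ⟨h2, h3⟩ := hasFDerivAt_spray (hP.contDiffAt hU hx hy) (0, w)
    have hF1 := (hF.slitSmooth.differentiableAt hU hx hy).hasFDerivAt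
    have hϑ := ((contDiffOn_coeffForm hθ).contDiffAt (hU.mem_nhds hx)).differentiableAt
      (by simp)
    have hσ1 := (hσ.contDiffAt (hU.mem_nhds hx)).differentiableAt (by simp)
    have h4 := ((hP.differentiableAt hU hx hy).hasFDerivAt.pow 2).sub
      ((((hasFDerivAt_form (y := y) hϑ).const_mul 3).mul hF1).add
        ((hasFDerivAt_base (y := y) hσ1).mul (hF1.pow 2)))
    have h5 := h4.congr_of_eventuallyEq
      (f₁ := fun q => fderiv ℝ (Function.uncurry (projFactor F)) q (q.2, 0)) (by
        filter_upwards [slit_mem_nhds hU hx hy] with q hq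
        have h6 := (key q.1 hq.1 q.2 hq.2).1
        have h7 := (hF.pos hq.1 hq.2).ne'
        have h8 : (3 * coeffForm (θ q.1) q.2 / F q.1 q.2 + σ q.1) * F q.1 q.2 ^ 2 =
            3 * coeffForm (θ q.1) q.2 * F q.1 q.2 + σ q.1 * F q.1 q.2 ^ 2 := by
          field_simp
        rw [h8] at h6
        simp only [Function.uncurry, Pi.sub_apply, Pi.add_apply, Pi.mul_apply]
        linear_combination -h6)
    have e2 := congrArg (fun L => L (0, w)) (h2.hasFDerivAt.unique h5)
    simp only [h3] at e2
    rw [second_fderiv_symm (hP.contDiffAt hU hx hy)] at e2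
    simp at e2
    have h7 := (hF.pos hx hy).ne'
    have h9 : -(3 * coeffForm (θ x) y / F x y + σ x) * F x y *
        fderiv ℝ (Function.uncurry F) (x, y) (0, w) =
        -(3 * coeffForm (θ x) y + σ x * F x y) * fderiv ℝ (Function.uncurry F) (x, y) (0, w) := by
      field_simp
    rw [h9] at e1
    simp only [Function.uncurry_apply_pair]
    linear_combination (e1 + e2) / 3

end IsFinslerMetric

end

/-! ### Randers metrics of weakly isotropic flag curvature -/

section

namespace IsFinslerMetric

variable {n : ℕ} {U : Set (Fin n → ℝ)} {F : (Fin n → ℝ) → (Fin n → ℝ) → ℝ}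

theorem zero_right (hF : IsFinslerMetric U F) {x : Fin n → ℝ} (hx : x ∈ U) : F x 0 = 0 :=
  (hF.eq_zero_iff x hx 0).2 rfl

theorem contDiffOn_slice (hF : IsFinslerMetric U F) (y : Fin n → ℝ) :
    ContDiffOn ℝ ∞ (fun x => F x y) U := by
  rcases eq_or_ne y 0 with rfl | hy
  · exact contDiffOn_const.congr fun x hx => hF.zero_right hx
  · exact hF.smooth.comp (contDiff_id.prodMk contDiff_const).contDiffOn fun x hx => ⟨hx, hy⟩

theorem isRandersMetric (hF : IsFinslerMetric U F)
    (h : ∀ x ∈ U, IsLinQuad (fun y => F x y + -F x (-y)) (fun y => F x y * -F x (-y))) :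
    IsRandersMetric U F :=
  isRandersMetric_of_isLinQuad hF.contDiffOn_slice (fun _ hx _ hy => hF.pos hx hy)
    (fun _ hx => hF.zero_right hx) (fun x hx c hc y => hF.homogeneous x hx y c hc.le) h

end IsFinslerMetric

/-- In dimension one the odd part of a Finsler metric is linear and `F(x, y) F(x, -y)` is
quadratic. -/
theorem isLinQuad_of_dim_one {U : Set (Fin 1 → ℝ)} {F : (Fin 1 → ℝ) → (Fin 1 → ℝ) → ℝ}
    (hF : IsFinslerMetric U F) {x : Fin 1 → ℝ} (hx : x ∈ U) :
    IsLinQuad (fun y => F x y + -F x (-y)) (fun y => F x y * -F x (-y)) := by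
  have val : ∀ y : Fin 1 → ℝ, F x y + -F x (-y) = y 0 * (F x 1 + -F x (-1)) ∧
      F x y * -F x (-y) = y 0 ^ 2 * (F x 1 * -F x (-1)) := by
    intro y
    have hom := hF.homogeneous x hx
    rcases le_total 0 (y 0) with h | h
    · have e1 : y = y 0 • (1 : Fin 1 → ℝ) := by ext i; simp [Subsingleton.elim i 0]
      have e2 : -y = y 0 • (-1 : Fin 1 → ℝ) := by ext i; simp [Subsingleton.elim i 0]
      have a1 : F x y = y 0 * F x 1 := by rw [← hom _ _ h, ← e1]
      have a2 : F x (-y) = y 0 * F x (-1) := by rw [← hom _ _ h, ← e2]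
      rw [a1, a2]
      constructor <;> ring
    · have h' := neg_nonneg.2 h
      have e1 : y = (-y 0) • (-1 : Fin 1 → ℝ) := by ext i; simp [Subsingleton.elim i 0]
      have e2 : -y = (-y 0) • (1 : Fin 1 → ℝ) := by ext i; simp [Subsingleton.elim i 0]
      have a1 : F x y = -y 0 * F x (-1) := by rw [← hom _ _ h', ← e1]
      have a2 : F x (-y) = -y 0 * F x 1 := by rw [← hom _ _ h', ← e2]
      rw [a1, a2]
      constructor <;> ring
  refine ⟨fun y z => ?_, fun y z s t => ?_⟩
  · rw [(val (y + z)).1, (val y).1, (val z).1, Pi.add_apply]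
    ring
  · rw [(val (s • y + t • z)).2, (val (y + z)).2, (val y).2, (val z).2]
    simp only [Pi.add_apply, Pi.smul_apply, smul_eq_mul]
    ring

end

end Finsler

theorem theorem2 {n : ℕ} (U : Set (Fin n → ℝ)) (hU : IsOpen U) (hUc : IsConnected U)
    (F : (Fin n → ℝ) → (Fin n → ℝ) → ℝ) (hF : Finsler.IsFinslerMetric U F)
    (hflat : Finsler.IsProjectivelyFlat U F)
    (θ : (Fin n → ℝ) → (Fin n → ℝ)) (hθ : ContDiffOn ℝ ∞ θ U)
    (σ : (Fin n → ℝ) → ℝ) (hσ : ContDiffOn ℝ ∞ σ U)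
    (hK : Finsler.HasWeaklyIsotropicFlagCurv U F θ σ)
    (hθ0 : ∃ x ∈ U, θ x ≠ 0) :
    Finsler.IsRandersMetric U F := by
  refine hF.isRandersMetric fun x hx => ?_
  -- In dimension zero θ cannot be nonzero. In dimension one there are no flags, but homogeneity
  -- alone suffices. The differential system is used only from dimension two on.
  rcases Nat.lt_trichotomy n 1 with hn | rfl | hn
  · obtain rfl : n = 0 := by omega
    obtain ⟨z, -, hz⟩ := hθ0
    exact absurd (Subsingleton.elim _ _) hz
  · exact Finsler.isLinQuad_of_dim_one hF hx
  · have hE : 1 < Module.rank ℝ (Fin n → ℝ) := by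
      rw [rank_fin_fun]; exact_mod_cast hn
    have S := hF.projSystem hU hn hflat hθ hσ hK
    obtain ⟨f, hf⟩ := S.exists_pair hE (fun x hx y hy => hF.pos hx hy)
      (fun x hx => hF.zero_right hx)
    obtain ⟨z, hz, hz0⟩ := hθ0
    exact hf.isLinQuad hE hUc.isPreconnected ⟨z, hz, Finsler.coeffForm_ne_zero hz0⟩ hx
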